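/- Let $\mathcal X,\mathcal Y$ be metric spaces with their Borel $\sigma$-fields, and let $\mathcal H_{\mathcal X}$, $\mathcal H_{\mathcal Y}$ be reproducing kernel Hilbert spaces of real functions on $\mathcal X$, $\mathcal Y$ with kernels $K$, $L$. Write $(x\otimes y)(h)=\langle x,h\rangle y$. Let $X$, $Y$ be random variables, defined on a common probability space, with values in $\mathcal X$, $\mathcal Y$, such that $K(X,\cdot)$ and $L(Y,\cdot)$ are (strongly measurable) random elements of $\mathcal H_{\mathcal X}$, $\mathcal H_{\mathcal Y}$ (which is automatic if $\mathcal X,\mathcal Y$ are separable and $K$, $L$ continuous), and let $(X_i,Y_i)_{i\ge 1}$ be i.i.d. copies of $(X,Y)$. Put $m_X=\mathbb E(K(X,\cdot))$, $\Sigma_X=\mathbb E(K(X,\cdot)\otimes K(X,\cdot))-m_X\otimes m_X$, and define $m_Y,\Sigma_Y$ likewise from $L$ and $Y$. Put $\overline K_n=\frac1n\sum_{i=1}^nK(X_i,\cdot)$, $\overline L_n=\frac1n\sum_{i=1}^nL(Y_i,\cdot)$, $$\widehat\Sigma_X=\frac1n\sum_{i=1}^n(K(X_i,\cdot)-\overline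 K_n)\otimes(K(X_i,\cdot)-\overline K_n),\qquad \widehat\Sigma_Y=\frac1n\sum_{i=1}^n(L(Y_i,\cdot)-\overline L_n)\otimes(L(Y_i,\cdot)-\overline L_n),$$ $$\widehat\Sigma_{XY}=\frac1n\sum_{i=1}^n(L(Y_i,\cdot)-\overline L_n)\otimes(K(X_i,\cdot)-\overline K_n).$$ Let $(\gamma_n)_{n\ge1}$ be a sequence of strictly positive numbers with $\gamma_n\to0$, and put $$\widehat V_{XY}=(\widehat\Sigma_X+\gamma_n I)^{-1/2}\,\widehat\Sigma_{XY}\,(\widehat\Sigma_Y+\gamma_n I)^{-1/2}.$$ For a positive compact operator $A$ with eigenvalues $\lambda_p(A)$ (counted with multiplicity), $r\in\{1,2\}$ and $\gamma>0$, let $d_r(A,\gamma)=\{\sum_p(\lambda_p(A)+\gamma)^{-r}\lambda_p(A)^r\}^{1/r}$, and put $\widehat D_{r,n}=d_r(\widehat\Sigma_X,\gamma_n)\,d_r(\widehat\Sigma_Y,\gamma_n)$ and $$\widehat T_n=\frac{n\|\widehat V_{XY}\|_{HS}^2-\widehat D_{1,n}}{\sqrt2\,\widehat D_{2,n}}$$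 (read as $0$ when $\widehat D_{2,n}=0$). Assume: (1) $K$ and $L$ are universal, i.e. continuous and such that, on every compact subset, every continuous real function is a uniform limit of restrictions of elements of the reproducing kernel Hilbert space; and $\sup K<\infty$, $\sup L<\infty$; (2) the eigenvalues $\lambda_p$ of $\Sigma_X$ and $\mu_q$ of $\Sigma_Y$, counted with multiplicity, satisfy $\sum_p\lambda_p^{1/2}<\infty$ and $\sum_q\mu_q^{1/2}<\infty$; (3) $\Sigma_X$ and $\Sigma_Y$ have infinitely many strictly positive eigenvalues; (4) $\gamma_n^{-6}n^{-1}\to0$. If $X$ and $Y$ are independent, then $\widehat T_n$ converges in distribution to $\mathcal N(0,1)$ as $n\to\infty$. -/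

import Mathlib

open MeasureTheory ProbabilityTheory Filter Topology InnerProductSpace

namespace NOCCO

noncomputable section

/-! ### Reproducing kernel Hilbert spaces of real functions -/

section RKHS

variable {𝒳 : Type*} (H : Type*) [NormedAddCommGroup H] [InnerProductSpace ℝ H] [CompleteSpace H]
  [RKHS ℝ H 𝒳 ℝ]

/-- The feature map `Φ(x) = K(x, ·) ∈ H` of the reproducing kernel Hilbert space `H`:
`⟪Φ(x), f⟫ = f x` for all `f ∈ H`. -/
def feature (x : 𝒳) : H := RKHS.kerFun H x 1

/-- The reproducing kernel `K(x, y) = ⟪Φ(x), Φ(y)⟫` of `H`. -/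
def kern (x y : 𝒳) : ℝ := ⟪feature H x, feature H y⟫_ℝ

/-- `‖K‖_∞ = sup_{x,y} K(x, y) < ∞`. -/
def BoundedKernel : Prop := BddAbove (Set.range fun p : 𝒳 × 𝒳 => kern H p.1 p.2)

/-- The kernel of `H` is universal: it is continuous and, on every compact subset `Z` of the
underlying space, every continuous function is a uniform limit of (restrictions of) elements
of `H`. For a compact space this is density of `H` in `C(𝒳)`. -/
def UniversalKernel [TopologicalSpace 𝒳] : Prop :=
  Continuous (fun p : 𝒳 × 𝒳 => kern H p.1 p.2) ∧
    ∀ Z : Set 𝒳, IsCompact Z → ∀ f : 𝒳 → ℝ, ContinuousOn f Z →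
      ∀ ε : ℝ, 0 < ε → ∃ h : H, ∀ x ∈ Z, |h x - f x| < ε

/-- The mean element `m_X = E[K(X, ·)]`. -/
def meanElement {Ω : Type*} [MeasurableSpace Ω] (P : Measure Ω) (X : Ω → 𝒳) : H :=
  ∫ ω, feature H (X ω) ∂P

/-- The covariance operator `Σ_X = E[K(X, ·) ⊗ K(X, ·)] - m_X ⊗ m_X`, where
`(x ⊗ y) h = ⟪x, h⟫ y`, that is `x ⊗ y = rankOne ℝ y x`. -/
def covOp {Ω : Type*} [MeasurableSpace Ω] (P : Measure Ω) (X : Ω → 𝒳) : H →L[ℝ] H :=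
  (∫ ω, rankOne ℝ (feature H (X ω)) (feature H (X ω)) ∂P) -
    rankOne ℝ (meanElement H P X) (meanElement H P X)

/-- The empirical mean element of the first `n` points of `x`. -/
def empMean (n : ℕ) (x : ℕ → 𝒳) : H :=
  (n : ℝ)⁻¹ • ∑ i ∈ Finset.range n, feature H (x i)

/-- The empirical covariance operator of the first `n` points of `x`. -/
def empCov (n : ℕ) (x : ℕ → 𝒳) : H →L[ℝ] H :=
  (n : ℝ)⁻¹ • ∑ i ∈ Finset.range n,
    rankOne ℝ (feature H (x i) - empMean H n x) (feature H (x i) - empMean H n x)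

end RKHS

/-! ### Operators on real Hilbert spaces -/

section Operators

variable {E F : Type*} [NormedAddCommGroup E] [InnerProductSpace ℝ E]
  [NormedAddCommGroup F] [InnerProductSpace ℝ F]

/-- An index set for the strictly positive eigenvalues of `A` counted with multiplicity:
pairs `(t, i)` of a strictly positive eigenvalue `t` and `i < dim ker (A - t)`. -/
def PosEig (A : E →L[ℝ] E) : Type :=
  Σ t : {t : ℝ // 0 < t ∧ Module.End.HasEigenvalue (A : E →ₗ[ℝ] E) t},
    Fin (Module.finrank ℝ (Module.End.eigenspace (A : E →ₗ[ℝ] E) t.1))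

/-- The family of strictly positive eigenvalues of `A`, each repeated according to its
multiplicity. For a positive compact operator these are all its nonzero eigenvalues. -/
def eig (A : E →L[ℝ] E) (p : PosEig A) : ℝ := p.1.1

/-- `d_r(A, γ) = (∑_p (λ_p + γ)^{-r} λ_p^r)^{1/r}`, for a positive compact operator `A` with
eigenvalues `λ_p` (counted with multiplicity; zero eigenvalues contribute nothing). -/
def d (r : ℕ) (A : E →L[ℝ] E) (γ : ℝ) : ℝ :=
  (∑' p : PosEig A, ((eig A p + γ) ^ r)⁻¹ * eig A p ^ r) ^ (1 / (r : ℝ))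

open Classical in
/-- `T^{-1/2}` for a positive, boundedly invertible operator `T`: the (unique) positive operator
`B` such that `B²` is the inverse of `T`. -/
def invSqrt [CompleteSpace E] (T : E →L[ℝ] E) : E →L[ℝ] E :=
  if h : ∃ B : E →L[ℝ] E, B.IsPositive ∧ (B ∘L B) ∘L T = ContinuousLinearMap.id ℝ E ∧
      T ∘L (B ∘L B) = ContinuousLinearMap.id ℝ E
  then h.choose else 0

/-- The squared Hilbert-Schmidt norm `‖T‖²_HS = ∑_i ‖T e_i‖²` of a Hilbert-Schmidt operator `T`,
where `(e_i)` is an orthonormal basis (the value does not depend on it). -/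
def hsNormSq [CompleteSpace E] (T : E →L[ℝ] F) : ℝ :=
  ∑' i, ‖T ((exists_hilbertBasis ℝ E).choose_spec.choose i)‖ ^ 2

end Operators

/-! ### The test statistic -/

section Statistic

variable {𝒳 𝒴 : Type*} (HX HY : Type*)
  [NormedAddCommGroup HX] [InnerProductSpace ℝ HX] [CompleteSpace HX] [RKHS ℝ HX 𝒳 ℝ]
  [NormedAddCommGroup HY] [InnerProductSpace ℝ HY] [CompleteSpace HY] [RKHS ℝ HY 𝒴 ℝ]

/-- The empirical cross-covariance operator
`n⁻¹ ∑_i (L(y_i, ·) - L̄_n) ⊗ (K(x_i, ·) - K̄_n)`, from `HY` to `HX`. -/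
def empCrossCov (n : ℕ) (x : ℕ → 𝒳) (y : ℕ → 𝒴) : HY →L[ℝ] HX :=
  (n : ℝ)⁻¹ • ∑ i ∈ Finset.range n,
    rankOne ℝ (feature HX (x i) - empMean HX n x) (feature HY (y i) - empMean HY n y)

/-- The regularised empirical normalized cross-covariance operator
`(Σ̂_X + γ I)^{-1/2} Σ̂_XY (Σ̂_Y + γ I)^{-1/2}`. -/
def empNOCCO (γ : ℝ) (n : ℕ) (x : ℕ → 𝒳) (y : ℕ → 𝒴) : HY →L[ℝ] HX :=
  invSqrt (empCov HX n x + γ • ContinuousLinearMap.id ℝ HX) ∘L empCrossCov HX HY n x y ∘L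
    invSqrt (empCov HY n y + γ • ContinuousLinearMap.id ℝ HY)

/-- `D̂_{r,n} = d_r(Σ̂_X, γ) d_r(Σ̂_Y, γ)`. -/
def empD (r : ℕ) (γ : ℝ) (n : ℕ) (x : ℕ → 𝒳) (y : ℕ → 𝒴) : ℝ :=
  d r (empCov HX n x) γ * d r (empCov HY n y) γ

/-- The statistic `T̂_n = (n ‖V̂_XY‖²_HS - D̂_{1,n}) / (√2 D̂_{2,n})`. -/
def statT (γ : ℝ) (n : ℕ) (x : ℕ → 𝒳) (y : ℕ → 𝒴) : ℝ :=
  (n * hsNormSq (empNOCCO HX HY γ n x y) - empD HX HY 1 γ n x y) /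
    (√2 * empD HX HY 2 γ n x y)

end Statistic

end

end NOCCO

/-!
# Asymptotic normality of the regularised normalized cross-covariance statistic

Write `Σ` for a covariance operator, `R = (Σ + γ)⁻¹` and `u(x) = K(x, ·) - m`, `v(y) = L(y, ·) - m`
for the centred feature maps. The square roots disappear from the Hilbert-Schmidt norm, so that
the statistic is built from quadratic forms only (`statT_eq_gramStat`):
`n ‖V̂‖²` is `n⁻¹ ∑_{i,j} ⟪R̂_X x_i, x_j⟫ ⟪R̂_Y y_i, y_j⟫`, and `d₁`, `d₂²` are the empirical means of
`⟪R̂ x_i, x_i⟫` and `⟪R̂ Σ̂ R̂ x_i, x_i⟫`, where the `x_i`, `y_i` are the empirically centred features.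
Being invariant under translations, it may be computed from `u(X_i)`, `v(Y_i)`.

*Population version.* Replace the empirical operators by `Σ_X`, `Σ_Y` and `D̂₁` by the diagonal
of the double sum. What remains is a `U`-statistic with the kernel
`h_n = ⟪R u(x), u(x')⟫ ⟪R v(y), v(y')⟫`, which integrates to zero in each variable, normalised by
its standard deviation. By independence `∬ h_n²` is the product of `d₂(Σ_X, γ)²` and
`d₂(Σ_Y, γ)²`, and these tend to infinity, because each of the infinitely many positive eigenvalues
`λ` contributes `(λ / (λ + γ))² → 1` (`tendsto_popForm_regSandwich`). The kernel
`∫ h_n(z, t) h_n(w, t) dt` has a second moment of at most `∬ h_n²`, since `Σ R` is a contraction,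
so the eigenvalues of `h_n` are negligible against its `L²` norm and the limit is Gaussian.

*Central limit theorem* (`tendsto_charFun_pairSum`). For the normalised pair sum `W`, expanding
`exp (i t W)` to second order around its value without the index `i`, and summing over `i`, gives
Stein's identity `E[W exp (i t W)] ≈ i t E[exp (i t W)]`
(`DegenerateKernel.norm_integral_mul_cexp_sub_le`). This says that the characteristic function `φ`
of `W` almost solves `φ' = -t φ`, hence is close to `exp (-t²/2)`.

*Approximation.* All the empirical means involved (of `u`, `u ⊗ u`, `u ⊗ v` and of the quadratic
forms) are within `O(n^{-1/2})` of their expectations, up to the powers of `γ⁻¹` that bound the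
forms, by Chebyshev's inequality in a Hilbert space (`measureReal_norm_avg_gt_le`). On this event the resolvent identity bounds the difference of the
two statistics by a multiple of `γ⁻³ n^{-1/2}` (`abs_gramStat_sub_le`), which tends to zero.
Slutsky's lemma concludes.
-/

set_option linter.unusedSectionVars false

namespace NOCCO

/-! ### Bounded measurable functions -/

section BddMeasurable

variable {α β 𝕜 : Type*} [MeasurableSpace α] [MeasurableSpace β] [RCLike 𝕜]

/-- Bounded measurable scalar functions; they form an algebra, are stable under partial
integration and are integrable against every finite measure. -/
def BddMeasurable (f : α → 𝕜) : Prop := Measurable f ∧ ∃ C : ℝ, ∀ x, ‖f x‖ ≤ C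

namespace BddMeasurable

variable {f g : α → 𝕜}

lemma const (c : 𝕜) : BddMeasurable fun _ : α => c := ⟨measurable_const, ‖c‖, fun _ => le_rfl⟩

lemma add (hf : BddMeasurable f) (hg : BddMeasurable g) : BddMeasurable fun x => f x + g x := by
  obtain ⟨hf, C, hC⟩ := hf
  obtain ⟨hg, D, hD⟩ := hg
  exact ⟨hf.add hg, C + D, fun x => (norm_add_le _ _).trans (add_le_add (hC x) (hD x))⟩

lemma neg (hf : BddMeasurable f) : BddMeasurable fun x => - f x := by
  obtain ⟨hf, C, hC⟩ := hf
  exact ⟨hf.neg, C, fun x => by simpa using hC x⟩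

lemma sub (hf : BddMeasurable f) (hg : BddMeasurable g) : BddMeasurable fun x => f x - g x := by
  simpa only [sub_eq_add_neg] using hf.add hg.neg

lemma mul (hf : BddMeasurable f) (hg : BddMeasurable g) : BddMeasurable fun x => f x * g x := by
  obtain ⟨hf, C, hC⟩ := hf
  obtain ⟨hg, D, hD⟩ := hg
  refine ⟨hf.mul hg, C * D, fun x => ?_⟩
  rw [norm_mul]
  exact mul_le_mul (hC x) (hD x) (norm_nonneg _) ((norm_nonneg _).trans (hC x))

lemma pow (hf : BddMeasurable f) (k : ℕ) : BddMeasurable fun x => f x ^ k := by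
  induction k with
  | zero => simpa using const (α := α) (1 : 𝕜)
  | succ k ih => simpa only [pow_succ] using ih.mul hf

lemma sum {κ : Type*} (s : Finset κ) {F : κ → α → 𝕜} (hF : ∀ k, BddMeasurable (F k)) :
    BddMeasurable fun x => ∑ k ∈ s, F k x := by
  classical
  induction s using Finset.induction_on with
  | empty => simpa using const (α := α) (0 : 𝕜)
  | insert a s ha ih => simpa only [Finset.sum_insert ha] using (hF a).add ih

lemma comp (hf : BddMeasurable f) {e : β → α} (he : Measurable e) :
    BddMeasurable fun y => f (e y) := ⟨hf.1.comp he, hf.2.imp fun _ h y => h (e y)⟩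

lemma norm (hf : BddMeasurable f) : BddMeasurable fun x => ‖f x‖ :=
  ⟨hf.1.norm, hf.2.imp fun _ h y => by simpa using h y⟩

lemma ofReal {f : α → ℝ} (hf : BddMeasurable f) : BddMeasurable fun x => (f x : ℂ) :=
  ⟨Complex.measurable_ofReal.comp hf.1, hf.2.imp fun _ h y => by simpa using h y⟩

lemma cexp_I {f : α → ℝ} (hf : Measurable f) :
    BddMeasurable fun x => Complex.exp (f x * Complex.I) :=
  ⟨by fun_prop, 1, fun x => (Complex.norm_exp_ofReal_mul_I (f x)).le⟩

lemma integrable (hf : BddMeasurable f) (μ : Measure α) [IsFiniteMeasure μ] : Integrable f μ := by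
  obtain ⟨hm, C, hC⟩ := hf
  exact Integrable.of_bound hm.aestronglyMeasurable C (ae_of_all _ hC)

lemma integral_right {F : α → β → 𝕜} (hF : BddMeasurable fun p : α × β => F p.1 p.2)
    (ρ : Measure β) [IsProbabilityMeasure ρ] : BddMeasurable fun a => ∫ b, F a b ∂ρ := by
  obtain ⟨hm, C, hC⟩ := hF
  refine ⟨(hm.stronglyMeasurable.integral_prod_right' (ν := ρ)).measurable, C, fun a => ?_⟩
  have := norm_integral_le_of_norm_le_const (μ := ρ) (f := F a) (C := C)
    (ae_of_all _ fun b => hC (a, b))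
  simpa using this

lemma section_right {F : α → β → 𝕜} (hF : BddMeasurable fun p : α × β => F p.1 p.2) (a : α) :
    BddMeasurable (F a) := hF.comp (e := fun b => (a, b)) measurable_prodMk_left

end BddMeasurable

/-- Cauchy-Schwarz against the constant function `1`. -/
lemma sq_integral_abs_le {f : α → ℝ} (hf : BddMeasurable f) (μ : Measure α)
    [IsProbabilityMeasure μ] : (∫ x, |f x| ∂μ) ^ 2 ≤ ∫ x, f x ^ 2 ∂μ := by
  set m := ∫ x, |f x| ∂μ with hm
  have h1 : 0 ≤ ∫ x, (|f x| - m) ^ 2 ∂μ := integral_nonneg fun x => sq_nonneg _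
  have ha : BddMeasurable fun x => |f x| := hf.norm
  have h2 : ∫ x, (|f x| - m) ^ 2 ∂μ = ∫ x, f x ^ 2 ∂μ - m ^ 2 := by
    have : ∀ x, (|f x| - m) ^ 2 = f x ^ 2 - 2 * m * |f x| + m ^ 2 := fun x => by
      rw [sub_sq, sq_abs]; ring
    simp_rw [this]
    have i1 := (hf.pow 2).integrable μ
    have i2 := (ha.integrable μ).const_mul (2 * m)
    rw [integral_add (f := fun x => f x ^ 2 - 2 * m * |f x|) (i1.sub i2) (integrable_const _),
      integral_sub i1 i2, integral_const_mul, ← hm]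
    simp
    ring
  linarith

lemma integral_abs_le_sqrt {f : α → ℝ} (hf : BddMeasurable f) (μ : Measure α)
    [IsProbabilityMeasure μ] : ∫ x, |f x| ∂μ ≤ √(∫ x, f x ^ 2 ∂μ) :=
  Real.le_sqrt_of_sq_le (sq_integral_abs_le hf μ)

end BddMeasurable

/-! ### Resampling one coordinate of an i.i.d. sample -/

section Resampling

variable {ι 𝒵 : Type*} [Fintype ι] [DecidableEq ι] [MeasurableSpace 𝒵] (ρ : Measure 𝒵)
  [IsProbabilityMeasure ρ]

lemma measurable_update_pair (i : ι) :
    Measurable fun p : 𝒵 × (ι → 𝒵) => Function.update p.2 i p.1 := by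
  refine measurable_pi_iff.2 fun j => ?_
  by_cases h : j = i
  · subst h; simpa using measurable_fst
  · simp only [Function.update_of_ne h]
    exact (measurable_pi_apply j).comp measurable_snd

/-- The law of an i.i.d. sample does not change when one coordinate is replaced by an independent
copy. -/
lemma map_update_prod_pi (i : ι) :
    (ρ.prod (Measure.pi fun _ : ι => ρ)).map
      (fun p : 𝒵 × (ι → 𝒵) => Function.update p.2 i p.1) = Measure.pi fun _ : ι => ρ := by
  symm
  refine Measure.pi_eq fun s hs => ?_
  rw [Measure.map_apply (measurable_update_pair i) (MeasurableSet.univ_pi hs)]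
  have : (fun p : 𝒵 × (ι → 𝒵) => Function.update p.2 i p.1) ⁻¹' Set.univ.pi s
      = s i ×ˢ Set.univ.pi (Function.update s i Set.univ) := by
    ext ⟨z, x⟩
    simp only [Set.mem_preimage, Set.mem_pi, Set.mem_univ, forall_const, Set.mem_prod]
    constructor
    · intro h
      refine ⟨by simpa using h i, fun j => ?_⟩
      by_cases hj : j = i
      · subst hj; simp
      · simpa [Function.update_of_ne hj] using h j
    · rintro ⟨h1, h2⟩ j
      by_cases hj : j = i
      · subst hj; simpa using h1
      · simpa [Function.update_of_ne hj] using h2 j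
  rw [this, Measure.prod_prod, Measure.pi_pi, ← Finset.mul_prod_erase _ _ (Finset.mem_univ i),
    ← Finset.mul_prod_erase Finset.univ (fun j => ρ (s j)) (Finset.mem_univ i)]
  simp only [Function.update_self, measure_univ, one_mul]
  congr 1
  refine Finset.prod_congr rfl fun j hj => ?_
  rw [Function.update_of_ne (Finset.ne_of_mem_erase hj)]

lemma integral_resample {E : Type*} [NormedAddCommGroup E] [NormedSpace ℝ E] (i : ι)
    {f : (ι → 𝒵) → E} (hf : Integrable f (Measure.pi fun _ : ι => ρ)) :
    ∫ x, f x ∂(Measure.pi fun _ : ι => ρ) =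
      ∫ x, ∫ z, f (Function.update x i z) ∂ρ ∂(Measure.pi fun _ : ι => ρ) := by
  have hmap := map_update_prod_pi (ι := ι) ρ i
  have hf' := hf
  rw [← hmap] at hf'
  conv_lhs => rw [← hmap]
  rw [integral_map (measurable_update_pair i).aemeasurable hf'.aestronglyMeasurable,
    integral_prod_symm (fun p : 𝒵 × (ι → 𝒵) => f (Function.update p.2 i p.1))
      (hf'.comp_measurable (measurable_update_pair i))]

lemma integral_eq_zero_of_resample {E : Type*} [NormedAddCommGroup E] [NormedSpace ℝ E] (i : ι)
    {f : (ι → 𝒵) → E} (h : ∀ x, ∫ z, f (Function.update x i z) ∂ρ = 0) :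
    ∫ x, f x ∂(Measure.pi fun _ : ι => ρ) = 0 := by
  by_cases hf : Integrable f (Measure.pi fun _ : ι => ρ)
  · rw [integral_resample ρ i hf]; simp [h]
  · exact integral_undef hf

/-- Independence of one coordinate from a function of the other ones. -/
lemma integral_coord_mul (i : ι) {f : 𝒵 → ℝ} {g : (ι → 𝒵) → ℝ} (hf : BddMeasurable f)
    (hg : BddMeasurable g) (hgi : ∀ x z, g (Function.update x i z) = g x) :
    ∫ x, f (x i) * g x ∂(Measure.pi fun _ : ι => ρ) =
      (∫ z, f z ∂ρ) * ∫ x, g x ∂(Measure.pi fun _ : ι => ρ) := by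
  rw [integral_resample ρ i
    (((hf.comp (measurable_pi_apply i)).mul hg).integrable _)]
  simp_rw [hgi, Function.update_self, integral_mul_const, integral_const_mul]

lemma integral_coord (i : ι) {f : 𝒵 → ℝ} (hf : BddMeasurable f) :
    ∫ x, f (x i) ∂(Measure.pi fun _ : ι => ρ) = ∫ z, f z ∂ρ := by
  simpa using integral_coord_mul ρ i hf (BddMeasurable.const (1 : ℝ)) (fun _ _ => rfl)

variable {ρ} {a : 𝒵 → ℝ} {B : ℝ}

lemma sum_update_of_notMem {E : Type*} [AddCommMonoid E] (a : 𝒵 → E) {T : Finset ι} {j : ι}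
    (hj : j ∉ T) (x : ι → 𝒵) (z : 𝒵) :
    ∑ k ∈ T, a (Function.update x j z k) = ∑ k ∈ T, a (x k) :=
  Finset.sum_congr rfl fun k hk => by
    rw [Function.update_of_ne (ne_of_mem_of_not_mem hk hj)]

lemma BddMeasurable.sum_coord (ha : BddMeasurable a) (T : Finset ι) :
    BddMeasurable fun x : ι → 𝒵 => ∑ j ∈ T, a (x j) :=
  BddMeasurable.sum T fun j => ha.comp (measurable_pi_apply j)

lemma integral_sum_coord (ha : BddMeasurable a) (h0 : ∫ z, a z ∂ρ = 0) (T : Finset ι) :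
    ∫ x, (∑ j ∈ T, a (x j)) ∂(Measure.pi fun _ : ι => ρ) = 0 := by
  rw [integral_finsetSum _ fun j _ => (ha.comp (measurable_pi_apply j)).integrable _]
  simp [integral_coord ρ _ ha, h0]

lemma integral_sum_coord_sq (ha : BddMeasurable a) (h0 : ∫ z, a z ∂ρ = 0) (T : Finset ι) :
    ∫ x, (∑ j ∈ T, a (x j)) ^ 2 ∂(Measure.pi fun _ : ι => ρ) = T.card * ∫ z, a z ^ 2 ∂ρ := by
  induction T using Finset.induction_on with
  | empty => simp
  | insert j T hj ih =>
    have hS := BddMeasurable.sum_coord (ι := ι) ha T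
    have haj : BddMeasurable fun x : ι → 𝒵 => a (x j) := ha.comp (measurable_pi_apply j)
    have e : ∀ x : ι → 𝒵, (∑ k ∈ insert j T, a (x k)) ^ 2 =
        a (x j) ^ 2 + 2 * (a (x j) * ∑ k ∈ T, a (x k)) + (∑ k ∈ T, a (x k)) ^ 2 := fun x => by
      rw [Finset.sum_insert hj]; ring
    simp_rw [e]
    rw [integral_add (((haj.pow 2).add ((BddMeasurable.const 2).mul (haj.mul hS))).integrable _)
        ((hS.pow 2).integrable _),
      integral_add ((haj.pow 2).integrable _) (((BddMeasurable.const 2).mul (haj.mul hS)).integrable _),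
      integral_const_mul, integral_coord_mul ρ j ha hS (sum_update_of_notMem a hj),
      integral_coord ρ j (ha.pow 2), h0, ih, Finset.card_insert_of_notMem hj]
    push_cast
    ring

/-- Fourth moment of a sum of bounded centred i.i.d. random variables. -/
lemma integral_sum_coord_pow_four_le (ha : BddMeasurable a) (hB : ∀ z, |a z| ≤ B)
    (h0 : ∫ z, a z ∂ρ = 0) (T : Finset ι) :
    ∫ x, (∑ j ∈ T, a (x j)) ^ 4 ∂(Measure.pi fun _ : ι => ρ) ≤
      3 * (T.card : ℝ) ^ 2 * B ^ 2 * ∫ z, a z ^ 2 ∂ρ := by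
  have hB2 : ∀ z, a z ^ 2 ≤ B ^ 2 := fun z => sq_le_sq' (by linarith [neg_abs_le (a z), hB z])
    ((le_abs_self _).trans (hB z))
  have hv0 : 0 ≤ ∫ z, a z ^ 2 ∂ρ := integral_nonneg fun z => sq_nonneg _
  have hv : ∫ z, a z ^ 2 ∂ρ ≤ B ^ 2 := by
    simpa using integral_mono ((ha.pow 2).integrable ρ) (integrable_const (B ^ 2)) hB2
  have h4 : ∫ z, a z ^ 4 ∂ρ ≤ B ^ 2 * ∫ z, a z ^ 2 ∂ρ := by
    rw [← integral_const_mul]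
    refine integral_mono ((ha.pow 4).integrable ρ) (((ha.pow 2).integrable ρ).const_mul _) fun z => ?_
    have := mul_le_mul_of_nonneg_right (hB2 z) (sq_nonneg (a z))
    simp only
    linarith [show a z ^ 4 = a z ^ 2 * a z ^ 2 by ring]
  induction T using Finset.induction_on with
  | empty => simp
  | insert j T hj ih =>
    have hS := BddMeasurable.sum_coord (ι := ι) ha T
    have haj : BddMeasurable fun x : ι → 𝒵 => a (x j) := ha.comp (measurable_pi_apply j)
    have hu := fun k : ℕ => fun (x : ι → 𝒵) z =>
      congrArg (· ^ k) (sum_update_of_notMem a hj x z)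
    have e : ∀ x : ι → 𝒵, (∑ k ∈ insert j T, a (x k)) ^ 4 =
        a (x j) ^ 4 + 4 * (a (x j) ^ 3 * ∑ k ∈ T, a (x k)) +
          6 * (a (x j) ^ 2 * (∑ k ∈ T, a (x k)) ^ 2) + 4 * (a (x j) * (∑ k ∈ T, a (x k)) ^ 3) +
          (∑ k ∈ T, a (x k)) ^ 4 := fun x => by
      rw [Finset.sum_insert hj]; ring
    simp_rw [e]
    have i1 := haj.pow 4
    have i2 := (BddMeasurable.const (α := ι → 𝒵) (4 : ℝ)).mul ((haj.pow 3).mul hS)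
    have i3 := (BddMeasurable.const (α := ι → 𝒵) (6 : ℝ)).mul ((haj.pow 2).mul (hS.pow 2))
    have i4 := (BddMeasurable.const (α := ι → 𝒵) (4 : ℝ)).mul (haj.mul (hS.pow 3))
    rw [integral_add ((((i1.add i2).add i3).add i4).integrable _) ((hS.pow 4).integrable _),
      integral_add (((i1.add i2).add i3).integrable _) (i4.integrable _),
      integral_add ((i1.add i2).integrable _) (i3.integrable _),
      integral_add (i1.integrable _) (i2.integrable _),
      integral_const_mul, integral_const_mul, integral_const_mul,
      integral_coord_mul ρ j (ha.pow 3) hS (sum_update_of_notMem a hj),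
      integral_coord_mul ρ j (ha.pow 2) (hS.pow 2) (hu 2),
      integral_coord_mul ρ j ha (hS.pow 3) (hu 3),
      integral_coord ρ j (ha.pow 4), h0, integral_sum_coord ha h0 T, integral_sum_coord_sq ha h0 T,
      Finset.card_insert_of_notMem hj]
    push_cast
    have hm : (0 : ℝ) ≤ T.card := Nat.cast_nonneg _
    have := mul_le_mul_of_nonneg_right hv hv0
    have := mul_le_mul_of_nonneg_left this hm
    nlinarith [mul_nonneg (sq_nonneg B) hv0]

end Resampling

/-! ### Degenerate kernels and their second moments -/

section DegenerateKernel

variable {ι 𝒵 : Type*} [Fintype ι] [DecidableEq ι] [MeasurableSpace 𝒵]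

/-- A symmetric measurable kernel `h`, bounded by `B`, which is degenerate for `ρ`: it integrates
to `0` in each variable. -/
structure DegenerateKernel (ρ : Measure 𝒵) (h : 𝒵 → 𝒵 → ℝ) (B : ℝ) : Prop where
  measurable : Measurable fun p : 𝒵 × 𝒵 => h p.1 p.2
  bound : ∀ z w, |h z w| ≤ B
  symm : ∀ z w, h z w = h w z
  centred : ∀ z, ∫ w, h z w ∂ρ = 0

/-- The second moment `∬ h²` of a kernel. -/
noncomputable def kernelSq (ρ : Measure 𝒵) (h : 𝒵 → 𝒵 → ℝ) : ℝ := ∫ z, ∫ w, h z w ^ 2 ∂ρ ∂ρ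

/-- The composition `G(z, w) = ∫ h(z, t) h(w, t) ρ(dt)` of a symmetric kernel with itself. -/
noncomputable def kernelComp (ρ : Measure 𝒵) (h : 𝒵 → 𝒵 → ℝ) (z w : 𝒵) : ℝ :=
  ∫ t, h z t * h w t ∂ρ

/-- The row sum `∑_{j ∈ T, j ≠ i} h(x_i, x_j)`. -/
def rowSum (h : 𝒵 → 𝒵 → ℝ) (T : Finset ι) (i : ι) (x : ι → 𝒵) : ℝ :=
  ∑ j ∈ T.erase i, h (x i) (x j)

/-- The sum `∑_{i ≠ j} h(x_i, x_j)` over ordered pairs of distinct indices in `T`. -/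
def pairSum (h : 𝒵 → 𝒵 → ℝ) (T : Finset ι) (x : ι → 𝒵) : ℝ :=
  ∑ i ∈ T, rowSum h T i x

variable {ρ : Measure 𝒵} [IsProbabilityMeasure ρ] {h : 𝒵 → 𝒵 → ℝ} {B : ℝ}

lemma kernelSq_nonneg : 0 ≤ kernelSq ρ h :=
  integral_nonneg fun _ => integral_nonneg fun _ => sq_nonneg _

namespace DegenerateKernel

lemma bddMeasurable (H : DegenerateKernel ρ h B) :
    BddMeasurable fun p : 𝒵 × 𝒵 => h p.1 p.2 := ⟨H.measurable, B, fun p => H.bound p.1 p.2⟩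

lemma bddMeasurable_right (H : DegenerateKernel ρ h B) (z : 𝒵) : BddMeasurable (h z) :=
  H.bddMeasurable.section_right z

lemma centred_left (H : DegenerateKernel ρ h B) (w : 𝒵) : ∫ z, h z w ∂ρ = 0 := by
  simp_rw [H.symm _ w]; exact H.centred w

lemma bddMeasurable_coord (H : DegenerateKernel ρ h B) (i j : ι) :
    BddMeasurable fun x : ι → 𝒵 => h (x i) (x j) :=
  H.bddMeasurable.comp (e := fun x : ι → 𝒵 => (x i, x j))
    ((measurable_pi_apply i).prodMk (measurable_pi_apply j))

lemma bddMeasurable_rowSum (H : DegenerateKernel ρ h B) (T : Finset ι) (i : ι) :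
    BddMeasurable (rowSum h T i) :=
  BddMeasurable.sum _ fun j => H.bddMeasurable_coord i j

lemma bddMeasurable_pairSum (H : DegenerateKernel ρ h B) (T : Finset ι) :
    BddMeasurable (pairSum h T) :=
  BddMeasurable.sum _ fun i => H.bddMeasurable_rowSum T i

lemma bddMeasurable_sq_integral (H : DegenerateKernel ρ h B) :
    BddMeasurable fun z => ∫ w, h z w ^ 2 ∂ρ :=
  BddMeasurable.integral_right (F := fun z w => h z w ^ 2) (H.bddMeasurable.pow 2) ρ

/-- The composition of a degenerate kernel with itself is again degenerate. -/
lemma comp_self (H : DegenerateKernel ρ h B) : DegenerateKernel ρ (kernelComp ρ h) (B ^ 2) := by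
  have hm : BddMeasurable fun p : (𝒵 × 𝒵) × 𝒵 => h p.1.1 p.2 * h p.1.2 p.2 :=
    (H.bddMeasurable.comp (e := fun p : (𝒵 × 𝒵) × 𝒵 => (p.1.1, p.2)) (by fun_prop)).mul
      (H.bddMeasurable.comp (e := fun p : (𝒵 × 𝒵) × 𝒵 => (p.1.2, p.2)) (by fun_prop))
  refine ⟨(BddMeasurable.integral_right (F := fun (p : 𝒵 × 𝒵) t => h p.1 t * h p.2 t) hm ρ).1,
    fun z w => ?_, fun z w => ?_, fun z => ?_⟩
  · have := norm_integral_le_of_norm_le_const (μ := ρ) (f := fun t => h z t * h w t) (C := B ^ 2)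
      (ae_of_all _ fun t => by
        rw [norm_mul, sq]
        exact mul_le_mul (H.bound _ _) (H.bound _ _) (norm_nonneg _)
          ((abs_nonneg _).trans (H.bound z t)))
    simpa [kernelComp] using this
  · simp only [kernelComp]; simp_rw [mul_comm]
  · simp only [kernelComp]
    rw [integral_integral_swap]
    · simp_rw [integral_const_mul, H.centred_left]; simp
    · exact ((hm.comp (e := fun p : 𝒵 × 𝒵 => ((z, p.1), p.2)) (by fun_prop)).integrable _)

end DegenerateKernel

/-- The terms that involve a given index, isolated by symmetry. -/
lemma pairSum_eq_add_erase (hs : ∀ z w, h z w = h w z) {T : Finset ι} {i : ι} (hi : i ∈ T)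
    (x : ι → 𝒵) : pairSum h T x = 2 * rowSum h T i x + pairSum h (T.erase i) x := by
  unfold pairSum
  rw [← Finset.add_sum_erase _ _ hi]
  have : ∀ k ∈ T.erase i, rowSum h T k x = h (x i) (x k) + rowSum h (T.erase i) k x := by
    intro k hk
    have hik : i ∈ T.erase k := Finset.mem_erase.2 ⟨(Finset.ne_of_mem_erase hk).symm, hi⟩
    rw [rowSum, ← Finset.add_sum_erase _ _ hik, rowSum, Finset.erase_right_comm, hs (x k)]
  rw [Finset.sum_congr rfl this, Finset.sum_add_distrib]
  change _ + (rowSum h T i x + _) = _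
  ring

lemma rowSum_update (T : Finset ι) (i : ι) (x : ι → 𝒵) (z : 𝒵) :
    rowSum h T i (Function.update x i z) = ∑ j ∈ T.erase i, h z (x j) := by
  unfold rowSum
  rw [Function.update_self]
  exact Finset.sum_congr rfl fun j hj => by rw [Function.update_of_ne (Finset.ne_of_mem_erase hj)]

lemma pairSum_update_of_notMem {T : Finset ι} {i : ι} (hi : i ∉ T) (x : ι → 𝒵) (z : 𝒵) :
    pairSum h T (Function.update x i z) = pairSum h T x := by
  unfold pairSum rowSum
  refine Finset.sum_congr rfl fun k hk => Finset.sum_congr rfl fun l hl => ?_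
  rw [Function.update_of_ne (ne_of_mem_of_not_mem hk hi),
    Function.update_of_ne (ne_of_mem_of_not_mem (Finset.mem_of_mem_erase hl) hi)]

namespace DegenerateKernel

lemma integral_coord_sq (H : DegenerateKernel ρ h B) {i j : ι} (hij : j ≠ i) :
    ∫ x, h (x i) (x j) ^ 2 ∂(Measure.pi fun _ : ι => ρ) = kernelSq ρ h := by
  rw [integral_resample ρ j (((H.bddMeasurable_coord i j).pow 2).integrable _)]
  simp_rw [Function.update_self, Function.update_of_ne hij.symm]
  exact integral_coord ρ i H.bddMeasurable_sq_integral

lemma integral_coord_mul_rowSum (H : DegenerateKernel ρ h B) {T : Finset ι} {i j : ι}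
    (hj : j ∈ T.erase i) :
    ∫ x, h (x i) (x j) * rowSum h T i x ∂(Measure.pi fun _ : ι => ρ) = kernelSq ρ h := by
  unfold rowSum
  simp_rw [Finset.mul_sum]
  rw [integral_finsetSum _ fun k _ =>
    ((H.bddMeasurable_coord i j).mul (H.bddMeasurable_coord i k)).integrable _,
    Finset.sum_eq_single_of_mem j hj]
  · simp_rw [← sq]
    exact H.integral_coord_sq (Finset.ne_of_mem_erase hj)
  · intro k hk hkj
    refine integral_eq_zero_of_resample ρ k fun x => ?_
    simp_rw [Function.update_self, Function.update_of_ne hkj.symm,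
      Function.update_of_ne (Finset.ne_of_mem_erase hk).symm, integral_const_mul, H.centred,
      mul_zero]

lemma integral_coord_mul_pairSum (H : DegenerateKernel ρ h B) {T : Finset ι} {i j : ι}
    (hi : i ∈ T) (hj : j ∈ T.erase i) :
    ∫ x, h (x i) (x j) * pairSum h T x ∂(Measure.pi fun _ : ι => ρ) = 2 * kernelSq ρ h := by
  have h0 : ∫ x, h (x i) (x j) * pairSum h (T.erase i) x ∂(Measure.pi fun _ : ι => ρ) = 0 := by
    refine integral_eq_zero_of_resample ρ i fun x => ?_
    simp_rw [pairSum_update_of_notMem (Finset.notMem_erase i T), Function.update_self,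
      Function.update_of_ne (Finset.ne_of_mem_erase hj), integral_mul_const, H.centred_left,
      zero_mul]
  simp_rw [pairSum_eq_add_erase H.symm hi, mul_add, mul_left_comm _ (2 : ℝ)]
  rw [integral_add, h0, integral_const_mul, H.integral_coord_mul_rowSum hj, add_zero]
  · exact (((H.bddMeasurable_coord i j).mul (H.bddMeasurable_rowSum T i)).integrable _).const_mul _
  · exact ((H.bddMeasurable_coord i j).mul (H.bddMeasurable_pairSum _)).integrable _

/-- The summands of a degenerate pair sum are orthogonal. -/
lemma integral_pairSum_sq (H : DegenerateKernel ρ h B) (T : Finset ι) :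
    ∫ x, pairSum h T x ^ 2 ∂(Measure.pi fun _ : ι => ρ) =
      2 * T.card * (T.card - 1) * kernelSq ρ h := by
  have e : ∀ x : ι → 𝒵, pairSum h T x ^ 2 =
      ∑ i ∈ T, ∑ j ∈ T.erase i, h (x i) (x j) * pairSum h T x := fun x => by
    rw [sq]
    conv_lhs => arg 1; rw [pairSum]
    simp_rw [rowSum, Finset.sum_mul]
  simp_rw [e]
  have hi : ∀ i j : ι, BddMeasurable fun x : ι → 𝒵 => h (x i) (x j) * pairSum h T x :=
    fun i j => (H.bddMeasurable_coord i j).mul (H.bddMeasurable_pairSum T)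
  rw [integral_finsetSum _ fun i _ => (BddMeasurable.sum _ fun j => hi i j).integrable _]
  have : ∀ i ∈ T, ∫ x, ∑ j ∈ T.erase i, h (x i) (x j) * pairSum h T x
      ∂(Measure.pi fun _ : ι => ρ) = ((T.card : ℝ) - 1) * (2 * kernelSq ρ h) := by
    intro i hiT
    rw [integral_finsetSum _ fun j _ => (hi i j).integrable _,
      Finset.sum_congr rfl fun j hj => H.integral_coord_mul_pairSum hiT hj, Finset.sum_const,
      Finset.card_erase_of_mem hiT, nsmul_eq_mul, Nat.cast_sub (Finset.card_pos.2 ⟨i, hiT⟩)]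
    simp
  rw [Finset.sum_congr rfl this, Finset.sum_const, nsmul_eq_mul]
  ring

lemma integral_pairSum_sq_le (H : DegenerateKernel ρ h B) (T : Finset ι) :
    ∫ x, pairSum h T x ^ 2 ∂(Measure.pi fun _ : ι => ρ) ≤ 2 * (T.card : ℝ) ^ 2 * kernelSq ρ h := by
  rw [H.integral_pairSum_sq]
  have := mul_nonneg (Nat.cast_nonneg (α := ℝ) T.card) (kernelSq_nonneg (ρ := ρ) (h := h))
  nlinarith

lemma integral_rowSum_pow (H : DegenerateKernel ρ h B) (T : Finset ι) (i : ι) (k : ℕ) :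
    ∫ x, rowSum h T i x ^ k ∂(Measure.pi fun _ : ι => ρ) =
      ∫ z, ∫ x : ι → 𝒵, (∑ j ∈ T.erase i, h z (x j)) ^ k ∂(Measure.pi fun _ : ι => ρ) ∂ρ := by
  rw [integral_resample ρ i (((H.bddMeasurable_rowSum T i).pow k).integrable _)]
  simp_rw [rowSum_update]
  refine integral_integral_swap ?_
  refine BddMeasurable.integrable (BddMeasurable.pow (BddMeasurable.sum _ fun j => ?_) k) _
  exact H.bddMeasurable.comp (e := fun p : (ι → 𝒵) × 𝒵 => (p.2, p.1 j)) (by fun_prop)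

lemma integral_rowSum_sq (H : DegenerateKernel ρ h B) (T : Finset ι) (i : ι) :
    ∫ x, rowSum h T i x ^ 2 ∂(Measure.pi fun _ : ι => ρ) = (T.erase i).card * kernelSq ρ h := by
  rw [H.integral_rowSum_pow]
  simp_rw [integral_sum_coord_sq (H.bddMeasurable_right _) (H.centred _), integral_const_mul]
  rfl

lemma integral_rowSum_pow_four_le (H : DegenerateKernel ρ h B) (T : Finset ι) (i : ι) :
    ∫ x, rowSum h T i x ^ 4 ∂(Measure.pi fun _ : ι => ρ) ≤
      3 * ((T.erase i).card : ℝ) ^ 2 * B ^ 2 * kernelSq ρ h := by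
  rw [H.integral_rowSum_pow, kernelSq, ← integral_const_mul]
  refine integral_mono ?_ ((H.bddMeasurable_sq_integral.integrable ρ).const_mul _) fun z =>
    integral_sum_coord_pow_four_le (H.bddMeasurable_right z) (H.bound z) (H.centred z) _
  refine BddMeasurable.integrable (BddMeasurable.integral_right
    (F := fun z (x : ι → 𝒵) => (∑ j ∈ T.erase i, h z (x j)) ^ 4)
    (BddMeasurable.pow (BddMeasurable.sum _ fun j => ?_) 4) _) _
  exact H.bddMeasurable.comp (e := fun p : 𝒵 × (ι → 𝒵) => (p.1, p.2 j)) (by fun_prop)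

/-- The third absolute moment, by the arithmetic-geometric mean inequality
`2 |r|³ ≤ c r² + c⁻¹ r⁴` with `c = B √n`. -/
lemma integral_abs_rowSum_cube_le (H : DegenerateKernel ρ h B) (hB : 0 < B) (i : ι) :
    ∫ x, |rowSum h Finset.univ i x| ^ 3 ∂(Measure.pi fun _ : ι => ρ) ≤
      2 * B * (Fintype.card ι * √(Fintype.card ι)) * kernelSq ρ h := by
  have hs := kernelSq_nonneg (ρ := ρ) (h := h)
  have hn : (0 : ℝ) < Fintype.card ι := by exact_mod_cast Fintype.card_pos_iff.2 ⟨i⟩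
  have hr := H.bddMeasurable_rowSum Finset.univ i
  have hm : (((Finset.univ : Finset ι).erase i).card : ℝ) ≤ Fintype.card ι :=
    Nat.cast_le.2 (Finset.card_le_univ _)
  set n : ℝ := (Fintype.card ι : ℝ)
  set a := √n with ha
  have ha0 : 0 < a := Real.sqrt_pos.2 hn
  have haa : a * a = n := Real.mul_self_sqrt hn.le
  have hm0 : (0 : ℝ) ≤ (((Finset.univ : Finset ι).erase i).card : ℝ) := Nat.cast_nonneg _
  have h2 := H.integral_rowSum_sq Finset.univ i
  have h4 := H.integral_rowSum_pow_four_le Finset.univ i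
  set m : ℝ := (((Finset.univ : Finset ι).erase i).card : ℝ)
  have hc : 0 < B * a := mul_pos hB ha0
  calc ∫ x, |rowSum h Finset.univ i x| ^ 3 ∂(Measure.pi fun _ : ι => ρ)
      ≤ ∫ x, (B * a / 2 * rowSum h Finset.univ i x ^ 2 +
          (2 * (B * a))⁻¹ * rowSum h Finset.univ i x ^ 4) ∂(Measure.pi fun _ : ι => ρ) := by
        refine integral_mono ((hr.norm.pow 3).integrable _)
          ((((BddMeasurable.const _).mul (hr.pow 2)).add
            ((BddMeasurable.const _).mul (hr.pow 4))).integrable _) fun x => ?_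
        simp only
        set r := rowSum h Finset.univ i x
        have e2 : r ^ 2 = |r| ^ 2 := (sq_abs r).symm
        have e4 : r ^ 4 = |r| ^ 4 := (Even.pow_abs (by decide) r).symm
        rw [e2, e4]
        have : B * a / 2 * |r| ^ 2 + (2 * (B * a))⁻¹ * |r| ^ 4 - |r| ^ 3 =
            (2 * (B * a))⁻¹ * (|r| * (B * a - |r|)) ^ 2 := by field_simp; ring
        have := mul_nonneg (inv_nonneg.2 (mul_pos two_pos hc).le) (sq_nonneg (|r| * (B * a - |r|)))
        linarith
    _ = B * a / 2 * (m * kernelSq ρ h) + (2 * (B * a))⁻¹ *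
          ∫ x, rowSum h Finset.univ i x ^ 4 ∂(Measure.pi fun _ : ι => ρ) := by
        rw [integral_add (((hr.pow 2).integrable _).const_mul _)
          (((hr.pow 4).integrable _).const_mul _), integral_const_mul, integral_const_mul, h2]
    _ ≤ B * a / 2 * (n * kernelSq ρ h) + (2 * (B * a))⁻¹ * (3 * n ^ 2 * B ^ 2 * kernelSq ρ h) := by
        gcongr
        exact h4.trans (by gcongr)
    _ = 2 * B * (n * a) * kernelSq ρ h := by
        rw [← haa]; field_simp; ring

lemma integral_abs_rowSum_le (H : DegenerateKernel ρ h B) (i : ι) :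
    ∫ x, |rowSum h Finset.univ i x| ∂(Measure.pi fun _ : ι => ρ) ≤
      √(Fintype.card ι) * √(kernelSq ρ h) := by
  refine (integral_abs_le_sqrt (H.bddMeasurable_rowSum _ i) _).trans ?_
  rw [H.integral_rowSum_sq, ← Real.sqrt_mul (Nat.cast_nonneg _)]
  refine Real.sqrt_le_sqrt (mul_le_mul_of_nonneg_right ?_ kernelSq_nonneg)
  exact_mod_cast Finset.card_le_univ _

lemma _root_.NOCCO.integral_kernelComp_diag :
    ∫ z, kernelComp ρ h z z ∂ρ = kernelSq ρ h := by
  simp only [kernelComp, ← sq, kernelSq]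

/-- The conditional second moment of a row sum, given the other points, concentrates around its
mean. -/
lemma integral_abs_condVar_sub_le (H : DegenerateKernel ρ h B) (hB : 0 ≤ B) (T : Finset ι) :
    ∫ x, |∑ j ∈ T, kernelComp ρ h (x j) (x j) + pairSum (kernelComp ρ h) T x -
        T.card * kernelSq ρ h| ∂(Measure.pi fun _ : ι => ρ) ≤
      B * √(T.card) * √(kernelSq ρ h) +
        √2 * T.card * √(kernelSq ρ (kernelComp ρ h)) := by
  set s := kernelSq ρ h with hs
  have hs0 : 0 ≤ s := kernelSq_nonneg
  have G := H.comp_self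
  have hd : BddMeasurable fun z => kernelComp ρ h z z :=
    G.bddMeasurable.comp (e := fun z => (z, z)) (by fun_prop)
  have hds : BddMeasurable fun z => kernelComp ρ h z z - s := hd.sub (BddMeasurable.const s)
  have hd0 : ∫ z, (kernelComp ρ h z z - s) ∂ρ = 0 := by
    rw [integral_sub (hd.integrable ρ) (integrable_const _), integral_kernelComp_diag]; simp [hs]
  have hS := BddMeasurable.sum_coord (ι := ι) hds T
  have hP := G.bddMeasurable_pairSum T
  have e : ∀ x : ι → 𝒵, ∑ j ∈ T, kernelComp ρ h (x j) (x j) + pairSum (kernelComp ρ h) T x -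
      T.card * s = ∑ j ∈ T, (kernelComp ρ h (x j) (x j) - s) + pairSum (kernelComp ρ h) T x :=
    fun x => by rw [Finset.sum_sub_distrib]; simp; ring
  simp_rw [e]
  have hvar : ∫ z, (kernelComp ρ h z z - s) ^ 2 ∂ρ ≤ B ^ 2 * s := by
    have e2 : ∀ z, (kernelComp ρ h z z - s) ^ 2 =
        kernelComp ρ h z z ^ 2 - 2 * s * kernelComp ρ h z z + s ^ 2 := fun z => by ring
    have i1 := (hd.pow 2)
    have i2 := (BddMeasurable.const (α := 𝒵) (2 * s)).mul hd
    simp_rw [e2]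
    rw [integral_add ((i1.sub i2).integrable _) (integrable_const _),
      integral_sub (i1.integrable _) (i2.integrable _), integral_const_mul, integral_kernelComp_diag]
    have : ∫ z, kernelComp ρ h z z ^ 2 ∂ρ ≤ B ^ 2 * s := by
      rw [hs, ← integral_kernelComp_diag, ← integral_const_mul]
      refine integral_mono (i1.integrable _) ((hd.integrable ρ).const_mul _) fun z => ?_
      have h0 : 0 ≤ kernelComp ρ h z z := integral_nonneg fun t => mul_self_nonneg _
      have h1 := (le_abs_self _).trans (G.bound z z)
      simp only
      nlinarith
    simp
    nlinarith [sq_nonneg s]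
  calc _ ≤ ∫ x : ι → 𝒵, (|∑ j ∈ T, (kernelComp ρ h (x j) (x j) - s)| +
        |pairSum (kernelComp ρ h) T x|) ∂(Measure.pi fun _ : ι => ρ) :=
        integral_mono ((hS.add hP).norm.integrable _) ((hS.norm.add hP.norm).integrable _)
          fun x => abs_add_le _ _
    _ = _ := integral_add (hS.norm.integrable _) (hP.norm.integrable _)
    _ ≤ √(T.card * (B ^ 2 * s)) + √(2 * (T.card : ℝ) ^ 2 * kernelSq ρ (kernelComp ρ h)) := by
        refine add_le_add ((integral_abs_le_sqrt hS _).trans (Real.sqrt_le_sqrt ?_))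
          ((integral_abs_le_sqrt hP _).trans (Real.sqrt_le_sqrt (G.integral_pairSum_sq_le T)))
        rw [integral_sum_coord_sq hds hd0]
        gcongr
    _ = _ := by
        rw [Real.sqrt_mul (Nat.cast_nonneg _), Real.sqrt_mul (sq_nonneg B), Real.sqrt_sq hB,
          Real.sqrt_mul (by positivity), Real.sqrt_mul (by norm_num),
          Real.sqrt_sq (Nat.cast_nonneg _)]
        ring

end DegenerateKernel

end DegenerateKernel

/-! ### Asymptotic normality of degenerate U-statistics -/

lemma norm_cexp_mul_I_sub_one_le (x : ℝ) : ‖Complex.exp (x * Complex.I) - 1‖ ≤ |x| := by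
  rw [mul_comm]; exact Real.norm_exp_I_mul_ofReal_sub_one_le

lemma norm_cexp_mul_I_sub_one_sub_le (x : ℝ) :
    ‖Complex.exp (x * Complex.I) - 1 - x * Complex.I‖ ≤ 2 * x ^ 2 := by
  have hx : ‖(x * Complex.I : ℂ)‖ = |x| := by simp
  by_cases h : |x| ≤ 1
  · have := Complex.norm_exp_sub_one_sub_id_le (hx.le.trans h)
    rw [hx, sq_abs] at this
    nlinarith [sq_nonneg x]
  · have h1 := (norm_sub_le (Complex.exp (x * Complex.I) - 1) (x * Complex.I)).trans
      (add_le_add (norm_cexp_mul_I_sub_one_le x) hx.le)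
    push Not at h
    rw [← sq_abs]
    nlinarith

/-- Arithmetic of the normalisation: the main term of the leave-one-out expansion. -/
lemma stein_main_term {n s b c t κ : ℝ} (hn : n ≠ 0) (hb : b ≠ 0) (hc : c ≠ 0) (hc2 : c ^ 2 = 2)
    (hs : s = b ^ 2) (hκ : κ = 1 / (c * n * b)) :
    κ * (n * (2 * (t * κ) * ((n - 1) * s))) = t - t / n := by
  subst hs hκ
  field_simp
  rw [hc2]

/-- Arithmetic of the normalisation: the error terms of the leave-one-out expansion. -/
lemma stein_error_le {a b c B u T n s κ : ℝ} (ha : 1 ≤ a) (hb : 0 < b) (hc : 0 < c)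
    (hc2 : c ^ 2 = 2) (hB : 0 ≤ B) (hu : 0 ≤ u) (hT : 0 ≤ T) (hn : n = a ^ 2) (hs : s = b ^ 2)
    (hκ : κ = 1 / (c * n * b)) :
    κ * (n * (16 * (T ^ 2 * κ ^ 2) * (B * (n * a) * s) +
      2 * (T * κ) * (B * a * b + c * n * u + 2 * (T * κ) * (n * s) * (a * b)))) + T / a ≤
    (T + T ^ 2) * (3 / a + 8 * (B / (a * b)) + 2 * (u / s)) := by
  subst hn hs hκ
  have ha0 : 0 < a := by linarith
  have hE2 : 1 / (c * a ^ 2 * b) * (a ^ 2 * (16 * (T ^ 2 * (1 / (c * a ^ 2 * b)) ^ 2) *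
      (B * (a ^ 2 * a) * b ^ 2) + 2 * (T * (1 / (c * a ^ 2 * b))) * (B * a * b + c * a ^ 2 * u +
        2 * (T * (1 / (c * a ^ 2 * b))) * (a ^ 2 * b ^ 2) * (a * b)))) =
      16 / c ^ 3 * T ^ 2 * (B / (a * b)) +
      2 / c ^ 2 * T * (B / (a * b)) + 2 / c * T * (u / b ^ 2) + 4 / c ^ 3 * T ^ 2 / a := by
    field_simp
    ring
  have hc3 : c ^ 3 = 2 * c := by rw [pow_succ, hc2]
  have hc14 : 7 / 5 ≤ c := by nlinarith
  have k1 : 16 / c ^ 3 ≤ 8 := by rw [hc3, div_le_iff₀ (by positivity)]; nlinarith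
  have k2 : 2 / c ^ 2 ≤ 8 := by rw [hc2]; norm_num
  have k3 : 2 / c ≤ 2 := by rw [div_le_iff₀ hc]; nlinarith
  have k4 : 4 / c ^ 3 ≤ 2 := by rw [hc3, div_le_iff₀ (by positivity)]; nlinarith
  rw [hE2]
  calc _ ≤ 8 * T ^ 2 * (B / (a * b)) + 8 * T * (B / (a * b)) + 2 * T * (u / b ^ 2) +
        2 * T ^ 2 / a + T / a := by gcongr
    _ ≤ _ := by
        have p1 : 0 ≤ T ^ 2 / a := by positivity
        have p2 : 0 ≤ T / a := by positivity
        have p3 : 0 ≤ T ^ 2 * (u / b ^ 2) := by positivity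
        have e1 : (T + T ^ 2) * (3 / a + 8 * (B / (a * b)) + 2 * (u / b ^ 2)) =
          3 * (T / a) + 3 * (T ^ 2 / a) + 8 * T * (B / (a * b)) + 8 * T ^ 2 * (B / (a * b)) +
          2 * T * (u / b ^ 2) + 2 * (T ^ 2 * (u / b ^ 2)) := by ring
        have e2 : 2 * T ^ 2 / a = 2 * (T ^ 2 / a) := by ring
        rw [e1, e2]
        linarith

section Stein

variable {ι 𝒵 : Type*} [Fintype ι] [DecidableEq ι] [MeasurableSpace 𝒵]
  {ρ : Measure 𝒵} [IsProbabilityMeasure ρ] {h : 𝒵 → 𝒵 → ℝ} {B : ℝ}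

namespace DegenerateKernel

/-- Averaging the square of a row sum over the point `x_i` that defines the row. -/
lemma integral_rowSum_sq_mul (H : DegenerateKernel ρ h B) (i : ι) {g : (ι → 𝒵) → ℂ}
    (hg : BddMeasurable g) (hgi : ∀ x z, g (Function.update x i z) = g x) :
    ∫ x, ((rowSum h Finset.univ i x ^ 2 : ℝ) : ℂ) * g x ∂(Measure.pi fun _ : ι => ρ) =
      ∫ x, ((∑ j ∈ Finset.univ.erase i, kernelComp ρ h (x j) (x j) +
        pairSum (kernelComp ρ h) (Finset.univ.erase i) x : ℝ) : ℂ) * g x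
        ∂(Measure.pi fun _ : ι => ρ) := by
  rw [integral_resample ρ i
    ((((H.bddMeasurable_rowSum Finset.univ i).pow 2).ofReal.mul hg).integrable _)]
  refine integral_congr_ae (ae_of_all _ fun x => ?_)
  simp only
  simp_rw [hgi, rowSum_update, integral_mul_const]
  congr 1
  rw [integral_complex_ofReal]
  congr 1
  set T := (Finset.univ : Finset ι).erase i
  have e : ∀ z, (∑ j ∈ T, h z (x j)) ^ 2 = ∑ j ∈ T, ∑ k ∈ T, h (x j) z * h (x k) z := fun z => by
    rw [sq, Finset.sum_mul_sum]
    simp_rw [H.symm z]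
  have hi : ∀ j k, BddMeasurable fun z => h (x j) z * h (x k) z := fun j k =>
    (H.bddMeasurable_right _).mul (H.bddMeasurable_right _)
  simp_rw [e]
  rw [integral_finsetSum _ fun j _ => (BddMeasurable.sum _ fun k => hi j k).integrable _, pairSum,
    ← Finset.sum_add_distrib]
  refine Finset.sum_congr rfl fun j hj => ?_
  rw [integral_finsetSum _ fun k _ => (hi j k).integrable _, ← Finset.add_sum_erase _ _ hj]
  rfl

/-- The leave-one-out expansion: with `U` the pair sum, `r` the `i`-th row sum and `U - 2 r`
independent of `x_i`, expand `exp (i τ U)` to second order around `exp (i τ (U - 2 r))`. -/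
lemma norm_integral_rowSum_mul_cexp_sub_le (H : DegenerateKernel ρ h B) (hB : 0 < B) (i : ι)
    (τ : ℝ) :
    ‖∫ x, (rowSum h Finset.univ i x : ℂ) *
          Complex.exp ((τ * pairSum h Finset.univ x : ℝ) * Complex.I)
          ∂(Measure.pi fun _ : ι => ρ) -
        ((2 * τ * ((Finset.univ.erase i).card * kernelSq ρ h) : ℝ) : ℂ) * Complex.I *
          ∫ x, Complex.exp ((τ * pairSum h Finset.univ x : ℝ) * Complex.I)
            ∂(Measure.pi fun _ : ι => ρ)‖ ≤
      16 * τ ^ 2 * (B * (Fintype.card ι * √(Fintype.card ι)) * kernelSq ρ h) +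
      2 * |τ| * (B * √(Fintype.card ι) * √(kernelSq ρ h) +
        √2 * Fintype.card ι * √(kernelSq ρ (kernelComp ρ h)) +
        2 * |τ| * (Fintype.card ι * kernelSq ρ h) *
          (√(Fintype.card ι) * √(kernelSq ρ h))) := by
  set π := Measure.pi fun _ : ι => ρ
  have hs0 : 0 ≤ kernelSq ρ h := kernelSq_nonneg
  have hg0 : 0 ≤ kernelSq ρ (kernelComp ρ h) := kernelSq_nonneg
  have hm : (((Finset.univ : Finset ι).erase i).card : ℝ) ≤ Fintype.card ι :=
    Nat.cast_le.2 (Finset.card_le_univ _)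
  have hm0 : (0 : ℝ) ≤ (((Finset.univ : Finset ι).erase i).card : ℝ) := Nat.cast_nonneg _
  have h3 := H.integral_abs_rowSum_cube_le hB i
  have h1 := H.integral_abs_rowSum_le i
  have hQ := H.integral_abs_condVar_sub_le hB.le ((Finset.univ : Finset ι).erase i)
  have hQ' : ∀ g : (ι → 𝒵) → ℂ, BddMeasurable g → (∀ x z, g (Function.update x i z) = g x) → _ :=
    fun g => H.integral_rowSum_sq_mul i (g := g)
  set n : ℝ := (Fintype.card ι : ℝ)
  set T := (Finset.univ : Finset ι).erase i with hT
  set m : ℝ := (T.card : ℝ)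
  set s := kernelSq ρ h
  set g := kernelSq ρ (kernelComp ρ h)
  set r : (ι → 𝒵) → ℝ := rowSum h Finset.univ i with hr_def
  have hr : BddMeasurable r := H.bddMeasurable_rowSum Finset.univ i
  set U : (ι → 𝒵) → ℝ := pairSum h Finset.univ with hU_def
  have hU : BddMeasurable U := H.bddMeasurable_pairSum Finset.univ
  have hV : BddMeasurable (pairSum h T) := H.bddMeasurable_pairSum T
  have hUV : ∀ x, U x = 2 * r x + pairSum h T x := fun x =>
    pairSum_eq_add_erase H.symm (Finset.mem_univ i) x
  set e : (ι → 𝒵) → ℂ := fun x => Complex.exp ((τ * U x : ℝ) * Complex.I) with he_def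
  set f : (ι → 𝒵) → ℂ := fun x => Complex.exp ((τ * pairSum h T x : ℝ) * Complex.I) with hf_def
  have he : BddMeasurable e := BddMeasurable.cexp_I (hU.1.const_mul τ)
  have hf : BddMeasurable f := BddMeasurable.cexp_I (hV.1.const_mul τ)
  have hf1 : ∀ x, ‖f x‖ = 1 := fun x => Complex.norm_exp_ofReal_mul_I _
  have hef : ∀ x, e x = f x * Complex.exp ((2 * τ * r x : ℝ) * Complex.I) := fun x => by
    simp only [he_def, hf_def]
    rw [← Complex.exp_add, hUV]
    congr 1
    push_cast
    ring
  have hfi : ∀ x z, f (Function.update x i z) = f x := fun x z => by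
    simp only [hf_def, hT, pairSum_update_of_notMem (Finset.notMem_erase i _)]
  set Q : (ι → 𝒵) → ℝ := fun x => ∑ j ∈ T, kernelComp ρ h (x j) (x j) +
    pairSum (kernelComp ρ h) T x with hQ_def
  have G := H.comp_self
  have hQm : BddMeasurable Q :=
    (BddMeasurable.sum _ fun j => G.bddMeasurable_coord j j).add (G.bddMeasurable_pairSum T)
  -- the remainder of the second order expansion
  set R : (ι → 𝒵) → ℂ := fun x => (r x : ℂ) * e x - (r x : ℂ) * f x -
    ((2 * τ : ℝ) : ℂ) * Complex.I * (((r x ^ 2 : ℝ) : ℂ) * f x) with hR_def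
  have hrf := hr.ofReal.mul hf
  have hre := hr.ofReal.mul he
  have hr2f := (hr.pow 2).ofReal.mul hf
  have hR : BddMeasurable R :=
    (hre.sub hrf).sub ((BddMeasurable.const _).mul hr2f)
  have hRle : ∀ x, ‖R x‖ ≤ 8 * τ ^ 2 * |r x| ^ 3 := fun x => by
    have : R x = (r x : ℂ) * f x * (Complex.exp ((2 * τ * r x : ℝ) * Complex.I) - 1 -
        (2 * τ * r x : ℝ) * Complex.I) := by
      simp only [hR_def, hef x]; push_cast; ring
    rw [this, norm_mul, norm_mul, hf1, Complex.norm_real, mul_one, Real.norm_eq_abs]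
    refine (mul_le_mul_of_nonneg_left (norm_cexp_mul_I_sub_one_sub_le _) (abs_nonneg _)).trans ?_
    rw [mul_pow, ← sq_abs (r x)]
    exact le_of_eq (by ring)
  have hRint : ‖∫ x, R x ∂π‖ ≤ 8 * τ ^ 2 * (2 * B * (n * √n) * s) := by
    refine (norm_integral_le_integral_norm _).trans ?_
    refine (integral_mono (hR.norm.integrable _)
      (((BddMeasurable.const _).mul (hr.norm.pow 3)).integrable _) hRle).trans ?_
    rw [integral_const_mul]
    exact mul_le_mul_of_nonneg_left h3 (by positivity)
  have hrf0 : ∫ x, (r x : ℂ) * f x ∂π = 0 := by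
    refine integral_eq_zero_of_resample ρ i fun x => ?_
    simp_rw [hfi, hr_def, rowSum_update, integral_mul_const]
    rw [integral_complex_ofReal, integral_finsetSum _ fun j _ => ?_]
    · simp [H.centred_left]
    · exact (H.bddMeasurable.comp (e := fun z => (z, x j)) (by fun_prop)).integrable _
  have hsplit : ∫ x, (r x : ℂ) * e x ∂π =
      ∫ x, R x ∂π + ((2 * τ : ℝ) : ℂ) * Complex.I * ∫ x, (Q x : ℂ) * f x ∂π := by
    have : ∀ x, (r x : ℂ) * e x = R x + ((r x : ℂ) * f x +
        ((2 * τ : ℝ) : ℂ) * Complex.I * (((r x ^ 2 : ℝ) : ℂ) * f x)) := fun x => by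
      simp only [hR_def]; ring
    simp_rw [this]
    rw [integral_add (hR.integrable _)
        ((hrf.add ((BddMeasurable.const _).mul hr2f)).integrable _),
      integral_add (hrf.integrable _) (((BddMeasurable.const _).mul hr2f).integrable _),
      integral_const_mul, hrf0, hQ' f hf hfi, zero_add]
  have hQf : ‖∫ x, (Q x : ℂ) * f x ∂π - ((m * s : ℝ) : ℂ) * ∫ x, f x ∂π‖ ≤
      B * √n * √s + √2 * n * √g := by
    rw [← integral_const_mul, ← integral_sub ((hQm.ofReal.mul hf).integrable _)
      (((BddMeasurable.const _).mul hf).integrable _)]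
    refine (norm_integral_le_integral_norm _).trans ?_
    have : ∀ x, ‖(Q x : ℂ) * f x - ((m * s : ℝ) : ℂ) * f x‖ = |Q x - m * s| := fun x => by
      rw [← sub_mul, norm_mul, hf1, mul_one, ← Complex.ofReal_sub, Complex.norm_real,
        Real.norm_eq_abs]
    simp_rw [this]
    refine hQ.trans ?_
    gcongr
  have hfe : ‖∫ x, f x ∂π - ∫ x, e x ∂π‖ ≤ 2 * |τ| * (√n * √s) := by
    rw [← integral_sub (hf.integrable _) (he.integrable _)]
    refine (norm_integral_le_integral_norm _).trans ?_
    refine (integral_mono ((hf.sub he).norm.integrable _)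
      (((BddMeasurable.const (2 * |τ|)).mul hr.norm).integrable _) fun x => ?_).trans ?_
    · simp only [hef x]
      rw [show f x - f x * Complex.exp ((2 * τ * r x : ℝ) * Complex.I) =
        - (f x * (Complex.exp ((2 * τ * r x : ℝ) * Complex.I) - 1)) by ring, norm_neg, norm_mul, hf1,
        one_mul]
      refine (norm_cexp_mul_I_sub_one_le _).trans (le_of_eq ?_)
      rw [abs_mul, abs_mul, abs_two, Real.norm_eq_abs]
    · rw [integral_const_mul]
      exact mul_le_mul_of_nonneg_left h1 (by positivity)
  have hfinal : ∫ x, (r x : ℂ) * e x ∂π - ((2 * τ * (m * s) : ℝ) : ℂ) * Complex.I * ∫ x, e x ∂π =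
      ∫ x, R x ∂π + ((2 * τ : ℝ) : ℂ) * Complex.I *
        ((∫ x, (Q x : ℂ) * f x ∂π - ((m * s : ℝ) : ℂ) * ∫ x, f x ∂π) +
          ((m * s : ℝ) : ℂ) * (∫ x, f x ∂π - ∫ x, e x ∂π)) := by
    rw [hsplit]; push_cast; ring
  rw [hfinal]
  refine (norm_add_le _ _).trans (add_le_add (hRint.trans (le_of_eq (by ring))) ?_)
  rw [norm_mul, norm_mul, Complex.norm_I, mul_one, Complex.norm_real, Real.norm_eq_abs, abs_mul,
    abs_two]
  refine mul_le_mul_of_nonneg_left ?_ (by positivity)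
  refine (norm_add_le _ _).trans (add_le_add hQf ?_)
  rw [norm_mul, Complex.norm_real, Real.norm_eq_abs, abs_of_nonneg (mul_nonneg hm0 hs0)]
  calc m * s * ‖∫ x, f x ∂π - ∫ x, e x ∂π‖ ≤ n * s * (2 * |τ| * (√n * √s)) := by gcongr
    _ = _ := by ring

/-- Stein's identity, approximately: `E[W exp (i t W)] ≈ i t E[exp (i t W)]` for the normalised
pair sum `W = U / (√2 n √s)`. -/
lemma norm_integral_mul_cexp_sub_le (H : DegenerateKernel ρ h B) (hB : 0 < B) [Nonempty ι]
    (hs : 0 < kernelSq ρ h) (t : ℝ) {W : (ι → 𝒵) → ℝ}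
    (hW : W = fun x => pairSum h Finset.univ x / (√2 * Fintype.card ι * √(kernelSq ρ h))) :
    ‖∫ x, (W x : ℂ) * Complex.exp ((t * W x : ℝ) * Complex.I) ∂(Measure.pi fun _ : ι => ρ) -
        (t : ℂ) * Complex.I *
          ∫ x, Complex.exp ((t * W x : ℝ) * Complex.I) ∂(Measure.pi fun _ : ι => ρ)‖ ≤
      (|t| + t ^ 2) * (3 / √(Fintype.card ι) + 8 * (B / (√(Fintype.card ι) * √(kernelSq ρ h))) +
        2 * (√(kernelSq ρ (kernelComp ρ h)) / kernelSq ρ h)) := by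
  set π := Measure.pi fun _ : ι => ρ
  have hn : (1 : ℝ) ≤ Fintype.card ι := Nat.one_le_cast.2 Fintype.card_pos
  have hrow := fun i : ι => H.norm_integral_rowSum_mul_cexp_sub_le hB i
    (t / (√2 * Fintype.card ι * √(kernelSq ρ h)))
  have hcard : ∀ i : ι, (((Finset.univ : Finset ι).erase i).card : ℝ) = Fintype.card ι - 1 :=
    fun i => by
      rw [Finset.card_erase_of_mem (Finset.mem_univ i), Finset.card_univ,
        Nat.cast_sub Fintype.card_pos, Nat.cast_one]
  have hcardn : ((Finset.univ : Finset ι).card : ℝ) = Fintype.card ι := by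
    rw [Finset.card_univ]
  simp_rw [hcard] at hrow
  set n : ℝ := (Fintype.card ι : ℝ)
  set s := kernelSq ρ h
  set g := kernelSq ρ (kernelComp ρ h)
  obtain ⟨a, ha, ha2⟩ : ∃ a, a = √n ∧ a ^ 2 = n := ⟨_, rfl, Real.sq_sqrt (by linarith)⟩
  obtain ⟨b, hb, hb2⟩ : ∃ b, b = √s ∧ b ^ 2 = s := ⟨_, rfl, Real.sq_sqrt hs.le⟩
  obtain ⟨c, hc, hc2⟩ : ∃ c, c = √(2 : ℝ) ∧ c ^ 2 = 2 := ⟨_, rfl, Real.sq_sqrt (by norm_num)⟩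
  have ha0 : 0 < a := ha ▸ Real.sqrt_pos.2 (by linarith)
  have ha1 : 1 ≤ a := ha ▸ Real.one_le_sqrt.2 hn
  have hb0 : 0 < b := hb ▸ Real.sqrt_pos.2 hs
  have hc0 : 0 < c := hc ▸ Real.sqrt_pos.2 (by norm_num)
  have hc1 : c ≤ 3 / 2 := by nlinarith
  have hg0 : 0 ≤ √g := Real.sqrt_nonneg _
  rw [← hb, ← hc] at hW
  rw [← ha, ← hb]
  simp only [← ha, ← hb, ← hc] at hrow
  set κ : ℝ := 1 / (c * n * b) with hκ
  have hκ0 : 0 < κ := by positivity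
  have hτ : t / (c * n * b) = t * κ := by rw [hκ]; ring
  rw [hτ] at hrow
  set U : (ι → 𝒵) → ℝ := pairSum h Finset.univ with hU_def
  have hU : BddMeasurable U := H.bddMeasurable_pairSum Finset.univ
  have hWU : ∀ x, W x = κ * U x := fun x => by rw [hW, hκ]; ring
  have htW : ∀ x, t * W x = t * κ * U x := fun x => by rw [hWU]; ring
  simp_rw [htW, hWU]
  set e : (ι → 𝒵) → ℂ := fun x => Complex.exp ((t * κ * U x : ℝ) * Complex.I) with he_def
  have he : BddMeasurable e := BddMeasurable.cexp_I (hU.1.const_mul _)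
  have he1 : ‖∫ x, e x ∂π‖ ≤ 1 := by
    have := norm_integral_le_of_norm_le_const (μ := π) (f := e) (C := 1)
      (ae_of_all _ fun x => (Complex.norm_exp_ofReal_mul_I _).le)
    simpa using this
  set E := 16 * (t * κ) ^ 2 * (B * (n * a) * s) + 2 * |t * κ| * (B * a * b + c * n * √g +
    2 * |t * κ| * (n * s) * (a * b)) with hE
  have hsum : ‖∫ x, (U x : ℂ) * e x ∂π -
      (n : ℂ) * (((2 * (t * κ) * ((n - 1) * s) : ℝ) : ℂ) * Complex.I * ∫ x, e x ∂π)‖ ≤ n * E := by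
    have : ∀ x, (U x : ℂ) * e x = ∑ i, (rowSum h Finset.univ i x : ℂ) * e x := fun x => by
      rw [hU_def, pairSum, ← Finset.sum_mul]; push_cast; rfl
    simp_rw [this]
    rw [integral_finsetSum _ fun i _ =>
      ((H.bddMeasurable_rowSum Finset.univ i).ofReal.mul he).integrable _]
    have hconst : (n : ℂ) * (((2 * (t * κ) * ((n - 1) * s) : ℝ) : ℂ) * Complex.I * ∫ x, e x ∂π) =
        ∑ i : ι, (((2 * (t * κ) * ((n - 1) * s) : ℝ) : ℂ) * Complex.I * ∫ x, e x ∂π) := by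
      rw [Finset.sum_const, nsmul_eq_mul, ← hcardn]; push_cast; rfl
    rw [hconst, ← Finset.sum_sub_distrib]
    refine (norm_sum_le_of_le _ fun i _ => hrow i).trans ?_
    rw [Finset.sum_const, nsmul_eq_mul, hcardn]
  have hfin : ∫ x, ((κ * U x : ℝ) : ℂ) * e x ∂π - (t : ℂ) * Complex.I * ∫ x, e x ∂π =
      (κ : ℂ) * (∫ x, (U x : ℂ) * e x ∂π -
        (n : ℂ) * (((2 * (t * κ) * ((n - 1) * s) : ℝ) : ℂ) * Complex.I * ∫ x, e x ∂π)) -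
      ((t / n : ℝ) : ℂ) * Complex.I * ∫ x, e x ∂π := by
    have hk : κ * (n * (2 * (t * κ) * ((n - 1) * s))) = t - t / n := by
      have hn0 : n ≠ 0 := by linarith
      exact stein_main_term hn0 hb0.ne' hc0.ne' hc2 hb2.symm hκ
    have hk' : (κ : ℂ) * ((n : ℂ) * ((2 * (t * κ) * ((n - 1) * s) : ℝ) : ℂ)) =
        (t : ℂ) - ((t / n : ℝ) : ℂ) := by exact_mod_cast congrArg Complex.ofReal hk
    have h1 : ∫ x, ((κ * U x : ℝ) : ℂ) * e x ∂π = (κ : ℂ) * ∫ x, (U x : ℂ) * e x ∂π := by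
      rw [← integral_const_mul]; congr 1; ext x; push_cast; ring
    rw [h1]
    linear_combination (Complex.I * ∫ x, e x ∂π) * hk'
  change ‖∫ x, ((κ * U x : ℝ) : ℂ) * e x ∂π - (t : ℂ) * Complex.I * ∫ x, e x ∂π‖ ≤ _
  rw [hfin]
  have hn0 : 0 < n := by linarith
  have hB1 : ‖((t / n : ℝ) : ℂ) * Complex.I * ∫ x, e x ∂π‖ ≤ |t| / a := by
    rw [norm_mul, norm_mul, Complex.norm_I, mul_one, Complex.norm_real, Real.norm_eq_abs, abs_div,
      abs_of_pos hn0]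
    calc |t| / n * ‖∫ x, e x ∂π‖ ≤ |t| / n * 1 := by gcongr
      _ ≤ |t| / a := by
        rw [mul_one]; gcongr; rw [← ha2]; nlinarith
  refine (norm_sub_le _ _).trans ?_
  rw [norm_mul, Complex.norm_real, Real.norm_eq_abs, abs_of_pos hκ0]
  rw [hE, abs_mul, abs_of_pos hκ0, mul_pow, ← sq_abs t] at hsum
  refine (add_le_add (mul_le_mul_of_nonneg_left hsum hκ0.le) hB1).trans ?_
  rw [← sq_abs t]
  exact stein_error_le ha1 hb0 hc0 hc2 hB.le hg0 (abs_nonneg t) ha2.symm hb2.symm hκ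

end DegenerateKernel

end Stein

lemma hasDerivAt_integral_cexp {α : Type*} [MeasurableSpace α] (μ : Measure α)
    [IsProbabilityMeasure μ] {W : α → ℝ} (hW : BddMeasurable W) (t : ℝ) :
    HasDerivAt (fun t : ℝ => ∫ x, Complex.exp ((t * W x : ℝ) * Complex.I) ∂μ)
      (Complex.I * ∫ x, (W x : ℂ) * Complex.exp ((t * W x : ℝ) * Complex.I) ∂μ) t := by
  obtain ⟨hm, C, hC⟩ := hW
  have hexp : ∀ t : ℝ, BddMeasurable fun x => Complex.exp ((t * W x : ℝ) * Complex.I) :=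
    fun t => BddMeasurable.cexp_I (hm.const_mul t)
  have hWb : BddMeasurable W := ⟨hm, C, hC⟩
  rw [← integral_const_mul]
  refine (hasDerivAt_integral_of_dominated_loc_of_deriv_le (s := Set.univ) (bound := fun _ => C)
    (F := fun (t : ℝ) x => Complex.exp ((t * W x : ℝ) * Complex.I))
    (F' := fun (t : ℝ) x => Complex.I * ((W x : ℂ) * Complex.exp ((t * W x : ℝ) * Complex.I)))
    Filter.univ_mem (Eventually.of_forall fun t => (hexp t).1.aestronglyMeasurable)
    ((hexp t).integrable μ)
    ((BddMeasurable.const Complex.I).mul (hWb.ofReal.mul (hexp t))).1.aestronglyMeasurable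
    (ae_of_all _ fun x t _ => ?_) (integrable_const _) (ae_of_all _ fun x t _ => ?_)).2
  · rw [norm_mul, norm_mul, Complex.norm_exp_ofReal_mul_I, Complex.norm_I, Complex.norm_real]
    simpa using hC x
  · have h1 : HasDerivAt (fun t : ℝ => ((t * W x : ℝ) : ℂ) * Complex.I)
        ((W x : ℂ) * Complex.I) t := by
      have := ((hasDerivAt_id t).mul_const (W x)).ofReal_comp.mul_const Complex.I
      simpa using this
    refine h1.cexp.congr_deriv ?_
    ring

/-- A function with `φ(0) = 1` that almost solves the equation `φ' = -t φ` of the characteristic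
function of the standard normal law is close to the solution. -/
lemma norm_sub_cexp_le_of_approx_ode {φ ψ : ℝ → ℂ} {η : ℝ} (h0 : φ 0 = 1)
    (hφ : ∀ t, HasDerivAt φ (Complex.I * ψ t) t)
    (hψ : ∀ t, ‖ψ t - (t : ℂ) * Complex.I * φ t‖ ≤ (|t| + t ^ 2) * η) (t : ℝ) :
    ‖φ t - Complex.exp ((-(t ^ 2 / 2) : ℝ))‖ ≤ (|t| + t ^ 2) * Real.exp (t ^ 2 / 2) * |t| * η := by
  have hη : 0 ≤ η := by
    have := (norm_nonneg _).trans (hψ 1)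
    norm_num at this
    exact this
  set F : ℝ → ℂ := fun s => φ s * ((Real.exp (s ^ 2 / 2) : ℝ) : ℂ) with hF
  have hE : ∀ s : ℝ, HasDerivAt (fun s : ℝ => ((Real.exp (s ^ 2 / 2) : ℝ) : ℂ))
      ((s * Real.exp (s ^ 2 / 2) : ℝ) : ℂ) s := fun s => by
    have h1 : HasDerivAt (fun s : ℝ => s ^ 2 / 2) s s := by
      have := (hasDerivAt_pow 2 s).div_const 2
      simpa using this
    have := h1.exp.ofReal_comp
    refine this.congr_deriv ?_
    push_cast
    ring
  have hF' : ∀ s, HasDerivAt F ((Complex.I * (ψ s - (s : ℂ) * Complex.I * φ s)) *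
      ((Real.exp (s ^ 2 / 2) : ℝ) : ℂ)) s := fun s => by
    refine ((hφ s).mul (hE s)).congr_deriv ?_
    push_cast
    linear_combination ((s : ℂ) * φ s * Complex.exp ((s : ℂ) ^ 2 / 2)) * Complex.I_mul_I
  have hbound : ∀ s ∈ Set.Icc (-|t|) |t|, ‖(Complex.I * (ψ s - (s : ℂ) * Complex.I * φ s)) *
      ((Real.exp (s ^ 2 / 2) : ℝ) : ℂ)‖ ≤ (|t| + t ^ 2) * η * Real.exp (t ^ 2 / 2) := by
    intro s hs
    have hs1 : |s| ≤ |t| := abs_le.2 hs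
    have hs2 : s ^ 2 ≤ t ^ 2 := sq_le_sq.2 hs1
    rw [norm_mul, norm_mul, Complex.norm_I, one_mul, Complex.norm_real, Real.norm_eq_abs,
      Real.abs_exp]
    gcongr
    exact (hψ s).trans (by gcongr)
  have hmv := Convex.norm_image_sub_le_of_norm_hasDerivWithin_le
    (fun s _ => (hF' s).hasDerivWithinAt) hbound (convex_Icc _ _)
    (show (0 : ℝ) ∈ Set.Icc (-|t|) |t| by simp) (show t ∈ Set.Icc (-|t|) |t| from
      ⟨neg_abs_le t, le_abs_self t⟩)
  have hF0 : F 0 = 1 := by simp [hF, h0]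
  have hFt : φ t - Complex.exp ((-(t ^ 2 / 2) : ℝ)) =
      (F t - F 0) * ((Real.exp (-(t ^ 2 / 2)) : ℝ) : ℂ) := by
    rw [hF0, hF, sub_mul, mul_assoc, ← Complex.ofReal_mul, ← Real.exp_add]
    simp
  rw [hFt, norm_mul, Complex.norm_real, Real.norm_eq_abs, Real.abs_exp]
  have hexp1 : Real.exp (-(t ^ 2 / 2)) ≤ 1 := Real.exp_le_one_iff.2 (by nlinarith [sq_nonneg t])
  calc ‖F t - F 0‖ * Real.exp (-(t ^ 2 / 2)) ≤ ‖F t - F 0‖ * 1 := by gcongr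
    _ ≤ (|t| + t ^ 2) * η * Real.exp (t ^ 2 / 2) * ‖t - 0‖ := by rw [mul_one]; exact hmv
    _ = _ := by rw [sub_zero, Real.norm_eq_abs]; ring

/-- Asymptotic normality of degenerate U-statistics with kernels that vary with the sample size:
the characteristic functions of the normalised pair sums converge to that of the standard normal
law, if the kernels are of smaller order than `√n` times their `L²` norm and their compositions
with themselves are of smaller order than their second moment. -/
theorem tendsto_charFun_pairSum {𝒵 : Type*} [MeasurableSpace 𝒵] {ρ : Measure 𝒵}
    [IsProbabilityMeasure ρ] {h : ℕ → 𝒵 → 𝒵 → ℝ} {B : ℕ → ℝ}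
    (H : ∀ᶠ n in atTop, DegenerateKernel ρ (h n) (B n)) (hB : ∀ᶠ n in atTop, 0 < B n)
    (hs : ∀ᶠ n in atTop, 0 < kernelSq ρ (h n))
    (h1 : Tendsto (fun n : ℕ => B n / (√n * √(kernelSq ρ (h n)))) atTop (𝓝 0))
    (h2 : Tendsto (fun n : ℕ => √(kernelSq ρ (kernelComp ρ (h n))) / kernelSq ρ (h n))
      atTop (𝓝 0)) (t : ℝ) :
    Tendsto (fun n : ℕ => ∫ x : Fin n → 𝒵, Complex.exp ((t *
        (pairSum (h n) Finset.univ x / (√2 * n * √(kernelSq ρ (h n)))) : ℝ) * Complex.I)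
        ∂(Measure.pi fun _ => ρ)) atTop (𝓝 (Complex.exp ((-(t ^ 2 / 2) : ℝ)))) := by
  rw [tendsto_iff_norm_sub_tendsto_zero]
  have h3 : Tendsto (fun n : ℕ => 3 / √(n : ℝ)) atTop (𝓝 0) :=
    tendsto_const_nhds.div_atTop (Real.tendsto_sqrt_atTop.comp tendsto_natCast_atTop_atTop)
  have hη := (((h3.add (h1.const_mul 8)).add (h2.const_mul 2)).const_mul
    ((|t| + t ^ 2) * Real.exp (t ^ 2 / 2) * |t|))
  simp only [mul_zero, add_zero] at hη
  refine squeeze_zero' (Eventually.of_forall fun _ => norm_nonneg _) ?_ hη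
  filter_upwards [H, hB, hs, eventually_ge_atTop 1] with n Hn hBn hsn hn
  have : Nonempty (Fin n) := ⟨⟨0, hn⟩⟩
  set W : (Fin n → 𝒵) → ℝ := fun x =>
    pairSum (h n) Finset.univ x / (√2 * n * √(kernelSq ρ (h n))) with hW
  have hWb : BddMeasurable W := by
    simp only [hW, div_eq_mul_inv]
    exact (Hn.bddMeasurable_pairSum _).mul (BddMeasurable.const _)
  have key := fun t => Hn.norm_integral_mul_cexp_sub_le (ι := Fin n) hBn hsn t (W := W)
    (by simp [hW])
  simp only [Fintype.card_fin] at key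
  exact norm_sub_cexp_le_of_approx_ode (by simp)
    (fun t => hasDerivAt_integral_cexp _ hWb t) key t

/-! ### Regularised inverses of positive operators -/

section RegInv

lemma ringInverse_eq_of_mul_eq_one {M : Type*} [MonoidWithZero M] {a b : M} (h : a * b = 1)
    (h' : b * a = 1) : Ring.inverse a = b := Ring.inverse_unit ⟨a, b, h, h'⟩

variable {E : Type*} [NormedAddCommGroup E] [InnerProductSpace ℝ E]

lemma isPositive_iff_real (T : E →L[ℝ] E) :
    T.IsPositive ↔ (∀ u v, ⟪T u, v⟫_ℝ = ⟪u, T v⟫_ℝ) ∧ ∀ u, 0 ≤ ⟪T u, u⟫_ℝ :=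
  ContinuousLinearMap.isPositive_iff T

/-- The regularised inverse `(A + γ I)⁻¹` (the junk value `0` if `A + γ I` is not invertible). -/
noncomputable def regInv (A : E →L[ℝ] E) (γ : ℝ) : E →L[ℝ] E :=
  Ring.inverse (A + γ • ContinuousLinearMap.id ℝ E)

variable [CompleteSpace E] {A A' : E →L[ℝ] E} {γ : ℝ}

lemma isUnit_add_smul_id (hA : A.IsPositive) (hγ : 0 < γ) :
    IsUnit (A + γ • ContinuousLinearMap.id ℝ E) := by
  refine ContinuousLinearMap.isUnit_of_forall_le_norm_inner_map _ (c := ⟨γ, hγ.le⟩) hγ fun x => ?_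
  have h1 : ⟪(A + γ • ContinuousLinearMap.id ℝ E) x, x⟫_ℝ = ⟪A x, x⟫_ℝ + γ * ‖x‖ ^ 2 := by
    simp [inner_add_left, real_inner_smul_left]
  have h2 := ((isPositive_iff_real A).1 hA).2 x
  rw [h1, Real.norm_eq_abs, abs_of_nonneg (by positivity)]
  change ‖x‖ ^ 2 * γ ≤ _
  linarith

lemma regInv_apply_add (hA : A.IsPositive) (hγ : 0 < γ) (x : E) :
    regInv A γ (A x + γ • x) = x :=
  congrArg (fun T : E →L[ℝ] E => T x) (Ring.inverse_mul_cancel _ (isUnit_add_smul_id hA hγ))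

lemma apply_regInv_add (hA : A.IsPositive) (hγ : 0 < γ) (x : E) :
    A (regInv A γ x) + γ • regInv A γ x = x :=
  congrArg (fun T : E →L[ℝ] E => T x) (Ring.mul_inverse_cancel _ (isUnit_add_smul_id hA hγ))

lemma regInv_symm (hA : A.IsPositive) (hγ : 0 < γ) (x y : E) :
    ⟪regInv A γ x, y⟫_ℝ = ⟪x, regInv A γ y⟫_ℝ := by
  conv_lhs => rw [← apply_regInv_add hA hγ y]
  conv_rhs => rw [← apply_regInv_add hA hγ x]
  rw [inner_add_right, inner_add_left, real_inner_smul_left, real_inner_smul_right,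
    ((isPositive_iff_real A).1 hA).1]

lemma norm_regInv_le (hA : A.IsPositive) (hγ : 0 < γ) : ‖regInv A γ‖ ≤ γ⁻¹ := by
  refine ContinuousLinearMap.opNorm_le_bound _ (inv_nonneg.2 hγ.le) fun x => ?_
  set y := regInv A γ x
  have h1 : A y + γ • y = x := apply_regInv_add hA hγ x
  have h2 : ⟪x, y⟫_ℝ = ⟪A y, y⟫_ℝ + γ * ‖y‖ ^ 2 := by
    rw [← h1, inner_add_left, real_inner_smul_left, real_inner_self_eq_norm_sq]
  have h3 := ((isPositive_iff_real A).1 hA).2 y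
  have h4 := real_inner_le_norm x y
  rw [inv_mul_eq_div, le_div_iff₀ hγ]
  by_cases hy : ‖y‖ = 0
  · rw [hy, zero_mul]; positivity
  · have : 0 < ‖y‖ := lt_of_le_of_ne (norm_nonneg _) (Ne.symm hy)
    nlinarith

lemma regInv_sub_regInv (hA : A.IsPositive) (hA' : A'.IsPositive) (hγ : 0 < γ) :
    regInv A γ - regInv A' γ = regInv A γ ∘L (A' - A) ∘L regInv A' γ := by
  ext x
  have h1 := apply_regInv_add hA' hγ x
  have h2 := regInv_apply_add hA hγ (regInv A' γ x)
  have h3 : A' (regInv A' γ x) - A (regInv A' γ x) =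
      x - (A (regInv A' γ x) + γ • regInv A' γ x) := by
    conv_rhs => enter [1]; rw [← h1]
    abel
  simp only [sub_apply, ContinuousLinearMap.comp_apply]
  rw [h3, map_sub, h2]

lemma norm_regInv_sub_regInv_le (hA : A.IsPositive) (hA' : A'.IsPositive) (hγ : 0 < γ) :
    ‖regInv A γ - regInv A' γ‖ ≤ (γ ^ 2)⁻¹ * ‖A - A'‖ := by
  rw [regInv_sub_regInv hA hA' hγ]
  calc _ ≤ ‖regInv A γ‖ * (‖A' - A‖ * ‖regInv A' γ‖) :=
        (ContinuousLinearMap.opNorm_comp_le _ _).trans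
          (mul_le_mul_of_nonneg_left (ContinuousLinearMap.opNorm_comp_le _ _) (norm_nonneg _))
    _ ≤ γ⁻¹ * (‖A' - A‖ * γ⁻¹) := by
        gcongr
        · exact norm_regInv_le hA hγ
        · exact norm_regInv_le hA' hγ
    _ = _ := by rw [norm_sub_rev A']; ring

/-- The operator `(A + γ)⁻¹ A (A + γ)⁻¹`, whose quadratic form computes the Hilbert-Schmidt norm
of `(A + γ)⁻¹ A`. -/
noncomputable def regSandwich (A : E →L[ℝ] E) (γ : ℝ) : E →L[ℝ] E :=
  regInv A γ ∘L A ∘L regInv A γ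

lemma regSandwich_eq (hA : A.IsPositive) (hγ : 0 < γ) :
    regSandwich A γ = regInv A γ - γ • (regInv A γ ∘L regInv A γ) := by
  ext x
  have := apply_regInv_add hA hγ x
  have h2 : A (regInv A γ x) = x - γ • regInv A γ x := by rw [eq_sub_iff_add_eq, this]
  simp [regSandwich, h2]

lemma norm_regSandwich_le (hA : A.IsPositive) (hγ : 0 < γ) : ‖regSandwich A γ‖ ≤ 2 * γ⁻¹ := by
  have h := norm_regInv_le hA hγ
  rw [regSandwich_eq hA hγ]
  calc _ ≤ ‖regInv A γ‖ + γ * (‖regInv A γ‖ * ‖regInv A γ‖) := by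
        refine (norm_sub_le _ _).trans (add_le_add le_rfl ?_)
        rw [norm_smul, Real.norm_eq_abs, abs_of_pos hγ]
        exact mul_le_mul_of_nonneg_left (ContinuousLinearMap.opNorm_comp_le _ _) hγ.le
    _ ≤ γ⁻¹ + γ * (γ⁻¹ * γ⁻¹) := by gcongr
    _ = _ := by field_simp; ring

lemma norm_regSandwich_sub_le (hA : A.IsPositive) (hA' : A'.IsPositive) (hγ : 0 < γ) :
    ‖regSandwich A γ - regSandwich A' γ‖ ≤ 3 * ((γ ^ 2)⁻¹ * ‖A - A'‖) := by
  have h := norm_regInv_le hA hγ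
  have h' := norm_regInv_le hA' hγ
  have hd := norm_regInv_sub_regInv_le hA hA' hγ
  set δ := (γ ^ 2)⁻¹ * ‖A - A'‖
  have hδ : 0 ≤ δ := by positivity
  rw [regSandwich_eq hA hγ, regSandwich_eq hA' hγ]
  have e : regInv A γ - γ • (regInv A γ ∘L regInv A γ) -
      (regInv A' γ - γ • (regInv A' γ ∘L regInv A' γ)) =
      (regInv A γ - regInv A' γ) - γ • ((regInv A γ - regInv A' γ) ∘L regInv A γ +
        regInv A' γ ∘L (regInv A γ - regInv A' γ)) := by
    ext x; simp; module
  rw [e]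
  calc _ ≤ ‖regInv A γ - regInv A' γ‖ + γ * (‖regInv A γ - regInv A' γ‖ * ‖regInv A γ‖ +
          ‖regInv A' γ‖ * ‖regInv A γ - regInv A' γ‖) := by
        refine (norm_sub_le _ _).trans (add_le_add le_rfl ?_)
        rw [norm_smul, Real.norm_eq_abs, abs_of_pos hγ]
        exact mul_le_mul_of_nonneg_left ((norm_add_le _ _).trans (add_le_add
          (ContinuousLinearMap.opNorm_comp_le _ _) (ContinuousLinearMap.opNorm_comp_le _ _))) hγ.le
    _ ≤ δ + γ * (δ * γ⁻¹ + γ⁻¹ * δ) := by gcongr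
    _ = _ := by field_simp; ring

end RegInv

/-! ### Eigenvectors and the spectral decomposition of second moment operators -/

section Spectral

variable {E : Type*} [NormedAddCommGroup E] [InnerProductSpace ℝ E]

/-- An orthonormal family of eigenvectors indexed by the positive eigenvalues counted with
multiplicity. It spans every finite-dimensional eigenspace of a positive eigenvalue. -/
lemma exists_orthonormal_eigenvectors {A : E →L[ℝ] E}
    (hA : ∀ u v, ⟪A u, v⟫_ℝ = ⟪u, A v⟫_ℝ) :
    ∃ e : PosEig A → E, Orthonormal ℝ e ∧ (∀ p, A (e p) = eig A p • e p) ∧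
      ∀ t : ℝ, 0 < t → FiniteDimensional ℝ (Module.End.eigenspace (A : E →ₗ[ℝ] E) t) →
        ∀ w, (∀ p, ⟪e p, w⟫_ℝ = 0) → ∀ z, A z = t • z → ⟪z, w⟫_ℝ = 0 := by
  have hex : ∀ t : ℝ, ∃ b : Fin (Module.finrank ℝ (Module.End.eigenspace (A : E →ₗ[ℝ] E) t)) → E,
      Orthonormal ℝ b ∧ (∀ i, A (b i) = t • b i) ∧
      (FiniteDimensional ℝ (Module.End.eigenspace (A : E →ₗ[ℝ] E) t) →
        ∀ w, (∀ i, ⟪b i, w⟫_ℝ = 0) → ∀ z, A z = t • z → ⟪z, w⟫_ℝ = 0) := by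
    intro t
    by_cases hfd : FiniteDimensional ℝ (Module.End.eigenspace (A : E →ₗ[ℝ] E) t)
    · let b := stdOrthonormalBasis ℝ (Module.End.eigenspace (A : E →ₗ[ℝ] E) t)
      refine ⟨fun i => (b i : E), b.orthonormal.comp_linearIsometry
        (Module.End.eigenspace (A : E →ₗ[ℝ] E) t).subtypeₗᵢ, fun i =>
          Module.End.mem_eigenspace_iff.1 (b i).2, fun _ w hw z hz => ?_⟩
      have hz' : z ∈ Module.End.eigenspace (A : E →ₗ[ℝ] E) t := Module.End.mem_eigenspace_iff.2 hz
      have h1 := congrArg (Submodule.subtype _) (b.sum_repr ⟨z, hz'⟩)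
      simp only [map_sum, map_smul, Submodule.subtype_apply] at h1
      rw [← h1, sum_inner]
      exact Finset.sum_eq_zero fun i _ => by rw [real_inner_smul_left, hw, mul_zero]
    · have h0 := Module.finrank_of_not_finite hfd
      have : IsEmpty (Fin (Module.finrank ℝ (Module.End.eigenspace (A : E →ₗ[ℝ] E) t))) := by
        rw [h0]; infer_instance
      exact ⟨isEmptyElim, ⟨isEmptyElim, fun i => isEmptyElim i⟩, isEmptyElim, fun h => absurd h hfd⟩
  choose b hb hAb hspan using hex
  refine ⟨fun p => b p.1.1 p.2, ⟨fun p => (hb _).1 _, ?_⟩, fun p => hAb _ _, ?_⟩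
  · rintro ⟨⟨t, ht⟩, i⟩ ⟨⟨s, hs⟩, j⟩ hij
    simp only
    by_cases hts : t = s
    · subst hts
      exact (hb t).2 fun h => hij (by rw [h])
    · have h1 := hA (b t i) (b s j)
      rw [hAb, hAb, real_inner_smul_left, real_inner_smul_right] at h1
      have h2 : (t - s) * ⟪b t i, b s j⟫_ℝ = 0 := by linarith
      exact (mul_eq_zero.1 h2).resolve_left (sub_ne_zero.2 hts)
  · intro t ht hfd w hw z hz
    by_cases hz0 : z = 0
    · simp [hz0]
    · have hev : Module.End.HasEigenvalue (A : E →ₗ[ℝ] E) t :=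
        Module.End.hasEigenvalue_of_hasEigenvector
          (x := z) ⟨Module.End.mem_eigenspace_iff.2 hz, hz0⟩
      exact hspan t hfd w (fun i => hw ⟨⟨t, ht, hev⟩, i⟩) z hz

/-- The operator with eigenvalues `f p` on the orthonormal family `e p` and `c` on its orthogonal
complement. -/
noncomputable def diagOp {κ : Type*} [Fintype κ] (e : κ → E) (c : ℝ) (f : κ → ℝ) : E →L[ℝ] E :=
  c • ContinuousLinearMap.id ℝ E + ∑ p, (f p - c) • rankOne ℝ (e p) (e p)

section diagOp

variable {κ : Type*} [Fintype κ] {e : κ → E}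

lemma diagOp_apply (c : ℝ) (f : κ → ℝ) (v : E) :
    diagOp e c f v = c • v + ∑ p, ((f p - c) * ⟪e p, v⟫_ℝ) • e p := by
  simp [diagOp, smul_smul]

lemma inner_diagOp_apply (he : Orthonormal ℝ e) (c : ℝ) (f : κ → ℝ) (v : E) (q : κ) :
    ⟪e q, diagOp e c f v⟫_ℝ = f q * ⟪e q, v⟫_ℝ := by
  classical
  rw [diagOp_apply, inner_add_right, inner_sum, real_inner_smul_right]
  simp_rw [real_inner_smul_right, orthonormal_iff_ite.1 he]
  simp
  ring

lemma diagOp_comp (he : Orthonormal ℝ e) (c c' : ℝ) (f f' : κ → ℝ) :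
    diagOp e c f ∘L diagOp e c' f' = diagOp e (c * c') (fun p => f p * f' p) := by
  ext v
  rw [ContinuousLinearMap.comp_apply, diagOp_apply c f]
  simp_rw [inner_diagOp_apply he]
  rw [diagOp_apply, diagOp_apply, smul_add, smul_smul, add_assoc, Finset.smul_sum,
    ← Finset.sum_add_distrib]
  congr 1
  refine Finset.sum_congr rfl fun p _ => ?_
  rw [smul_smul, ← add_smul]
  congr 1
  ring

lemma diagOp_one : diagOp e 1 (fun _ => 1) = ContinuousLinearMap.id ℝ E := by
  ext v; simp [diagOp_apply]

lemma diagOp_add_smul_id (f : κ → ℝ) (γ : ℝ) :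
    diagOp e 0 f + γ • ContinuousLinearMap.id ℝ E = diagOp e γ (fun p => f p + γ) := by
  ext v; simp [diagOp_apply, add_comm]

lemma diagOp_symm (c : ℝ) (f : κ → ℝ) (u v : E) :
    ⟪diagOp e c f u, v⟫_ℝ = ⟪u, diagOp e c f v⟫_ℝ := by
  rw [diagOp_apply, diagOp_apply, inner_add_left, inner_add_right, sum_inner, inner_sum,
    real_inner_smul_left, real_inner_smul_right]
  congr 1
  refine Finset.sum_congr rfl fun p _ => ?_
  rw [real_inner_smul_left, real_inner_smul_right, real_inner_comm u]
  ring

lemma diagOp_isPositive (he : Orthonormal ℝ e) {c : ℝ} {f : κ → ℝ} (hc : 0 ≤ c)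
    (hf : ∀ p, 0 ≤ f p) : (diagOp e c f).IsPositive := by
  refine (isPositive_iff_real _).2 ⟨diagOp_symm c f, fun u => ?_⟩
  have : diagOp e c f = diagOp e (√c) (fun p => √(f p)) ∘L diagOp e (√c) (fun p => √(f p)) := by
    rw [diagOp_comp he, Real.mul_self_sqrt hc]
    simp_rw [Real.mul_self_sqrt (hf _)]
  rw [this, ContinuousLinearMap.comp_apply, diagOp_symm]
  exact real_inner_self_nonneg

end diagOp

/-- The second moment operator `n⁻¹ ∑ x_i ⊗ x_i` of a finite family of points. -/
noncomputable def secondMoment {ι : Type*} [Fintype ι] (x : ι → E) : E →L[ℝ] E :=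
  (Fintype.card ι : ℝ)⁻¹ • ∑ i, rankOne ℝ (x i) (x i)

/-- The mean `n⁻¹ ∑ ⟪T x_i, x_i⟫` of a quadratic form over a finite family of points. -/
noncomputable def meanForm {ι : Type*} [Fintype ι] (T : E →L[ℝ] E) (x : ι → E) : ℝ :=
  (Fintype.card ι : ℝ)⁻¹ * ∑ i, ⟪T (x i), x i⟫_ℝ

section secondMoment

variable {ι : Type*} [Fintype ι] (x : ι → E)

lemma secondMoment_apply (v : E) :
    secondMoment x v = (Fintype.card ι : ℝ)⁻¹ • ∑ i, ⟪x i, v⟫_ℝ • x i := by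
  simp [secondMoment]

lemma inner_secondMoment (u v : E) :
    ⟪secondMoment x u, v⟫_ℝ = (Fintype.card ι : ℝ)⁻¹ * ∑ i, ⟪x i, u⟫_ℝ * ⟪x i, v⟫_ℝ := by
  rw [secondMoment_apply, real_inner_smul_left, sum_inner]
  simp_rw [real_inner_smul_left]

lemma secondMoment_isPositive : (secondMoment x).IsPositive := by
  refine (isPositive_iff_real _).2 ⟨fun u v => ?_, fun u => ?_⟩
  · rw [real_inner_comm (secondMoment x v) u, inner_secondMoment, inner_secondMoment]
    simp_rw [mul_comm]
  · rw [inner_secondMoment]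
    exact mul_nonneg (by positivity) (Finset.sum_nonneg fun i _ => mul_self_nonneg _)

lemma isCompactOperator_secondMoment : IsCompactOperator (secondMoment x) := by
  have h1 : ∀ i, IsCompactOperator (rankOne ℝ (x i) (x i)) := fun i => by
    have : IsCompactOperator (innerSL ℝ (x i)) :=
      isCompactOperator_of_locallyCompactSpace_dom (innerSL ℝ (x i))
    exact this.clm_comp (ContinuousLinearMap.toSpanSingleton ℝ (x i))
  have h2 : ∀ s : Finset ι, IsCompactOperator (∑ i ∈ s, rankOne ℝ (x i) (x i) : E →L[ℝ] E) := by
    classical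
    intro s
    induction s using Finset.induction_on with
    | empty => simpa using isCompactOperator_zero
    | insert a s ha ih => rw [Finset.sum_insert ha]; exact (h1 a).add ih
  have h3 := (h2 Finset.univ).smul (Fintype.card ι : ℝ)⁻¹
  simpa only [secondMoment, FunLike.coe_smul, FunLike.coe_sum] using h3

variable [CompleteSpace E] [Nonempty ι]

/-- The spectral decomposition of a second moment operator: the orthonormal eigenvectors with
positive eigenvalues are finitely many, and the points lie in their span. -/
lemma exists_spectral_of_eq_secondMoment {A : E →L[ℝ] E} (hA : A = secondMoment x) :
    ∃ (_ : Fintype (PosEig A)) (e : PosEig A → E), Orthonormal ℝ e ∧ A = diagOp e 0 (eig A) ∧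
      ∀ i, x i = ∑ p, ⟪e p, x i⟫_ℝ • e p := by
  have hpos := (isPositive_iff_real A).1 (hA ▸ secondMoment_isPositive x)
  have hcomp : IsCompactOperator A := hA ▸ isCompactOperator_secondMoment x
  have hAv : ∀ v, A v = (Fintype.card ι : ℝ)⁻¹ • ∑ i, ⟪x i, v⟫_ℝ • x i := fun v => by
    rw [hA, secondMoment_apply]
  have hAi : ∀ u v, ⟪A u, v⟫_ℝ = (Fintype.card ι : ℝ)⁻¹ * ∑ i, ⟪x i, u⟫_ℝ * ⟪x i, v⟫_ℝ :=
    fun u v => by rw [hA, inner_secondMoment]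
  obtain ⟨e, he, hAe, hspan⟩ := exists_orthonormal_eigenvectors hpos.1
  have heig : ∀ p : PosEig A, 0 < eig A p := fun p => p.1.2.1
  have hmem : ∀ p, e p ∈ Submodule.span ℝ (Set.range x) := fun p => by
    have h1 : e p = (eig A p)⁻¹ • A (e p) := by
      rw [hAe, smul_smul, inv_mul_cancel₀ (heig p).ne', one_smul]
    rw [h1, hAv]
    exact Submodule.smul_mem _ _ (Submodule.smul_mem _ _ (Submodule.sum_mem _ fun i _ =>
      Submodule.smul_mem _ _ (Submodule.subset_span ⟨i, rfl⟩)))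
  have hfin : Finite (PosEig A) := by
    have hfd : FiniteDimensional ℝ (Submodule.span ℝ (Set.range x)) :=
      FiniteDimensional.span_of_finite ℝ (Set.finite_range x)
    have hli : LinearIndependent ℝ
        (fun p => (⟨e p, hmem p⟩ : Submodule.span ℝ (Set.range x))) :=
      LinearIndependent.of_comp (Submodule.subtype _) he.linearIndependent
    exact hli.finite_of_isNoetherian
  obtain ⟨hft⟩ := nonempty_fintype (PosEig A)
  refine ⟨hft, e, he, ?_⟩
  -- vectors orthogonal to all `e p` are in the kernel
  have hker : ∀ w, (∀ p, ⟪e p, w⟫_ℝ = 0) → A w = 0 := by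
    intro w hw
    have hbot := ContinuousLinearMap.orthogonalComplement_iSup_eigenspaces_eq_bot hcomp hpos.1
    have hm : A w ∈ (⨆ μ, Module.End.eigenspace (A : E →ₗ[ℝ] E) μ)ᗮ := by
      rw [Submodule.mem_orthogonal]
      intro z hz
      refine Submodule.iSup_induction _ (motive := fun z => ⟪z, A w⟫_ℝ = 0) hz
        (fun t z hz => ?_) (by simp) fun y z hy hz => by rw [inner_add_left, hy, hz, add_zero]
      have hz' : A z = t • z := Module.End.mem_eigenspace_iff.1 hz
      rw [← hpos.1, hz', real_inner_smul_left]
      rcases lt_trichotomy t 0 with ht | ht | ht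
      · have h1 := hpos.2 z
        rw [hz', real_inner_smul_left, real_inner_self_eq_norm_sq] at h1
        have h2 : ‖z‖ ^ 2 = 0 := le_antisymm (by nlinarith [sq_nonneg ‖z‖]) (sq_nonneg _)
        rw [norm_eq_zero.1 (pow_eq_zero_iff two_ne_zero |>.1 h2)]
        simp
      · rw [ht, zero_mul]
      · rw [hspan t ht (ContinuousLinearMap.finite_dimensional_eigenspace hcomp t ht.ne') w hw z hz',
          mul_zero]
    rw [hbot] at hm
    exact (Submodule.mem_bot ℝ).1 hm
  have horth : ∀ v p, ⟪e p, v - ∑ q, ⟪e q, v⟫_ℝ • e q⟫_ℝ = 0 := fun v p => by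
    classical
    rw [inner_sub_right, inner_sum]
    simp_rw [real_inner_smul_right, orthonormal_iff_ite.1 he]
    simp
  refine ⟨?_, fun i => ?_⟩
  · ext v
    have h1 := hker _ (horth v)
    rw [map_sub, sub_eq_zero] at h1
    rw [h1, diagOp_apply, map_sum]
    simp [hAe, smul_smul, mul_comm]
  · have h1 := hker _ (horth (x i))
    set w := x i - ∑ q, ⟪e q, x i⟫_ℝ • e q with hw
    have h2 : ∀ j, ⟪x j, w⟫_ℝ = 0 := by
      have h3 : ⟪A w, w⟫_ℝ = 0 := by rw [h1, inner_zero_left]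
      have hn : (Fintype.card ι : ℝ) ≠ 0 := Nat.cast_ne_zero.2 Fintype.card_ne_zero
      rw [hAi, mul_eq_zero, or_iff_right (inv_ne_zero hn),
        Finset.sum_eq_zero_iff_of_nonneg fun j _ => mul_self_nonneg _] at h3
      exact fun j => mul_self_eq_zero.1 (h3 j (Finset.mem_univ j))
    have h4 : ⟪w, w⟫_ℝ = 0 := by
      conv_lhs => enter [3]; rw [hw]
      rw [inner_sub_left, h2, sum_inner, zero_sub, neg_eq_zero]
      exact Finset.sum_eq_zero fun q _ => by rw [real_inner_smul_left, horth, mul_zero]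
    rw [inner_self_eq_zero, hw, sub_eq_zero] at h4
    exact h4

lemma meanForm_diagOp {κ : Type*} [Fintype κ] {e : κ → E} {l : κ → ℝ} (he : Orthonormal ℝ e)
    (hA : secondMoment x = diagOp e 0 l) (hx : ∀ i, x i = ∑ p, ⟪e p, x i⟫_ℝ • e p)
    (c : ℝ) (f : κ → ℝ) : meanForm (diagOp e c f) x = ∑ p, f p * l p := by
  have h1 : ∀ i, ⟪diagOp e c f (x i), x i⟫_ℝ = ∑ p, f p * (⟪x i, e p⟫_ℝ * ⟪x i, e p⟫_ℝ) := by
    intro i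
    conv_lhs => enter [3]; rw [hx i]
    rw [inner_sum]
    refine Finset.sum_congr rfl fun p _ => ?_
    rw [real_inner_smul_right, real_inner_comm (e p) (diagOp e c f (x i)),
      inner_diagOp_apply he, real_inner_comm (e p) (x i)]
    ring
  rw [meanForm]
  simp_rw [h1]
  rw [Finset.sum_comm, Finset.mul_sum]
  refine Finset.sum_congr rfl fun p _ => ?_
  rw [← Finset.mul_sum, mul_left_comm, ← inner_secondMoment, hA, real_inner_comm,
    inner_diagOp_apply he, real_inner_self_eq_norm_sq, he.1 p]
  ring

variable {γ : ℝ}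

/-- The resolvent in terms of the spectral decomposition. -/
lemma regInv_diagOp {κ : Type*} [Fintype κ] {e : κ → E} {l : κ → ℝ} (he : Orthonormal ℝ e)
    (hl : ∀ p, 0 ≤ l p) (hγ : 0 < γ) :
    regInv (diagOp e 0 l) γ = diagOp e γ⁻¹ (fun p => (l p + γ)⁻¹) := by
  have h0 : ∀ p, l p + γ ≠ 0 := fun p => (add_pos_of_nonneg_of_pos (hl p) hγ).ne'
  rw [regInv, diagOp_add_smul_id]
  refine ringInverse_eq_of_mul_eq_one ?_ ?_
  · change diagOp e γ _ ∘L diagOp e γ⁻¹ _ = ContinuousLinearMap.id ℝ E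
    rw [diagOp_comp he, mul_inv_cancel₀ hγ.ne']
    simp_rw [mul_inv_cancel₀ (h0 _)]
    exact diagOp_one
  · change diagOp e γ⁻¹ _ ∘L diagOp e γ _ = ContinuousLinearMap.id ℝ E
    rw [diagOp_comp he, inv_mul_cancel₀ hγ.ne']
    simp_rw [inv_mul_cancel₀ (h0 _)]
    exact diagOp_one

lemma invSqrt_secondMoment (hγ : 0 < γ) :
    (invSqrt (secondMoment x + γ • ContinuousLinearMap.id ℝ E)).IsPositive ∧
    invSqrt (secondMoment x + γ • ContinuousLinearMap.id ℝ E) ∘L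
      invSqrt (secondMoment x + γ • ContinuousLinearMap.id ℝ E) = regInv (secondMoment x) γ := by
  obtain ⟨_, e, he, hA, -⟩ := exists_spectral_of_eq_secondMoment x rfl
  set l := eig (secondMoment x) with hl_def
  have hl : ∀ p, 0 ≤ l p := fun p => p.1.2.1.le
  have h0 : ∀ p, 0 < l p + γ := fun p => add_pos_of_nonneg_of_pos (hl p) hγ
  set T := secondMoment x + γ • ContinuousLinearMap.id ℝ E with hT
  have hex : ∃ B : E →L[ℝ] E, B.IsPositive ∧ (B ∘L B) ∘L T = ContinuousLinearMap.id ℝ E ∧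
      T ∘L (B ∘L B) = ContinuousLinearMap.id ℝ E := by
    refine ⟨diagOp e (√γ⁻¹) (fun p => √(l p + γ)⁻¹),
      diagOp_isPositive he (Real.sqrt_nonneg _) fun p => Real.sqrt_nonneg _, ?_⟩
    rw [diagOp_comp he, Real.mul_self_sqrt (inv_nonneg.2 hγ.le)]
    simp_rw [Real.mul_self_sqrt (inv_nonneg.2 (h0 _).le)]
    rw [← regInv_diagOp he hl hγ, ← hA]
    have hu := isUnit_add_smul_id (secondMoment_isPositive x) hγ
    exact ⟨Ring.inverse_mul_cancel _ hu, Ring.mul_inverse_cancel _ hu⟩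
  have hdef : invSqrt T = hex.choose := by rw [invSqrt, dif_pos hex]
  obtain ⟨h1, h2, h3⟩ := hex.choose_spec
  rw [← hdef] at h1 h2 h3
  exact ⟨h1, (ringInverse_eq_of_mul_eq_one h3 h2).symm⟩

lemma d_one_secondMoment (hγ : 0 < γ) :
    d 1 (secondMoment x) γ = meanForm (regInv (secondMoment x) γ) x := by
  obtain ⟨_, e, he, hA, hx⟩ := exists_spectral_of_eq_secondMoment x rfl
  have hl : ∀ p, 0 ≤ eig (secondMoment x) p := fun p => p.1.2.1.le
  rw [d, tsum_fintype]
  conv_rhs => rw [hA, regInv_diagOp he hl hγ, meanForm_diagOp x he hA hx]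
  simp

lemma d_two_secondMoment (hγ : 0 < γ) :
    d 2 (secondMoment x) γ = √(meanForm (regSandwich (secondMoment x) γ) x) := by
  obtain ⟨_, e, he, hA, hx⟩ := exists_spectral_of_eq_secondMoment x rfl
  have hl : ∀ p, 0 ≤ eig (secondMoment x) p := fun p => p.1.2.1.le
  rw [d, tsum_fintype, Real.sqrt_eq_rpow]
  conv_rhs => rw [hA, regSandwich, regInv_diagOp he hl hγ, diagOp_comp he, diagOp_comp he,
    meanForm_diagOp x he hA hx]
  push_cast
  congr 1
  refine Finset.sum_congr rfl fun p _ => ?_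
  rw [← inv_pow]
  ring

end secondMoment

end Spectral

/-! ### The statistic in terms of regularised inverses -/

section GramStat

variable {E F ι : Type*} [NormedAddCommGroup E] [InnerProductSpace ℝ E] [NormedAddCommGroup F]
  [InnerProductSpace ℝ F] [Fintype ι]

/-- The quadratic form `n⁻¹ ∑_{i,j} ⟪S x_i, x_j⟫ ⟪T y_i, y_j⟫` of `S ⊗ T` at
`n^{-1/2} ∑ x_i ⊗ y_i`. -/
noncomputable def crossForm (S : E →L[ℝ] E) (T : F →L[ℝ] F) (x : ι → E) (y : ι → F) : ℝ :=
  (Fintype.card ι : ℝ)⁻¹ * ∑ i, ∑ j, ⟪S (x i), x j⟫_ℝ * ⟪T (y i), y j⟫_ℝ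

/-- The mean of a finite family of points. -/
noncomputable def avg (x : ι → E) : E := (Fintype.card ι : ℝ)⁻¹ • ∑ i, x i

/-- The points centred at their mean. -/
noncomputable def centre (x : ι → E) (i : ι) : E := x i - avg x

lemma centre_sub_const [Nonempty ι] (x : ι → E) (m : E) :
    centre (fun i => x i - m) = centre x := by
  have hn : (Fintype.card ι : ℝ) ≠ 0 := Nat.cast_ne_zero.2 Fintype.card_ne_zero
  funext i
  have : avg (fun i => x i - m) = avg x - m := by
    rw [avg, avg, Finset.sum_sub_distrib, smul_sub, Finset.sum_const, Finset.card_univ,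
      ← Nat.cast_smul_eq_nsmul ℝ, smul_smul, inv_mul_cancel₀ hn, one_smul]
  rw [centre, centre, this]
  abel

lemma secondMoment_centre [Nonempty ι] (x : ι → E) :
    secondMoment (centre x) = secondMoment x - rankOne ℝ (avg x) (avg x) := by
  have hn : (Fintype.card ι : ℝ) ≠ 0 := Nat.cast_ne_zero.2 Fintype.card_ne_zero
  ext v
  have hs : ∑ i, x i = (Fintype.card ι : ℝ) • avg x := by
    rw [avg, smul_smul, mul_inv_cancel₀ hn, one_smul]
  have hs2 : ∑ i, ⟪x i, v⟫_ℝ = (Fintype.card ι : ℝ) * ⟪avg x, v⟫_ℝ := by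
    rw [← sum_inner, hs, real_inner_smul_left]
  rw [sub_apply, secondMoment_apply, secondMoment_apply, rankOne_apply]
  simp only [centre, inner_sub_left, sub_smul, smul_sub]
  simp only [Finset.sum_sub_distrib, ← Finset.smul_sum, ← Finset.sum_smul, smul_sub, hs, hs2,
    Finset.sum_const, Finset.card_univ, ← Nat.cast_smul_eq_nsmul ℝ, smul_smul,
    mul_left_comm _ (Fintype.card ι : ℝ)]
  simp only [← mul_assoc, mul_inv_cancel₀ hn, one_mul]
  rw [mul_comm ((Fintype.card ι : ℝ)⁻¹) _, mul_assoc, inv_mul_cancel₀ hn, mul_one]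
  abel

variable [CompleteSpace E] [CompleteSpace F]

lemma mul_hsNormSq_comp [Nonempty ι] {S : E →L[ℝ] E} {T : F →L[ℝ] F}
    (hS : ∀ u v, ⟪S u, v⟫_ℝ = ⟪u, S v⟫_ℝ) (hT : ∀ u v, ⟪T u, v⟫_ℝ = ⟪u, T v⟫_ℝ)
    (x : ι → E) (y : ι → F) :
    (Fintype.card ι : ℝ) * hsNormSq (S ∘L ((Fintype.card ι : ℝ)⁻¹ • ∑ i, rankOne ℝ (x i) (y i)) ∘L T)
      = crossForm (S ∘L S) (T ∘L T) x y := by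
  set n : ℝ := (Fintype.card ι : ℝ)
  have hn : n ≠ 0 := Nat.cast_ne_zero.2 Fintype.card_ne_zero
  set V := S ∘L (n⁻¹ • ∑ i, rankOne ℝ (x i) (y i)) ∘L T with hV
  have hVe : ∀ e, V e = n⁻¹ • ∑ i, ⟪T (y i), e⟫_ℝ • S (x i) := fun e => by
    simp [hV, hT]
  have hsq : ∀ e, ‖V e‖ ^ 2 = n⁻¹ * n⁻¹ * ∑ i, ∑ j, ⟪S (x i), S (x j)⟫_ℝ *
      (⟪T (y i), e⟫_ℝ * ⟪e, T (y j)⟫_ℝ) := fun e => by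
    rw [← real_inner_self_eq_norm_sq, hVe, real_inner_smul_left, real_inner_smul_right, sum_inner,
      mul_assoc]
    congr 2
    refine Finset.sum_congr rfl fun i _ => ?_
    rw [inner_sum]
    refine Finset.sum_congr rfl fun j _ => ?_
    rw [real_inner_smul_left, real_inner_smul_right, real_inner_comm e (T (y j))]
    ring
  have hsum : HasSum (fun b => ‖V ((exists_hilbertBasis ℝ F).choose_spec.choose b)‖ ^ 2)
      (n⁻¹ * n⁻¹ * ∑ i, ∑ j, ⟪S (x i), S (x j)⟫_ℝ * ⟪T (y i), T (y j)⟫_ℝ) := by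
    simp_rw [hsq]
    refine HasSum.mul_left _ (hasSum_sum fun i _ => hasSum_sum fun j _ => HasSum.mul_left _ ?_)
    exact HilbertBasis.hasSum_inner_mul_inner _ _ _
  rw [hsNormSq, hsum.tsum_eq, crossForm, ← mul_assoc, ← mul_assoc, mul_inv_cancel₀ hn, one_mul]
  simp_rw [ContinuousLinearMap.comp_apply, hS (S _), hT (T _)]
  rfl

/-- The statistic as a function of the feature vectors `x_i`, `y_i`: centre them, and express
the Hilbert-Schmidt norm and the normalising constants by quadratic forms in the regularised
inverses of the empirical covariance operators. -/
noncomputable def gramStat (γ : ℝ) (x : ι → E) (y : ι → F) : ℝ :=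
  (crossForm (regInv (secondMoment (centre x)) γ) (regInv (secondMoment (centre y)) γ)
      (centre x) (centre y) -
    meanForm (regInv (secondMoment (centre x)) γ) (centre x) *
      meanForm (regInv (secondMoment (centre y)) γ) (centre y)) /
  (√2 * (√(meanForm (regSandwich (secondMoment (centre x)) γ) (centre x)) *
    √(meanForm (regSandwich (secondMoment (centre y)) γ) (centre y))))

lemma gramStat_sub_const [Nonempty ι] (γ : ℝ) (x : ι → E) (y : ι → F) (m : E) (m' : F) :
    gramStat γ (fun i => x i - m) (fun i => y i - m') = gramStat γ x y := by
  simp only [gramStat, centre_sub_const]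

/-! ### Continuity of the statistic in the feature vectors -/

lemma continuous_avg : Continuous (avg : (ι → E) → E) := by
  unfold avg; fun_prop

lemma continuous_centre : Continuous (centre : (ι → E) → ι → E) := by
  refine continuous_pi fun i => ?_
  exact (continuous_apply i).sub continuous_avg

lemma continuous_secondMoment : Continuous (secondMoment : (ι → E) → E →L[ℝ] E) := by
  have h : ∀ i, Continuous fun x : ι → E => rankOne ℝ (x i) (x i) := fun i =>
    (rankOne ℝ (E := E) (F := E)).continuous.comp (continuous_apply i) |>.clm_apply
      (continuous_apply i)
  exact (continuous_finsetSum Finset.univ fun i _ => h i).const_smul ((Fintype.card ι : ℝ)⁻¹)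

lemma continuous_regInv_secondMoment {γ : ℝ} (hγ : 0 < γ) :
    Continuous fun x : ι → E => regInv (secondMoment x) γ := by
  refine continuous_iff_continuousAt.2 fun x => ?_
  obtain ⟨u, hu⟩ := isUnit_add_smul_id (secondMoment_isPositive x) hγ
  have h1 := NormedRing.inverse_continuousAt u
  rw [hu] at h1
  exact ContinuousAt.comp (f := fun x : ι → E => secondMoment x + γ • ContinuousLinearMap.id ℝ E)
    h1 (continuous_secondMoment.add continuous_const).continuousAt

lemma continuous_regSandwich_secondMoment {γ : ℝ} (hγ : 0 < γ) :
    Continuous fun x : ι → E => regSandwich (secondMoment x) γ :=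
  (continuous_regInv_secondMoment hγ).clm_comp
    (continuous_secondMoment.clm_comp (continuous_regInv_secondMoment hγ))

lemma continuous_meanForm {T : (ι → E) → E →L[ℝ] E} (hT : Continuous T) :
    Continuous fun x : ι → E => meanForm (T x) x := by
  unfold meanForm
  exact (continuous_finsetSum _ fun i _ =>
    (hT.clm_apply (continuous_apply i)).inner (continuous_apply i)).const_mul _

lemma aestronglyMeasurable_pi {Ω : Type*} [MeasurableSpace Ω] {P : Measure Ω} {x : Ω → ι → E}
    (hx : ∀ i, AEStronglyMeasurable (fun ω => x ω i) P) : AEStronglyMeasurable x P := by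
  classical
  have h : x = fun ω => ∑ i, Pi.single i (x ω i) := by
    funext ω; exact (Finset.univ_sum_single _).symm
  rw [h]
  refine Finset.aestronglyMeasurable_fun_sum _ fun i _ => ?_
  exact (continuous_single i).comp_aestronglyMeasurable (hx i)

lemma aemeasurable_gramStat {Ω : Type*} [MeasurableSpace Ω] {P : Measure Ω} {x : Ω → ι → E}
    {y : Ω → ι → F} {γ : ℝ} (hγ : 0 < γ) (hx : ∀ i, AEStronglyMeasurable (fun ω => x ω i) P)
    (hy : ∀ i, AEStronglyMeasurable (fun ω => y ω i) P) :
    AEMeasurable (fun ω => gramStat γ (x ω) (y ω)) P := by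
  have hx' := continuous_centre.comp_aestronglyMeasurable (aestronglyMeasurable_pi hx)
  have hy' := continuous_centre.comp_aestronglyMeasurable (aestronglyMeasurable_pi hy)
  have hF : Continuous fun p : (ι → E) × (ι → F) =>
      crossForm (regInv (secondMoment p.1) γ) (regInv (secondMoment p.2) γ) p.1 p.2 := by
    unfold crossForm
    have h1 := (continuous_regInv_secondMoment (E := E) (ι := ι) hγ).comp
      (continuous_fst (Y := ι → F))
    have h2 := (continuous_regInv_secondMoment (E := F) (ι := ι) hγ).comp
      (continuous_snd (X := ι → E))
    have c1 : ∀ i, Continuous fun p : (ι → E) × (ι → F) => p.1 i := fun i => by fun_prop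
    have c2 : ∀ i, Continuous fun p : (ι → E) × (ι → F) => p.2 i := fun i => by fun_prop
    exact (continuous_finsetSum _ fun i _ => continuous_finsetSum _ fun j _ =>
      ((h1.clm_apply (c1 i)).inner (c1 j)).mul ((h2.clm_apply (c2 i)).inner (c2 j))).const_mul _
  have m1 := (hF.comp_aestronglyMeasurable (hx'.prodMk hy')).aemeasurable
  have m2 := ((continuous_meanForm (continuous_regInv_secondMoment
    hγ)).comp_aestronglyMeasurable hx').aemeasurable
  have m3 := ((continuous_meanForm (continuous_regInv_secondMoment
    hγ)).comp_aestronglyMeasurable hy').aemeasurable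
  have m4 := ((continuous_meanForm (continuous_regSandwich_secondMoment
    hγ)).comp_aestronglyMeasurable hx').aemeasurable
  have m5 := ((continuous_meanForm (continuous_regSandwich_secondMoment
    hγ)).comp_aestronglyMeasurable hy').aemeasurable
  exact (m1.sub (m2.mul m3)).div (aemeasurable_const.mul (m4.sqrt.mul m5.sqrt))

end GramStat

section Statistic

variable {𝒳 𝒴 : Type*} (HX HY : Type*)
  [NormedAddCommGroup HX] [InnerProductSpace ℝ HX] [CompleteSpace HX] [RKHS ℝ HX 𝒳 ℝ]
  [NormedAddCommGroup HY] [InnerProductSpace ℝ HY] [CompleteSpace HY] [RKHS ℝ HY 𝒴 ℝ]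

lemma empMean_eq_avg (n : ℕ) (x : ℕ → 𝒳) :
    empMean HX n x = avg fun i : Fin n => feature HX (x i) := by
  rw [empMean, avg, Fintype.card_fin, Finset.sum_range]

lemma empCov_eq_secondMoment (n : ℕ) (x : ℕ → 𝒳) :
    empCov HX n x = secondMoment (centre fun i : Fin n => feature HX (x i)) := by
  rw [empCov, secondMoment, Fintype.card_fin, Finset.sum_range]
  simp only [centre, ← empMean_eq_avg]

lemma statT_eq_gramStat {γ : ℝ} (hγ : 0 < γ) {n : ℕ} (hn : 1 ≤ n) (x : ℕ → 𝒳) (y : ℕ → 𝒴) :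
    statT HX HY γ n x y = gramStat γ (fun i : Fin n => feature HX (x i))
      (fun i : Fin n => feature HY (y i)) := by
  have : Nonempty (Fin n) := ⟨⟨0, hn⟩⟩
  have hC : empCrossCov HX HY n x y = (n : ℝ)⁻¹ • ∑ i : Fin n,
      rankOne ℝ (centre (fun i : Fin n => feature HX (x i)) i)
        (centre (fun i : Fin n => feature HY (y i)) i) := by
    rw [empCrossCov, Finset.sum_range]
    simp only [centre, ← empMean_eq_avg]
  rw [statT, empD, empD, empNOCCO, hC, empCov_eq_secondMoment, empCov_eq_secondMoment, gramStat]
  set u := centre fun i : Fin n => feature HX (x i)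
  set v := centre fun i : Fin n => feature HY (y i)
  obtain ⟨hS, hS2⟩ := invSqrt_secondMoment u hγ
  obtain ⟨hT, hT2⟩ := invSqrt_secondMoment v hγ
  have h := mul_hsNormSq_comp ((isPositive_iff_real _).1 hS).1 ((isPositive_iff_real _).1 hT).1 u v
  rw [hS2, hT2, Fintype.card_fin] at h
  rw [h, d_one_secondMoment u hγ, d_one_secondMoment v hγ, d_two_secondMoment u hγ,
    d_two_secondMoment v hγ]

end Statistic

/-! ### Perturbation bounds -/

section Perturbation

open scoped TensorProduct

variable {E F ι : Type*} [NormedAddCommGroup E] [InnerProductSpace ℝ E] [NormedAddCommGroup F]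
  [InnerProductSpace ℝ F] [Fintype ι]

lemma abs_inner_apply_sub_le (P P' : E →L[ℝ] E) (c c' : E) :
    |⟪P c, c⟫_ℝ - ⟪P' c', c'⟫_ℝ| ≤
      ‖P - P'‖ * ‖c‖ ^ 2 + ‖P'‖ * ‖c - c'‖ * (‖c‖ + ‖c'‖) := by
  have e : ⟪P c, c⟫_ℝ - ⟪P' c', c'⟫_ℝ =
      ⟪(P - P') c, c⟫_ℝ + (⟪P' (c - c'), c⟫_ℝ + ⟪P' c', c - c'⟫_ℝ) := by
    simp only [sub_apply, map_sub, inner_sub_left, inner_sub_right]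
    ring
  have h1 : |⟪(P - P') c, c⟫_ℝ| ≤ ‖P - P'‖ * ‖c‖ ^ 2 :=
    (abs_real_inner_le_norm _ _).trans (by
      rw [sq, ← mul_assoc]
      exact mul_le_mul_of_nonneg_right (ContinuousLinearMap.le_opNorm _ _) (norm_nonneg _))
  have h2 : |⟪P' (c - c'), c⟫_ℝ| ≤ ‖P'‖ * ‖c - c'‖ * ‖c‖ :=
    (abs_real_inner_le_norm _ _).trans
      (mul_le_mul_of_nonneg_right (ContinuousLinearMap.le_opNorm _ _) (norm_nonneg _))
  have h3 : |⟪P' c', c - c'⟫_ℝ| ≤ ‖P'‖ * ‖c'‖ * ‖c - c'‖ :=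
    (abs_real_inner_le_norm _ _).trans
      (mul_le_mul_of_nonneg_right (ContinuousLinearMap.le_opNorm _ _) (norm_nonneg _))
  rw [e]
  refine (abs_add_le _ _).trans ((add_le_add h1 ((abs_add_le _ _).trans
    (add_le_add h2 h3))).trans (le_of_eq (by ring)))

/-- The normalised cross covariance `n^{-1/2} ∑ x_i ⊗ y_i` as an element of the tensor product. -/
noncomputable def crossVec (x : ι → E) (y : ι → F) : E ⊗[ℝ] F :=
  (√(Fintype.card ι))⁻¹ • ∑ i, x i ⊗ₜ[ℝ] y i

lemma crossForm_eq_inner (S : E →L[ℝ] E) (T : F →L[ℝ] F) (x : ι → E) (y : ι → F) :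
    crossForm S T x y = ⟪TensorProduct.mapL S T (crossVec x y), crossVec x y⟫_ℝ := by
  rw [crossVec, map_smul, real_inner_smul_left, real_inner_smul_right, ← mul_assoc, ← mul_inv,
    Real.mul_self_sqrt (Nat.cast_nonneg _), map_sum, sum_inner, crossForm]
  simp_rw [inner_sum, TensorProduct.mapL_tmul, TensorProduct.inner_tmul]

lemma crossVec_centre [Nonempty ι] (x : ι → E) (y : ι → F) :
    crossVec (centre x) (centre y) =
      crossVec x y - √(Fintype.card ι) • (avg x ⊗ₜ[ℝ] avg y) := by
  have hn0 : (0 : ℝ) < Fintype.card ι := Nat.cast_pos.2 Fintype.card_pos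
  have hsx : ∑ i, x i = (Fintype.card ι : ℝ) • avg x := by
    rw [avg, smul_smul, mul_inv_cancel₀ hn0.ne', one_smul]
  have hsy : ∑ i, y i = (Fintype.card ι : ℝ) • avg y := by
    rw [avg, smul_smul, mul_inv_cancel₀ hn0.ne', one_smul]
  have hr : (√(Fintype.card ι : ℝ))⁻¹ * Fintype.card ι = √(Fintype.card ι) := by
    rw [inv_mul_eq_div, Real.div_sqrt]
  have h : ∑ i, centre x i ⊗ₜ[ℝ] centre y i =
      ∑ i, x i ⊗ₜ[ℝ] y i - (Fintype.card ι : ℝ) • (avg x ⊗ₜ[ℝ] avg y) := by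
    simp only [centre, TensorProduct.sub_tmul, TensorProduct.tmul_sub, Finset.sum_sub_distrib,
      ← TensorProduct.sum_tmul, ← TensorProduct.tmul_sum, hsx, hsy, Finset.sum_const,
      Finset.card_univ, ← Nat.cast_smul_eq_nsmul ℝ, TensorProduct.smul_tmul',
      TensorProduct.tmul_smul]
    abel
  rw [crossVec, crossVec, h, smul_sub, smul_smul, hr]

lemma meanForm_centre [Nonempty ι] (T : E →L[ℝ] E) (x : ι → E) :
    meanForm T (centre x) = meanForm T x - ⟪T (avg x), avg x⟫_ℝ := by
  have hn0 : (Fintype.card ι : ℝ) ≠ 0 := (Nat.cast_pos.2 Fintype.card_pos).ne'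
  have hsx : ∑ i, x i = (Fintype.card ι : ℝ) • avg x := by
    rw [avg, smul_smul, mul_inv_cancel₀ hn0, one_smul]
  have h : ∑ i, ⟪T (centre x i), centre x i⟫_ℝ =
      ∑ i, ⟪T (x i), x i⟫_ℝ - Fintype.card ι * ⟪T (avg x), avg x⟫_ℝ := by
    simp only [centre, map_sub, inner_sub_left, inner_sub_right, Finset.sum_sub_distrib,
      ← sum_inner, ← inner_sum, ← map_sum, hsx, Finset.sum_const, Finset.card_univ, map_smul,
      ← Nat.cast_smul_eq_nsmul ℝ, real_inner_smul_left, real_inner_smul_right]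
    ring
  rw [meanForm, meanForm, h, mul_sub, ← mul_assoc, inv_mul_cancel₀ hn0, one_mul]

lemma abs_meanForm_le [Nonempty ι] (T : E →L[ℝ] E) {x : ι → E} {C : ℝ} (hx : ∀ i, ‖x i‖ ≤ C) :
    |meanForm T x| ≤ ‖T‖ * C ^ 2 := by
  have hn0 : (0 : ℝ) < Fintype.card ι := Nat.cast_pos.2 Fintype.card_pos
  rw [meanForm, abs_mul, abs_of_pos (inv_pos.2 hn0), inv_mul_le_iff₀ hn0]
  refine (Finset.abs_sum_le_sum_abs _ _).trans ?_
  refine (Finset.sum_le_card_nsmul _ _ (‖T‖ * C ^ 2) fun i _ => ?_).trans (by simp)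
  refine (abs_real_inner_le_norm _ _).trans ?_
  calc ‖T (x i)‖ * ‖x i‖ ≤ ‖T‖ * ‖x i‖ * ‖x i‖ := by gcongr; exact T.le_opNorm _
    _ = ‖T‖ * ‖x i‖ ^ 2 := by ring
    _ ≤ _ := by gcongr; exact hx i

lemma norm_centre_le [Nonempty ι] {x : ι → E} {C : ℝ} (hx : ∀ i, ‖x i‖ ≤ C) (i : ι) :
    ‖centre x i‖ ≤ 2 * C := by
  have hn0 : (0 : ℝ) < Fintype.card ι := Nat.cast_pos.2 Fintype.card_pos
  have h : ‖avg x‖ ≤ C := by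
    rw [avg, norm_smul, norm_inv, Real.norm_natCast, inv_mul_le_iff₀ hn0]
    exact (norm_sum_le_of_le _ fun i _ => hx i).trans (by simp)
  exact (norm_sub_le _ _).trans (by linarith [hx i])

lemma abs_meanForm_centre_sub_le [Nonempty ι] (T T' : E →L[ℝ] E) {x : ι → E} {C : ℝ}
    (hx : ∀ i, ‖x i‖ ≤ C) :
    |meanForm T (centre x) - meanForm T' x| ≤
      ‖T - T'‖ * (2 * C) ^ 2 + ‖T'‖ * ‖avg x‖ ^ 2 := by
  have e : meanForm T (centre x) - meanForm T' x =
      meanForm (T - T') (centre x) - ⟪T' (avg x), avg x⟫_ℝ := by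
    have : meanForm (T - T') (centre x) = meanForm T (centre x) - meanForm T' (centre x) := by
      simp only [meanForm, sub_apply, inner_sub_left, Finset.sum_sub_distrib, mul_sub]
    rw [this, meanForm_centre T']
    ring
  rw [e]
  refine (abs_sub _ _).trans (add_le_add (abs_meanForm_le _ (norm_centre_le hx)) ?_)
  refine (abs_real_inner_le_norm _ _).trans ?_
  rw [sq, ← mul_assoc]
  exact mul_le_mul_of_nonneg_right (T'.le_opNorm _) (norm_nonneg _)

variable [CompleteSpace E] [CompleteSpace F] [Nonempty ι]
  {x : ι → E} {y : ι → F} {A : E →L[ℝ] E} {B : F →L[ℝ] F} {γ r M C : ℝ}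

lemma norm_secondMoment_centre_sub_le (hr : 0 ≤ r) (hr1 : r ≤ 1)
    (hx1 : ‖avg x‖ ≤ M * r) (hx2 : ‖secondMoment x - A‖ ≤ M * r) :
    ‖secondMoment (centre x) - A‖ ≤ (M + M ^ 2) * r := by
  rw [secondMoment_centre, sub_right_comm]
  refine (norm_sub_le _ _).trans ?_
  rw [norm_rankOne]
  calc _ ≤ M * r + (M * r) * (M * r) := by
        refine add_le_add hx2 (mul_le_mul hx1 hx1 (norm_nonneg _) ((norm_nonneg _).trans hx1))
    _ = M * r + M ^ 2 * (r * r) := by ring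
    _ ≤ M * r + M ^ 2 * (1 * r) := by gcongr
    _ = _ := by ring

lemma abs_meanForm_regInv_centre_sub_le (hA : A.IsPositive) (hγ : 0 < γ) (hγ1 : γ ≤ 1)
    (hr : 0 ≤ r) (hr1 : r ≤ 1) (hM : 0 ≤ M) (hx : ∀ i, ‖x i‖ ≤ C)
    (hx1 : ‖avg x‖ ≤ M * r) (hx2 : ‖secondMoment x - A‖ ≤ M * r) {m : ℝ}
    (hm : |meanForm (regInv A γ) x - m| ≤ M * r * γ⁻¹) :
    |meanForm (regInv (secondMoment (centre x)) γ) (centre x) - m| ≤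
      (M + M ^ 2) * (4 * C ^ 2 + 1) * ((γ ^ 2)⁻¹ * r) := by
  have hΔ := norm_secondMoment_centre_sub_le hr hr1 hx1 hx2
  have hR := (norm_regInv_sub_regInv_le (secondMoment_isPositive (centre x)) hA hγ).trans
    (mul_le_mul_of_nonneg_left hΔ (by positivity))
  have h1 := abs_meanForm_centre_sub_le (regInv (secondMoment (centre x)) γ) (regInv A γ) hx
  have hRA := norm_regInv_le hA hγ
  have hγi : γ⁻¹ ≤ (γ ^ 2)⁻¹ := by
    rw [← inv_pow]; exact le_self_pow₀ ((one_le_inv₀ hγ).2 hγ1) two_ne_zero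
  calc _ ≤ |meanForm (regInv (secondMoment (centre x)) γ) (centre x) - meanForm (regInv A γ) x| +
        |meanForm (regInv A γ) x - m| := abs_sub_le _ _ _
    _ ≤ ((γ ^ 2)⁻¹ * ((M + M ^ 2) * r) * (2 * C) ^ 2 + (γ ^ 2)⁻¹ * (M * r) ^ 2) +
        M * r * (γ ^ 2)⁻¹ := by
        refine add_le_add (h1.trans ?_) (hm.trans (by gcongr))
        gcongr
        exact hRA.trans hγi
    _ = (γ ^ 2)⁻¹ * ((M + M ^ 2) * (4 * C ^ 2) * r + M ^ 2 * (r * r) + M * r) := by ring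
    _ ≤ (γ ^ 2)⁻¹ * ((M + M ^ 2) * (4 * C ^ 2) * r + M ^ 2 * (1 * r) + M * r) := by gcongr
    _ = _ := by ring

lemma abs_meanForm_regSandwich_centre_sub_le (hA : A.IsPositive) (hγ : 0 < γ) (hγ1 : γ ≤ 1)
    (hr : 0 ≤ r) (hr1 : r ≤ 1) (hM : 0 ≤ M) (hx : ∀ i, ‖x i‖ ≤ C)
    (hx1 : ‖avg x‖ ≤ M * r) (hx2 : ‖secondMoment x - A‖ ≤ M * r) {m : ℝ}
    (hm : |meanForm (regSandwich A γ) x - m| ≤ M * r * (γ ^ 2)⁻¹) :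
    |meanForm (regSandwich (secondMoment (centre x)) γ) (centre x) - m| ≤
      (M + M ^ 2) * (12 * C ^ 2 + 2) * ((γ ^ 2)⁻¹ * r) := by
  have hΔ := norm_secondMoment_centre_sub_le hr hr1 hx1 hx2
  have hR := (norm_regSandwich_sub_le (secondMoment_isPositive (centre x)) hA hγ).trans
    (mul_le_mul_of_nonneg_left (mul_le_mul_of_nonneg_left hΔ (by positivity)) (by norm_num))
  have h1 := abs_meanForm_centre_sub_le (regSandwich (secondMoment (centre x)) γ)
    (regSandwich A γ) hx
  have hRA := norm_regSandwich_le hA hγ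
  have hγi : γ⁻¹ ≤ (γ ^ 2)⁻¹ := by
    rw [← inv_pow]; exact le_self_pow₀ ((one_le_inv₀ hγ).2 hγ1) two_ne_zero
  calc _ ≤ |meanForm (regSandwich (secondMoment (centre x)) γ) (centre x) -
          meanForm (regSandwich A γ) x| + |meanForm (regSandwich A γ) x - m| := abs_sub_le _ _ _
    _ ≤ (3 * ((γ ^ 2)⁻¹ * ((M + M ^ 2) * r)) * (2 * C) ^ 2 + 2 * (γ ^ 2)⁻¹ * (M * r) ^ 2) +
        M * r * (γ ^ 2)⁻¹ := by
        refine add_le_add (h1.trans ?_) hm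
        gcongr
        exact hRA.trans (by gcongr)
    _ = (γ ^ 2)⁻¹ * ((M + M ^ 2) * (12 * C ^ 2) * r + 2 * (M ^ 2 * (r * r)) + M * r) := by ring
    _ ≤ (γ ^ 2)⁻¹ * ((M + M ^ 2) * (12 * C ^ 2) * r + 2 * (M ^ 2 * (1 * r)) + 2 * (M * r)) := by
        have h2 : M * r ≤ 2 * (M * r) := le_mul_of_one_le_left (by positivity) one_le_two
        refine mul_le_mul_of_nonneg_left (add_le_add ?_ h2) (by positivity)
        gcongr
    _ = _ := by ring

lemma norm_mapL_regInv_sub_le {A' : E →L[ℝ] E} {B' : F →L[ℝ] F} {δ : ℝ}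
    (hA : A.IsPositive) (hA' : A'.IsPositive) (hB : B.IsPositive) (hB' : B'.IsPositive)
    (hγ : 0 < γ) (h1 : ‖A' - A‖ ≤ δ) (h2 : ‖B' - B‖ ≤ δ) :
    ‖TensorProduct.mapL (regInv A' γ) (regInv B' γ) -
      TensorProduct.mapL (regInv A γ) (regInv B γ)‖ ≤ 2 * ((γ ^ 3)⁻¹ * δ) := by
  have e : TensorProduct.mapL (regInv A' γ) (regInv B' γ) -
      TensorProduct.mapL (regInv A γ) (regInv B γ) =
      TensorProduct.mapL (regInv A' γ - regInv A γ) (regInv B' γ) +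
      TensorProduct.mapL (regInv A γ) (regInv B' γ - regInv B γ) := by
    have a1 := TensorProduct.mapL_add_left (regInv A' γ - regInv A γ) (regInv A γ) (regInv B' γ)
    have a2 := TensorProduct.mapL_add_right (regInv A γ) (regInv B' γ - regInv B γ) (regInv B γ)
    rw [sub_add_cancel] at a1 a2
    rw [a1, a2]
    abel
  rw [e]
  have b1 := norm_regInv_sub_regInv_le hA' hA hγ
  have b2 := norm_regInv_sub_regInv_le hB' hB hγ
  have b3 := norm_regInv_le hB' hγ
  have b4 := norm_regInv_le hA hγ
  have hδ : 0 ≤ δ := (norm_nonneg _).trans h1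
  have c1 := TensorProduct.norm_mapL_le (regInv A' γ - regInv A γ) (regInv B' γ)
  have c2 := TensorProduct.norm_mapL_le (regInv A γ) (regInv B' γ - regInv B γ)
  refine (ContinuousLinearMap.opNorm_add_le _ _).trans ((add_le_add c1 c2).trans ?_)
  calc ‖regInv A' γ - regInv A γ‖ * ‖regInv B' γ‖ + ‖regInv A γ‖ * ‖regInv B' γ - regInv B γ‖
      ≤ ((γ ^ 2)⁻¹ * δ) * γ⁻¹ + γ⁻¹ * ((γ ^ 2)⁻¹ * δ) := by
        refine add_le_add
          (mul_le_mul (b1.trans (mul_le_mul_of_nonneg_left h1 (by positivity))) b3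
            (norm_nonneg _) (by positivity))
          (mul_le_mul b4 (b2.trans (mul_le_mul_of_nonneg_left h2 (by positivity)))
            (norm_nonneg _) (by positivity))
    _ = _ := by field_simp; ring

lemma abs_crossForm_centre_sub_le (hA : A.IsPositive) (hB : B.IsPositive) (hγ : 0 < γ)
    (hγ1 : γ ≤ 1) (hr : r = (√(Fintype.card ι))⁻¹) (hM : 1 ≤ M)
    (hx1 : ‖avg x‖ ≤ M * r) (hx2 : ‖secondMoment x - A‖ ≤ M * r)
    (hy1 : ‖avg y‖ ≤ M * r) (hy2 : ‖secondMoment y - B‖ ≤ M * r) (hc : ‖crossVec x y‖ ≤ M) :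
    |crossForm (regInv (secondMoment (centre x)) γ) (regInv (secondMoment (centre y)) γ)
      (centre x) (centre y) - crossForm (regInv A γ) (regInv B γ) x y| ≤
      4 * (M + M ^ 2) ^ 3 * ((γ ^ 3)⁻¹ * r) := by
  have hn1 : (1 : ℝ) ≤ Fintype.card ι := Nat.one_le_cast.2 Fintype.card_pos
  have hs1 : 1 ≤ √(Fintype.card ι : ℝ) := Real.one_le_sqrt.2 hn1
  have hr0 : 0 ≤ r := by rw [hr]; positivity
  have hr1 : r ≤ 1 := by rw [hr]; exact inv_le_one_of_one_le₀ hs1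
  have hsr : √(Fintype.card ι : ℝ) * r = 1 := by rw [hr]; exact mul_inv_cancel₀ (by positivity)
  have hΔx := norm_secondMoment_centre_sub_le hr0 hr1 hx1 hx2
  have hΔy := norm_secondMoment_centre_sub_le hr0 hr1 hy1 hy2
  have hP := norm_mapL_regInv_sub_le hA (secondMoment_isPositive (centre x)) hB
    (secondMoment_isPositive (centre y)) hγ hΔx hΔy
  have hP0 : ‖TensorProduct.mapL (regInv A γ) (regInv B γ)‖ ≤ (γ ^ 3)⁻¹ := by
    refine (TensorProduct.norm_mapL_le _ _).trans ?_
    calc ‖regInv A γ‖ * ‖regInv B γ‖ ≤ γ⁻¹ * γ⁻¹ := by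
          gcongr
          · exact norm_regInv_le hA hγ
          · exact norm_regInv_le hB hγ
      _ = (γ ^ 2)⁻¹ := by rw [sq, mul_inv]
      _ ≤ (γ ^ 3)⁻¹ := by
          refine inv_anti₀ (by positivity) (pow_le_pow_of_le_one hγ.le hγ1 (by norm_num))
  have hd : ‖crossVec (centre x) (centre y) - crossVec x y‖ ≤ M ^ 2 * r := by
    rw [crossVec_centre, sub_sub_cancel_left, norm_neg, norm_smul, TensorProduct.norm_tmul,
      Real.norm_eq_abs, abs_of_nonneg (Real.sqrt_nonneg _)]
    calc _ ≤ √(Fintype.card ι : ℝ) * ((M * r) * (M * r)) := by gcongr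
      _ = M ^ 2 * r * (√(Fintype.card ι : ℝ) * r) := by ring
      _ = _ := by rw [hsr, mul_one]
  set c := crossVec x y
  set c' := crossVec (centre x) (centre y)
  set M1 := M + M ^ 2 with hM1
  have hMM : M ^ 2 ≤ M1 := by linarith
  have hM1' : 1 ≤ M1 := by nlinarith
  have hc' : ‖c'‖ ≤ M1 := by
    have h1 := norm_add_le (c' - c) c
    rw [sub_add_cancel] at h1
    nlinarith [sq_nonneg M]
  have hcM1 : ‖c‖ ≤ M1 := by nlinarith
  rw [crossForm_eq_inner, crossForm_eq_inner]
  refine (abs_inner_apply_sub_le _ _ _ _).trans ?_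
  calc _ ≤ 2 * ((γ ^ 3)⁻¹ * (M1 * r)) * M1 ^ 2 + (γ ^ 3)⁻¹ * (M1 * r) * (M1 + M1) := by
        gcongr
        exact hd.trans (by gcongr)
    _ = (γ ^ 3)⁻¹ * r * (2 * M1 ^ 3 + 2 * (M1 ^ 2 * 1)) := by ring
    _ ≤ (γ ^ 3)⁻¹ * r * (2 * M1 ^ 3 + 2 * (M1 ^ 2 * M1)) := by gcongr
    _ = _ := by ring

/-- If the squared denominators are perturbed by at most `ε`, so is their root, relatively. -/
lemma exists_sqrt_eq_mul {s s' ε : ℝ} (hs : 1 ≤ s) (h : |s' - s| ≤ ε) (hε : ε ≤ 1 / 4) :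
    ∃ θ : ℝ, |θ| ≤ ε ∧ √s' = √s * (1 + θ) := by
  have h' := abs_le.1 h
  have hs' : 0 ≤ s' := by linarith
  have ha : 1 ≤ √s := Real.one_le_sqrt.2 hs
  refine ⟨(√s' - √s) / √s, ?_, by field_simp; ring⟩
  have e : (√s' - √s) * (√s' + √s) = s' - s := by
    ring_nf; rw [Real.sq_sqrt hs', Real.sq_sqrt (by linarith)]
  have hb : 0 ≤ √s' := Real.sqrt_nonneg _
  rw [abs_div, abs_of_pos (by linarith : 0 < √s), div_le_iff₀ (by linarith)]
  have h2 : |√s' - √s| * (√s' + √s) ≤ ε := by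
    rw [← abs_of_nonneg (by linarith : 0 ≤ √s' + √s), ← abs_mul, e]; exact h
  have h3 : |√s' - √s| * 1 ≤ |√s' - √s| * (√s' + √s) :=
    mul_le_mul_of_nonneg_left (by linarith) (abs_nonneg _)
  have hε0 : 0 ≤ ε := (abs_nonneg _).trans h
  nlinarith

/-- Perturbation of a quotient whose denominator factors are at least `1`; the factor `2 + 5 M`
comes from a denominator that changes by a factor in `[1/2, 1 + 9 ε / 4]`. -/
lemma abs_div_sub_div_le {N N' s s' u u' ε M : ℝ} (hs : 1 ≤ s) (hu : 1 ≤ u) (hε : ε ≤ 1 / 4)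
    (h1 : |s' - s| ≤ ε) (h2 : |u' - u| ≤ ε) (h3 : |N' - N| ≤ ε)
    (hM : |N / (√2 * (√s * √u))| ≤ M) :
    |N' / (√2 * (√s' * √u')) - N / (√2 * (√s * √u))| ≤ (2 + 5 * M) * ε := by
  obtain ⟨θ, hθ, e1⟩ := exists_sqrt_eq_mul hs h1 hε
  obtain ⟨φ, hφ, e2⟩ := exists_sqrt_eq_mul hu h2 hε
  have hε0 : 0 ≤ ε := (abs_nonneg _).trans h1
  have ha : 1 ≤ √s := Real.one_le_sqrt.2 hs
  have hb : 1 ≤ √u := Real.one_le_sqrt.2 hu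
  have hc : 1 ≤ √(2 : ℝ) := Real.one_le_sqrt.2 (by norm_num)
  have hD : 1 ≤ √2 * (√s * √u) := by
    have := mul_le_mul ha hb zero_le_one (by linarith)
    nlinarith
  set D := √2 * (√s * √u)
  set q := (1 + θ) * (1 + φ) with hq
  have hθ' := abs_le.1 hθ
  have hφ' := abs_le.1 hφ
  have hq1 : |1 - q| ≤ 9 / 4 * ε := by
    have : 1 - q = -(θ + φ + θ * φ) := by rw [hq]; ring
    rw [this, abs_neg]
    have h5 : |θ * φ| ≤ ε * ε := by rw [abs_mul]; gcongr
    have h6 := abs_add_le (θ + φ) (θ * φ)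
    have h7 := abs_add_le θ φ
    nlinarith
  have hq2 : 1 / 2 ≤ q := by
    rw [hq]; nlinarith
  have hq0 : 0 < q := by linarith
  have hD' : √2 * (√s' * √u') = D * q := by rw [e1, e2, hq]; ring
  have hD0 : 0 < D := by linarith
  have e : N' / (D * q) - N / D = (N' - N) / (D * q) + N / D * ((1 - q) / q) := by
    field_simp; ring
  rw [hD', e]
  have k1 : |(N' - N) / (D * q)| ≤ 2 * ε := by
    rw [abs_div, abs_of_pos (mul_pos hD0 hq0), div_le_iff₀ (mul_pos hD0 hq0)]
    have : 1 / 2 ≤ D * q := by nlinarith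
    nlinarith
  have k2 : |(1 - q) / q| ≤ 5 * ε := by
    rw [abs_div, abs_of_pos hq0, div_le_iff₀ hq0]
    nlinarith
  calc _ ≤ |(N' - N) / (D * q)| + |N / D| * |(1 - q) / q| := by
        rw [← abs_mul]; exact abs_add_le _ _
    _ ≤ 2 * ε + M * (5 * ε) := by
        refine add_le_add k1 (mul_le_mul hM k2 (abs_nonneg _) ((abs_nonneg _).trans hM))
    _ = _ := by ring

/-- The constant in `abs_gramStat_sub_le`; only its independence of `n` matters. -/
noncomputable def pertConst (M C : ℝ) : ℝ :=
  4 * (M + M ^ 2) ^ 3 + 5 * C ^ 2 * ((M + M ^ 2) * (4 * C ^ 2 + 1)) + M +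
    (M + M ^ 2) * (12 * C ^ 2 + 2)

/-- Deterministic comparison of the statistic with its population version: if all the empirical
quantities are within `M n^{-1/2}` of their means, at their natural scale in `γ`, then the two
differ by a multiple of `γ⁻³ n^{-1/2}`. Here `p`, `q` stand for `d₁` and `s`, `u` for `d₂²` of the
covariance operators, and `D` for the diagonal of the double sum. -/
lemma abs_gramStat_sub_le (hA : A.IsPositive) (hB : B.IsPositive) (hγ : 0 < γ)
    (hγ1 : γ ≤ 1) (hr : r = (√(Fintype.card ι))⁻¹) (hM : 1 ≤ M)
    (hx : ∀ i, ‖x i‖ ≤ C) (hy : ∀ i, ‖y i‖ ≤ C)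
    (hx1 : ‖avg x‖ ≤ M * r) (hx2 : ‖secondMoment x - A‖ ≤ M * r)
    (hy1 : ‖avg y‖ ≤ M * r) (hy2 : ‖secondMoment y - B‖ ≤ M * r) (hc : ‖crossVec x y‖ ≤ M)
    {p q s u D : ℝ} (hp : |meanForm (regInv A γ) x - p| ≤ M * r * γ⁻¹)
    (hq : |meanForm (regInv B γ) y - q| ≤ M * r * γ⁻¹) (hpC : |p| ≤ C ^ 2 * γ⁻¹)
    (hs : |meanForm (regSandwich A γ) x - s| ≤ M * r * (γ ^ 2)⁻¹)
    (hu : |meanForm (regSandwich B γ) y - u| ≤ M * r * (γ ^ 2)⁻¹)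
    (hD : |D - p * q| ≤ M * r * (γ ^ 2)⁻¹) (hs1 : 1 ≤ s) (hu1 : 1 ≤ u)
    (hN : |(crossForm (regInv A γ) (regInv B γ) x y - D) / (√2 * (√s * √u))| ≤ M)
    (hsmall : pertConst M C * ((γ ^ 3)⁻¹ * r) ≤ 1 / 4) :
    |gramStat γ x y - (crossForm (regInv A γ) (regInv B γ) x y - D) / (√2 * (√s * √u))| ≤
      (2 + 5 * M) * (pertConst M C * ((γ ^ 3)⁻¹ * r)) := by
  have hn1 : (1 : ℝ) ≤ Fintype.card ι := Nat.one_le_cast.2 Fintype.card_pos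
  have hs1' : 1 ≤ √(Fintype.card ι : ℝ) := Real.one_le_sqrt.2 hn1
  have hr0 : 0 ≤ r := by rw [hr]; positivity
  have hr1 : r ≤ 1 := by rw [hr]; exact inv_le_one_of_one_le₀ hs1'
  have hM0 : 0 ≤ M := by linarith
  have h23 : (γ ^ 2)⁻¹ ≤ (γ ^ 3)⁻¹ :=
    inv_anti₀ (by positivity) (pow_le_pow_of_le_one hγ.le hγ1 (by norm_num))
  have b1 := abs_crossForm_centre_sub_le hA hB hγ hγ1 hr hM hx1 hx2 hy1 hy2 hc
  have b2 := abs_meanForm_regInv_centre_sub_le hA hγ hγ1 hr0 hr1 hM0 hx hx1 hx2 hp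
  have b3 := abs_meanForm_regInv_centre_sub_le hB hγ hγ1 hr0 hr1 hM0 hy hy1 hy2 hq
  have b4 := abs_meanForm_regSandwich_centre_sub_le hA hγ hγ1 hr0 hr1 hM0 hx hx1 hx2 hs
  have b5 := abs_meanForm_regSandwich_centre_sub_le hB hγ hγ1 hr0 hr1 hM0 hy hy1 hy2 hu
  have b6 : |meanForm (regInv (secondMoment (centre y)) γ) (centre y)| ≤ 4 * C ^ 2 * γ⁻¹ := by
    refine (abs_meanForm_le _ (norm_centre_le hy)).trans ?_
    have := norm_regInv_le (secondMoment_isPositive (centre y)) hγ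
    calc _ ≤ γ⁻¹ * (2 * C) ^ 2 := by gcongr
      _ = _ := by ring
  rw [gramStat]
  set F' := crossForm (regInv (secondMoment (centre x)) γ) (regInv (secondMoment (centre y)) γ)
    (centre x) (centre y)
  set F := crossForm (regInv A γ) (regInv B γ) x y
  set p' := meanForm (regInv (secondMoment (centre x)) γ) (centre x)
  set q' := meanForm (regInv (secondMoment (centre y)) γ) (centre y)
  set K2 := (M + M ^ 2) * (4 * C ^ 2 + 1) with hK2
  set K3 := (M + M ^ 2) * (12 * C ^ 2 + 2) with hK3
  have hK20 : 0 ≤ K2 := by positivity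
  have hK30 : 0 ≤ K3 := by positivity
  have hg0 : 0 ≤ (γ ^ 3)⁻¹ * r := by positivity
  have hsum : 0 ≤ 4 * (M + M ^ 2) ^ 3 + 5 * C ^ 2 * K2 + M := by positivity
  have hpq : |p' * q' - p * q| ≤ 5 * C ^ 2 * K2 * ((γ ^ 3)⁻¹ * r) := by
    have e : p' * q' - p * q = (p' - p) * q' + p * (q' - q) := by ring
    rw [e]
    calc _ ≤ |p' - p| * |q'| + |p| * |q' - q| := by
          rw [← abs_mul, ← abs_mul]; exact abs_add_le _ _
      _ ≤ (K2 * ((γ ^ 2)⁻¹ * r)) * (4 * C ^ 2 * γ⁻¹) + (C ^ 2 * γ⁻¹) * (K2 * ((γ ^ 2)⁻¹ * r)) := by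
          gcongr
      _ = _ := by field_simp; ring
  have hNN : |(F' - p' * q') - (F - D)| ≤ pertConst M C * ((γ ^ 3)⁻¹ * r) := by
    have e : (F' - p' * q') - (F - D) = (F' - F) + (-(p' * q' - p * q)) + (D - p * q) := by ring
    rw [e]
    calc _ ≤ |F' - F| + |p' * q' - p * q| + |D - p * q| := by
          refine (abs_add_three _ _ _).trans (le_of_eq ?_)
          rw [abs_neg]
      _ ≤ 4 * (M + M ^ 2) ^ 3 * ((γ ^ 3)⁻¹ * r) + 5 * C ^ 2 * K2 * ((γ ^ 3)⁻¹ * r) +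
            M * r * (γ ^ 3)⁻¹ := by
          gcongr
          exact hD.trans (by gcongr)
      _ = (4 * (M + M ^ 2) ^ 3 + 5 * C ^ 2 * K2 + M + 0) * ((γ ^ 3)⁻¹ * r) := by ring
      _ ≤ _ := by
          rw [pertConst]
          gcongr
  have hK3le : K3 * ((γ ^ 2)⁻¹ * r) ≤ pertConst M C * ((γ ^ 3)⁻¹ * r) := by
    have : K3 ≤ pertConst M C := by rw [pertConst]; linarith
    have : 0 ≤ pertConst M C := by linarith
    gcongr
  exact abs_div_sub_div_le hs1 hu1 hsmall (b4.trans hK3le) (b5.trans hK3le) hNN hN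

end Perturbation

/-! ### Chebyshev's inequality for means of independent vectors -/

section Chebyshev

variable {E ι 𝒵 : Type*} [NormedAddCommGroup E] [InnerProductSpace ℝ E] [Fintype ι] [DecidableEq ι]
  [MeasurableSpace 𝒵] {ρ : Measure 𝒵} [IsProbabilityMeasure ρ] {U : 𝒵 → E} {c : ℝ}

lemma measureReal_lt_le_of_integral_sq_le {α : Type*} [MeasurableSpace α] {μ : Measure α}
    [IsFiniteMeasure μ] {f : α → ℝ} {a N : ℝ} (hf : Integrable (fun x => f x ^ 2) μ)
    (ha : 0 < a) (hN : 0 < N) (h : ∫ x, f x ^ 2 ∂μ ≤ a ^ 2) :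
    μ.real {x | N * a < |f x|} ≤ (N ^ 2)⁻¹ := by
  have h1 := mul_meas_ge_le_integral_of_nonneg (ae_of_all μ fun x => sq_nonneg (f x)) hf
    ((N * a) ^ 2)
  have h2 : μ.real {x | N * a < |f x|} ≤ μ.real {x | (N * a) ^ 2 ≤ f x ^ 2} := by
    refine measureReal_mono fun x hx => ?_
    change (N * a) ^ 2 ≤ f x ^ 2
    rw [← sq_abs (f x)]
    exact pow_le_pow_left₀ (by positivity) (le_of_lt hx) 2
  refine h2.trans ?_
  rw [← one_div, le_div_iff₀ (by positivity)]
  have h3 : 0 < a ^ 2 := by positivity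
  refine le_of_mul_le_mul_left ?_ h3
  calc _ = (N * a) ^ 2 * μ.real {x | (N * a) ^ 2 ≤ f x ^ 2} := by ring
    _ ≤ a ^ 2 * 1 := by linarith

/-- The means of `n` i.i.d. centred vectors bounded by `c` are of order `c n^{-1/2}`. The vectors
are only assumed centred in the weak sense, so that `E` need not be complete. -/
lemma measureReal_norm_avg_gt_le [Nonempty ι] (hU : StronglyMeasurable U) (hb : ∀ z, ‖U z‖ ≤ c)
    (hc : 0 < c) (h0 : ∀ w, ∫ z, ⟪w, U z⟫_ℝ ∂ρ = 0) {N : ℝ} (hN : 0 < N) :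
    (Measure.pi fun _ : ι => ρ).real
      {x | N * (c * (√(Fintype.card ι))⁻¹) < ‖avg fun i => U (x i)‖} ≤ (N ^ 2)⁻¹ := by
  have hn0 : (0 : ℝ) < Fintype.card ι := Nat.cast_pos.2 Fintype.card_pos
  have hm : ∀ i, StronglyMeasurable fun x : ι → 𝒵 => U (x i) := fun i =>
    hU.comp_measurable (measurable_pi_apply i)
  have hint : ∀ i j, Integrable (fun x : ι → 𝒵 => ⟪U (x i), U (x j)⟫_ℝ)
      (Measure.pi fun _ : ι => ρ) := fun i j =>
    Integrable.of_bound ((hm i).inner (hm j)).aestronglyMeasurable (c * c) <| ae_of_all _ fun x =>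
      (norm_inner_le_norm _ _).trans (mul_le_mul (hb _) (hb _) (norm_nonneg _) hc.le)
  have hoff : ∀ i j, j ≠ i → ∫ x : ι → 𝒵, ⟪U (x i), U (x j)⟫_ℝ ∂(Measure.pi fun _ : ι => ρ) = 0 := by
    intro i j hij
    refine integral_eq_zero_of_resample ρ j fun x => ?_
    simp only [Function.update_self, Function.update_of_ne hij.symm, h0]
  have hdiag : ∀ i, ∫ x : ι → 𝒵, ⟪U (x i), U (x i)⟫_ℝ ∂(Measure.pi fun _ : ι => ρ) ≤ c ^ 2 := by
    intro i
    refine (integral_mono (hint i i) (integrable_const (c ^ 2)) fun x => ?_).trans (by simp)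
    change ⟪U (x i), U (x i)⟫_ℝ ≤ c ^ 2
    rw [real_inner_self_eq_norm_sq]
    exact pow_le_pow_left₀ (norm_nonneg _) (hb _) 2
  have hexp : ∀ x : ι → 𝒵, ‖avg fun i => U (x i)‖ ^ 2 =
      ((Fintype.card ι : ℝ)⁻¹) ^ 2 * ∑ i, ∑ j, ⟪U (x i), U (x j)⟫_ℝ := by
    intro x
    rw [avg, norm_smul, mul_pow, ← real_inner_self_eq_norm_sq (∑ i, U (x i)), sum_inner]
    simp [inner_sum]
  have hI : Integrable (fun x : ι → 𝒵 => ‖avg fun i => U (x i)‖ ^ 2)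
      (Measure.pi fun _ : ι => ρ) := by
    simp_rw [hexp]
    exact (integrable_finsetSum _ fun i _ => integrable_finsetSum _ fun j _ => hint i j).const_mul _
  have h := measureReal_lt_le_of_integral_sq_le (a := c * (√(Fintype.card ι))⁻¹) hI
    (by positivity) hN ?_
  · simpa only [abs_norm] using h
  simp_rw [hexp]
  rw [integral_const_mul, integral_finsetSum _ fun i _ => integrable_finsetSum _ fun j _ => hint i j]
  have hrow : ∀ i, ∫ x : ι → 𝒵, ∑ j, ⟪U (x i), U (x j)⟫_ℝ ∂(Measure.pi fun _ : ι => ρ) ≤ c ^ 2 := by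
    intro i
    rw [integral_finsetSum _ fun j _ => hint i j,
      Finset.sum_eq_single i (fun j _ hj => hoff i j hj) (by simp)]
    exact hdiag i
  rw [mul_pow, inv_pow (√_), Real.sq_sqrt hn0.le]
  calc _ ≤ ((Fintype.card ι : ℝ)⁻¹) ^ 2 * (Fintype.card ι * c ^ 2) := by
        gcongr
        exact (Finset.sum_le_card_nsmul _ _ (c ^ 2) fun i _ => hrow i).trans (by simp)
    _ = _ := by field_simp

lemma measureReal_abs_mean_gt_le [Nonempty ι] {f : 𝒵 → ℝ} (hf : Measurable f)
    (hb : ∀ z, |f z| ≤ c) (hc : 0 < c) {N : ℝ} (hN : 0 < N) :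
    (Measure.pi fun _ : ι => ρ).real {x | N * (2 * c * (√(Fintype.card ι))⁻¹) <
      |(Fintype.card ι : ℝ)⁻¹ * ∑ i, f (x i) - ∫ z, f z ∂ρ|} ≤ (N ^ 2)⁻¹ := by
  have hn0 : (Fintype.card ι : ℝ) ≠ 0 := (Nat.cast_pos.2 Fintype.card_pos).ne'
  have hI : Integrable f ρ := Integrable.of_bound hf.aestronglyMeasurable c (ae_of_all _ hb)
  have hm : |∫ z, f z ∂ρ| ≤ c := by
    simpa using norm_integral_le_of_norm_le_const (μ := ρ) (f := f) (ae_of_all _ hb)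
  have h := measureReal_norm_avg_gt_le (ι := ι) (ρ := ρ) (U := fun z => f z - ∫ z, f z ∂ρ)
    (c := 2 * c) (hf.sub_const _).stronglyMeasurable
    (fun z => (norm_sub_le _ _).trans (by
      rw [Real.norm_eq_abs, Real.norm_eq_abs]; linarith [hb z])) (by positivity)
    (fun w => by
      simp only [RCLike.inner_apply, conj_trivial]
      rw [integral_mul_const, integral_sub hI (integrable_const _)]; simp) hN
  have e : ∀ x : ι → 𝒵, ‖avg fun i => f (x i) - ∫ z, f z ∂ρ‖ =
      |(Fintype.card ι : ℝ)⁻¹ * ∑ i, f (x i) - ∫ z, f z ∂ρ| := by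
    intro x
    rw [avg, Finset.sum_sub_distrib, Finset.sum_const, Finset.card_univ, nsmul_eq_mul, smul_eq_mul,
      mul_sub, ← mul_assoc, inv_mul_cancel₀ hn0, one_mul, Real.norm_eq_abs]
  simpa only [e] using h

end Chebyshev

/-! ### Centred feature maps and their covariance operator -/

section CentredFeature

open scoped TensorProduct

variable {E 𝒳 : Type*} [NormedAddCommGroup E] [InnerProductSpace ℝ E] [MeasurableSpace 𝒳]

/-- A bounded, centred, strongly measurable random vector `u`, on the probability space `(𝒳, μ)`,
with covariance operator `A`. -/
structure CentredFeature (μ : Measure 𝒳) (u : 𝒳 → E) (A : E →L[ℝ] E) (C : ℝ) : Prop where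
  stronglyMeasurable : StronglyMeasurable u
  one_le : 1 ≤ C
  bound : ∀ x, ‖u x‖ ≤ C
  centred : ∀ w, ∫ x, ⟪w, u x⟫_ℝ ∂μ = 0
  inner_cov : ∀ a b, ⟪A a, b⟫_ℝ = ∫ x, ⟪a, u x⟫_ℝ * ⟪b, u x⟫_ℝ ∂μ

namespace CentredFeature

variable {μ : Measure 𝒳} [IsProbabilityMeasure μ] {u : 𝒳 → E} {A : E →L[ℝ] E} {C γ : ℝ}

lemma isPositive (hu : CentredFeature μ u A C) : A.IsPositive := by
  refine (isPositive_iff_real A).2 ⟨fun a b => ?_, fun a => ?_⟩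
  · rw [hu.inner_cov, real_inner_comm, hu.inner_cov]
    simp_rw [mul_comm]
  · rw [hu.inner_cov]
    exact integral_nonneg fun x => mul_self_nonneg _

lemma abs_inner_apply_le (hu : CentredFeature μ u A C) (T : E →L[ℝ] E) (x x' : 𝒳) :
    |⟪T (u x), u x'⟫_ℝ| ≤ ‖T‖ * C ^ 2 := by
  have hC : 0 ≤ C := zero_le_one.trans hu.one_le
  refine (abs_real_inner_le_norm _ _).trans ?_
  calc _ ≤ ‖T‖ * C * C := by
        refine mul_le_mul (T.le_opNorm_of_le (hu.bound x)) (hu.bound x') (norm_nonneg _)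
          (by positivity)
    _ = _ := by ring

lemma measurable_inner (hu : CentredFeature μ u A C) (T : E →L[ℝ] E) :
    Measurable fun p : 𝒳 × 𝒳 => ⟪T (u p.1), u p.2⟫_ℝ :=
  ((T.continuous.comp_stronglyMeasurable
    (hu.stronglyMeasurable.comp_measurable measurable_fst)).inner
      (hu.stronglyMeasurable.comp_measurable measurable_snd)).measurable

lemma measurable_diag (hu : CentredFeature μ u A C) (T : E →L[ℝ] E) :
    Measurable fun x => ⟪T (u x), u x⟫_ℝ :=
  (hu.measurable_inner T).comp (measurable_id.prodMk measurable_id)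

lemma integrable_diag (hu : CentredFeature μ u A C) (T : E →L[ℝ] E) :
    Integrable (fun x => ⟪T (u x), u x⟫_ℝ) μ :=
  Integrable.of_bound (hu.measurable_diag T).aestronglyMeasurable _
    (ae_of_all _ fun x => hu.abs_inner_apply_le T x x)

/-- The empirical second moment operator is within `O(n^{-1/2})` of the covariance operator. The
variance is computed in the Hilbert-Schmidt norm, that is in the completion of `E ⊗ E`. -/
lemma measureReal_norm_secondMoment_sub_gt_le {ι : Type*} [Fintype ι] [DecidableEq ι] [Nonempty ι]
    (hu : CentredFeature μ u A C) {N : ℝ} (hN : 0 < N) :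
    (Measure.pi fun _ : ι => μ).real {x | N * (2 * C ^ 2 * (√(Fintype.card ι))⁻¹) <
      ‖secondMoment (fun i => u (x i)) - A‖} ≤ (N ^ 2)⁻¹ := by
  have hC : 0 < C := zero_lt_one.trans_le hu.one_le
  have hn0 : (Fintype.card ι : ℝ) ≠ 0 := (Nat.cast_pos.2 Fintype.card_pos).ne'
  let W : 𝒳 → UniformSpace.Completion (E ⊗[ℝ] E) := fun x => ((u x ⊗ₜ[ℝ] u x : E ⊗[ℝ] E) : _)
  have hWm : StronglyMeasurable W := by
    have h1 : Continuous fun a : E => a ⊗ₜ[ℝ] a := by fun_prop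
    exact (UniformSpace.Completion.continuous_coe _).comp_stronglyMeasurable
      (h1.comp_stronglyMeasurable hu.stronglyMeasurable)
  have hWb : ∀ x, ‖W x‖ ≤ C ^ 2 := fun x => by
    rw [UniformSpace.Completion.norm_coe, TensorProduct.norm_tmul, ← sq]
    exact pow_le_pow_left₀ (norm_nonneg _) (hu.bound x) 2
  have hWi : Integrable W μ := Integrable.of_bound hWm.aestronglyMeasurable _ (ae_of_all _ hWb)
  have hθ : ‖∫ x, W x ∂μ‖ ≤ C ^ 2 := by
    simpa using norm_integral_le_of_norm_le_const (μ := μ) (ae_of_all _ hWb)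
  have h := measureReal_norm_avg_gt_le (ι := ι) (ρ := μ) (U := fun x => W x - ∫ x, W x ∂μ)
    (c := 2 * C ^ 2) (hWm.sub stronglyMeasurable_const)
    (fun x => (norm_sub_le _ _).trans (by linarith [hWb x])) (by positivity)
    (fun w => by
      simp only [inner_sub_right]
      rw [integral_sub (hWi.const_inner w) (integrable_const _), integral_inner hWi]
      simp) hN
  refine (measureReal_mono fun x hx => ?_).trans h
  refine Set.mem_ofPred.2 (lt_of_lt_of_le (Set.mem_ofPred.1 hx) ?_)
  set V := avg fun i => W (x i) - ∫ x, W x ∂μ with hV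
  have hform : ∀ a b : E, ⟪(secondMoment (fun i => u (x i)) - A) a, b⟫_ℝ =
      ⟪((a ⊗ₜ[ℝ] b : E ⊗[ℝ] E) : UniformSpace.Completion (E ⊗[ℝ] E)), V⟫_ℝ := by
    intro a b
    have hW : ∀ x, ⟪((a ⊗ₜ[ℝ] b : E ⊗[ℝ] E) : UniformSpace.Completion (E ⊗[ℝ] E)), W x⟫_ℝ =
        ⟪a, u x⟫_ℝ * ⟪b, u x⟫_ℝ := fun x => by
      rw [UniformSpace.Completion.inner_coe, TensorProduct.inner_tmul]
    rw [hV, avg, real_inner_smul_right, inner_sum]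
    simp only [inner_sub_right, hW, ← integral_inner hWi]
    rw [sub_apply, inner_sub_left, inner_secondMoment, hu.inner_cov, Finset.sum_sub_distrib,
      Finset.sum_const, Finset.card_univ, nsmul_eq_mul, mul_sub, ← mul_assoc, inv_mul_cancel₀ hn0,
      one_mul]
    simp only [real_inner_comm]
  refine ContinuousLinearMap.opNorm_le_bound _ (norm_nonneg _) fun a => ?_
  set Ta := (secondMoment (fun i => u (x i)) - A) a with hTa
  by_cases h0 : ‖Ta‖ = 0
  · rw [h0]; positivity
  have h1 : ‖Ta‖ * ‖Ta‖ ≤ ‖V‖ * ‖a‖ * ‖Ta‖ := by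
    rw [← sq, ← real_inner_self_eq_norm_sq]
    conv_lhs => rw [hTa, hform]
    refine (real_inner_le_norm _ _).trans ?_
    rw [UniformSpace.Completion.norm_coe, TensorProduct.norm_tmul]
    exact le_of_eq (by rw [hTa]; ring)
  exact le_of_mul_le_mul_right h1 (lt_of_le_of_ne (norm_nonneg _) (Ne.symm h0))

end CentredFeature

end CentredFeature

/-! ### Population quadratic forms and the kernel of the limiting `U`-statistic -/

section Population

variable {E F 𝒳 𝒴 : Type*} [NormedAddCommGroup E] [InnerProductSpace ℝ E]
  [NormedAddCommGroup F] [InnerProductSpace ℝ F] [MeasurableSpace 𝒳] [MeasurableSpace 𝒴]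

/-- The population mean `∫ ⟪T u, u⟫` of a quadratic form. -/
noncomputable def popForm (μ : Measure 𝒳) (u : 𝒳 → E) (T : E →L[ℝ] E) : ℝ :=
  ∫ x, ⟪T (u x), u x⟫_ℝ ∂μ

/-- The kernel `⟪S u(x), u(x')⟫ ⟪T v(y), v(y')⟫` on pairs `(x, y)`. -/
noncomputable def tensorKernel (u : 𝒳 → E) (v : 𝒴 → F) (S : E →L[ℝ] E) (T : F →L[ℝ] F)
    (z w : 𝒳 × 𝒴) : ℝ :=
  ⟪S (u z.1), u w.1⟫_ℝ * ⟪T (v z.2), v w.2⟫_ℝ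

variable {μ : Measure 𝒳} [IsProbabilityMeasure μ] {ν : Measure 𝒴} [IsProbabilityMeasure ν]
  {u : 𝒳 → E} {A S : E →L[ℝ] E} {v : 𝒴 → F} {B T : F →L[ℝ] F} {C γ : ℝ}

namespace CentredFeature

lemma integral_inner_mul_inner (hu : CentredFeature μ u A C)
    (hS : ∀ a b, ⟪S a, b⟫_ℝ = ⟪a, S b⟫_ℝ) (a b : E) :
    ∫ x, ⟪S a, u x⟫_ℝ * ⟪S b, u x⟫_ℝ ∂μ = ⟪(S ∘L A ∘L S) a, b⟫_ℝ := by
  rw [← hu.inner_cov, ContinuousLinearMap.comp_apply, ContinuousLinearMap.comp_apply, hS]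

lemma abs_popForm_le (hu : CentredFeature μ u A C) (S : E →L[ℝ] E) :
    |popForm μ u S| ≤ ‖S‖ * C ^ 2 := by
  simpa [popForm] using norm_integral_le_of_norm_le_const (μ := μ) (f := fun x => ⟪S (u x), u x⟫_ℝ)
    (ae_of_all _ fun x => hu.abs_inner_apply_le S x x)

lemma degenerateKernel (hu : CentredFeature μ u A C) (hv : CentredFeature ν v B C)
    (hS : ∀ a b, ⟪S a, b⟫_ℝ = ⟪a, S b⟫_ℝ) (hT : ∀ a b, ⟪T a, b⟫_ℝ = ⟪a, T b⟫_ℝ)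
    (hSn : ‖S‖ ≤ γ⁻¹) (hTn : ‖T‖ ≤ γ⁻¹) :
    DegenerateKernel (μ.prod ν) (tensorKernel u v S T) (C ^ 4 * (γ ^ 2)⁻¹) where
  measurable :=
    ((hu.measurable_inner S).comp
      ((measurable_fst.comp measurable_fst).prodMk (measurable_fst.comp measurable_snd))).mul
    ((hv.measurable_inner T).comp
      ((measurable_snd.comp measurable_fst).prodMk (measurable_snd.comp measurable_snd)))
  bound z w := by
    have h1 := hu.abs_inner_apply_le S z.1 w.1
    have h2 := hv.abs_inner_apply_le T z.2 w.2
    rw [tensorKernel, abs_mul]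
    have hγ : 0 ≤ γ⁻¹ := (norm_nonneg _).trans hSn
    calc _ ≤ (γ⁻¹ * C ^ 2) * (γ⁻¹ * C ^ 2) := by
          refine mul_le_mul (h1.trans ?_) (h2.trans ?_) (abs_nonneg _) (by positivity) <;> gcongr
      _ = _ := by rw [← inv_pow]; ring
  symm z w := by
    rw [tensorKernel, tensorKernel, hS, hT, real_inner_comm, real_inner_comm (T (v w.2))]
  centred z := by
    have h := integral_prod_mul (μ := μ) (ν := ν) (fun x => ⟪S (u z.1), u x⟫_ℝ)
      (fun y => ⟪T (v z.2), v y⟫_ℝ)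
    rw [hu.centred, zero_mul] at h
    exact h

lemma kernelComp_tensorKernel (hu : CentredFeature μ u A C) (hv : CentredFeature ν v B C)
    (hS : ∀ a b, ⟪S a, b⟫_ℝ = ⟪a, S b⟫_ℝ) (hT : ∀ a b, ⟪T a, b⟫_ℝ = ⟪a, T b⟫_ℝ) :
    kernelComp (μ.prod ν) (tensorKernel u v S T) =
      tensorKernel u v (S ∘L A ∘L S) (T ∘L B ∘L T) := by
  funext z w
  have h := integral_prod_mul (μ := μ) (ν := ν)
    (fun x => ⟪S (u z.1), u x⟫_ℝ * ⟪S (u w.1), u x⟫_ℝ)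
    (fun y => ⟪T (v z.2), v y⟫_ℝ * ⟪T (v w.2), v y⟫_ℝ)
  rw [hu.integral_inner_mul_inner hS, hv.integral_inner_mul_inner hT] at h
  rw [kernelComp, tensorKernel, ← h]
  refine integral_congr_ae (ae_of_all _ fun t => ?_)
  simp only [tensorKernel]
  ring

lemma kernelSq_tensorKernel (hu : CentredFeature μ u A C) (hv : CentredFeature ν v B C)
    (hS : ∀ a b, ⟪S a, b⟫_ℝ = ⟪a, S b⟫_ℝ) (hT : ∀ a b, ⟪T a, b⟫_ℝ = ⟪a, T b⟫_ℝ) :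
    kernelSq (μ.prod ν) (tensorKernel u v S T) =
      popForm μ u (S ∘L A ∘L S) * popForm ν v (T ∘L B ∘L T) := by
  rw [← integral_kernelComp_diag, hu.kernelComp_tensorKernel hv hS hT]
  exact integral_prod_mul (μ := μ) (ν := ν) (fun x => ⟪(S ∘L A ∘L S) (u x), u x⟫_ℝ)
    (fun y => ⟪(T ∘L B ∘L T) (v y), v y⟫_ℝ)

variable [CompleteSpace E]

lemma regSandwich_symm (hA : A.IsPositive) (hγ : 0 < γ) (a b : E) :
    ⟪regSandwich A γ a, b⟫_ℝ = ⟪a, regSandwich A γ b⟫_ℝ := by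
  simp only [regSandwich, ContinuousLinearMap.comp_apply]
  rw [regInv_symm hA hγ, ((isPositive_iff_real A).1 hA).1, regInv_symm hA hγ]

/-- `M A M ≤ M` for `M = (A + γ)⁻¹ A (A + γ)⁻¹`, because `A (A + γ)⁻¹` is a contraction. -/
lemma inner_regSandwich_comp_le (hA : A.IsPositive) (hγ : 0 < γ) (w : E) :
    ⟪(regSandwich A γ ∘L A ∘L regSandwich A γ) w, w⟫_ℝ ≤ ⟪regSandwich A γ w, w⟫_ℝ := by
  obtain ⟨hs, hp⟩ := (isPositive_iff_real A).1 hA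
  rw [ContinuousLinearMap.comp_apply, ContinuousLinearMap.comp_apply, regSandwich_symm hA hγ]
  simp only [regSandwich, ContinuousLinearMap.comp_apply]
  rw [regInv_symm hA hγ]
  set q := regInv A γ w
  set y := regInv A γ (A q) with hy
  have h1 : A y + γ • y = A q := apply_regInv_add hA hγ (A q)
  have h2 : ⟪A y, y⟫_ℝ + γ * ‖y‖ ^ 2 = ⟪A q, y⟫_ℝ := by
    rw [← h1, inner_add_left, real_inner_smul_left, real_inner_self_eq_norm_sq]
  have h3 := hp (q - y)
  have h4 : ⟪A y, q⟫_ℝ = ⟪A q, y⟫_ℝ := by rw [hs, real_inner_comm]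
  rw [map_sub, inner_sub_left, inner_sub_right, inner_sub_right, h4] at h3
  have h5 : 0 ≤ γ * ‖y‖ ^ 2 := by positivity
  linarith

lemma popForm_regSandwich_comp_le (hu : CentredFeature μ u A C) (hγ : 0 < γ) :
    popForm μ u (regSandwich A γ ∘L A ∘L regSandwich A γ) ≤ popForm μ u (regSandwich A γ) :=
  integral_mono (hu.integrable_diag _) (hu.integrable_diag _) fun x =>
    inner_regSandwich_comp_le hu.isPositive hγ (u x)

lemma popForm_regSandwich_comp_nonneg (hu : CentredFeature μ u A C) (hγ : 0 < γ) :
    0 ≤ popForm μ u (regSandwich A γ ∘L A ∘L regSandwich A γ) :=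
  integral_nonneg fun x => by
    change 0 ≤ ⟪(regSandwich A γ ∘L A ∘L regSandwich A γ) (u x), u x⟫_ℝ
    rw [ContinuousLinearMap.comp_apply, ContinuousLinearMap.comp_apply,
      regSandwich_symm hu.isPositive hγ]
    exact ((isPositive_iff_real A).1 hu.isPositive).2 _

/-- Bessel's inequality for the form `A`, from `0 ≤ ⟪A (w - w'), w - w'⟫` with `w'` the projection
of `w` to the span of the eigenvectors. -/
lemma sum_le_inner_apply (hA : A.IsPositive) {κ : Type*} {e : κ → E} (he : Orthonormal ℝ e)
    {l : κ → ℝ} (hl : ∀ p, A (e p) = l p • e p) (s : Finset κ) (w : E) :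
    ∑ p ∈ s, l p * ⟪e p, w⟫_ℝ ^ 2 ≤ ⟪A w, w⟫_ℝ := by
  obtain ⟨hs, hp⟩ := (isPositive_iff_real A).1 hA
  set w' := ∑ p ∈ s, ⟪e p, w⟫_ℝ • e p with hw'
  have h1 : A w' = ∑ p ∈ s, (⟪e p, w⟫_ℝ * l p) • e p := by
    rw [hw', map_sum]
    exact Finset.sum_congr rfl fun p _ => by rw [map_smul, hl, smul_smul]
  have h2 : ⟪A w', w⟫_ℝ = ∑ p ∈ s, l p * ⟪e p, w⟫_ℝ ^ 2 := by
    rw [h1, sum_inner]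
    exact Finset.sum_congr rfl fun p _ => by rw [real_inner_smul_left]; ring
  have h3 : ⟪A w', w'⟫_ℝ = ∑ p ∈ s, l p * ⟪e p, w⟫_ℝ ^ 2 := by
    rw [h1, hw', he.inner_sum]
    exact Finset.sum_congr rfl fun p _ => by simp; ring
  have h4 := hp (w - w')
  have h5 : ⟪A w, w'⟫_ℝ = ⟪A w', w⟫_ℝ := by rw [hs, real_inner_comm]
  rw [map_sub, inner_sub_left, inner_sub_right, inner_sub_right, h5, h3, h2] at h4
  linarith

/-- `∫ ⟪(A + γ)⁻¹ A (A + γ)⁻¹ u, u⟫ = d₂(A, γ)²` is at least any finite part of the sum defining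
it. -/
lemma sum_le_popForm_regSandwich (hu : CentredFeature μ u A C) (hγ : 0 < γ)
    {κ : Type*} {e : κ → E} (he : Orthonormal ℝ e) {l : κ → ℝ} (hl : ∀ p, A (e p) = l p • e p)
    (hl0 : ∀ p, 0 < l p) (s : Finset κ) :
    ∑ p ∈ s, (l p / (l p + γ)) ^ 2 ≤ popForm μ u (regSandwich A γ) := by
  have hA := hu.isPositive
  have hR : ∀ p, regInv A γ (e p) = (l p + γ)⁻¹ • e p := fun p => by
    have h := regInv_apply_add hA hγ (e p)
    rw [hl, ← add_smul, map_smul] at h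
    rw [← h, smul_smul, h, inv_mul_cancel₀ (add_pos (hl0 p) hγ).ne', one_smul]
  have hx : ∀ x, ∑ p ∈ s, l p * ((l p + γ)⁻¹ * ((l p + γ)⁻¹ * (⟪e p, u x⟫_ℝ * ⟪e p, u x⟫_ℝ))) ≤
      ⟪regSandwich A γ (u x), u x⟫_ℝ := fun x => by
    simp only [regSandwich, ContinuousLinearMap.comp_apply]
    rw [regInv_symm hA hγ]
    refine le_trans (le_of_eq (Finset.sum_congr rfl fun p _ => ?_))
      (sum_le_inner_apply hA he hl s (regInv A γ (u x)))
    rw [← regInv_symm hA hγ, hR, real_inner_smul_left]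
    ring
  have hI : ∀ p, Integrable (fun x => ⟪e p, u x⟫_ℝ * ⟪e p, u x⟫_ℝ) μ := fun p => by
    have hm := (stronglyMeasurable_const (b := e p)).inner (𝕜 := ℝ) hu.stronglyMeasurable
    refine Integrable.of_bound (hm.mul hm).aestronglyMeasurable (C * C) (ae_of_all _ fun x => ?_)
    have hb : ‖⟪e p, u x⟫_ℝ‖ ≤ C :=
      (norm_inner_le_norm _ _).trans (by rw [he.1, one_mul]; exact hu.bound x)
    rw [norm_mul]
    exact mul_le_mul hb hb (norm_nonneg _) ((norm_nonneg _).trans hb)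
  have hterm : ∀ p, Integrable (fun x => l p * ((l p + γ)⁻¹ * ((l p + γ)⁻¹ *
      (⟪e p, u x⟫_ℝ * ⟪e p, u x⟫_ℝ)))) μ := fun p =>
    (((hI p).const_mul _).const_mul _).const_mul _
  refine le_trans (le_of_eq ?_)
    (integral_mono (integrable_finsetSum s fun p _ => hterm p) (hu.integrable_diag _) hx)
  rw [integral_finsetSum s fun p _ => hterm p]
  refine Finset.sum_congr rfl fun p _ => ?_
  rw [integral_const_mul, integral_const_mul, integral_const_mul, ← hu.inner_cov, hl,
    real_inner_smul_left, real_inner_self_eq_norm_sq, he.1]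
  rw [div_eq_mul_inv]
  ring

/-- As `γ → 0` each term `(λ_p / (λ_p + γ))²` tends to `1`, and there are infinitely many. -/
lemma tendsto_popForm_regSandwich (hu : CentredFeature μ u A C) (hinf : Infinite (PosEig A))
    {γ : ℕ → ℝ} (hγ : ∀ᶠ n in atTop, 0 < γ n) (hγ0 : Tendsto γ atTop (𝓝 0)) :
    Tendsto (fun n => popForm μ u (regSandwich A (γ n))) atTop atTop := by
  obtain ⟨e, he, hl, -⟩ := exists_orthonormal_eigenvectors ((isPositive_iff_real A).1 hu.isPositive).1
  have hl0 : ∀ p, 0 < eig A p := fun p => p.1.2.1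
  refine tendsto_atTop.2 fun b => ?_
  obtain ⟨N, hN⟩ := exists_nat_gt b
  obtain ⟨s, hs⟩ := Infinite.exists_subset_card_eq (PosEig A) N
  have hlim : Tendsto (fun n => ∑ p ∈ s, (eig A p / (eig A p + γ n)) ^ 2) atTop (𝓝 N) := by
    have h : ∀ p ∈ s, Tendsto (fun n => (eig A p / (eig A p + γ n)) ^ 2) atTop (𝓝 1) := by
      intro p _
      have h1 := ((tendsto_const_nhds (x := eig A p)).div (hγ0.const_add (eig A p))
        (by rw [add_zero]; exact (hl0 p).ne')).pow 2
      rwa [add_zero, div_self (hl0 p).ne', one_pow] at h1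
    have h2 := tendsto_finsetSum s h
    simpa [hs] using h2
  filter_upwards [hγ, hlim.eventually (lt_mem_nhds hN)] with n h1 h2
  exact h2.le.trans (hu.sum_le_popForm_regSandwich h1 he hl hl0 s)

end CentredFeature

end Population

/-! ### The population statistic and its approximation by the statistic -/

section PopStat

open scoped TensorProduct

lemma measureReal_not_and_le {α : Type*} [MeasurableSpace α] {μ : Measure α} [IsFiniteMeasure μ]
    {p q : α → Prop} {a b : ℝ} (hp : μ.real {x | ¬ p x} ≤ a) (hq : μ.real {x | ¬ q x} ≤ b) :
    μ.real {x | ¬ (p x ∧ q x)} ≤ a + b := by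
  have h : {x | ¬ (p x ∧ q x)} = {x | ¬ p x} ∪ {x | ¬ q x} := by
    ext x; exact not_and_or
  rw [h]
  exact (measureReal_union_le _ _).trans (add_le_add hp hq)

lemma measureReal_not_le_le {α : Type*} [MeasurableSpace α] {μ : Measure α} [IsFiniteMeasure μ]
    {f : α → ℝ} {a b c : ℝ} (h : μ.real {x | a < f x} ≤ c) (hab : a ≤ b) :
    μ.real {x | ¬ f x ≤ b} ≤ c :=
  (measureReal_mono fun _ hx => lt_of_le_of_lt hab (not_le.1 hx)).trans h

variable {E F 𝒳 𝒴 ι : Type*} [NormedAddCommGroup E] [InnerProductSpace ℝ E] [CompleteSpace E]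
  [NormedAddCommGroup F] [InnerProductSpace ℝ F] [CompleteSpace F]
  [MeasurableSpace 𝒳] [MeasurableSpace 𝒴] [Fintype ι] [DecidableEq ι]
  {μ : Measure 𝒳} [IsProbabilityMeasure μ] {ν : Measure 𝒴} [IsProbabilityMeasure ν]
  {u : 𝒳 → E} {A : E →L[ℝ] E} {v : 𝒴 → F} {B : F →L[ℝ] F} {C γ N : ℝ}

/-- The statistic with the empirical covariance operators replaced by the population ones: a
normalised degenerate `U`-statistic. -/
noncomputable def popStat (μ : Measure 𝒳) (ν : Measure 𝒴) (u : 𝒳 → E) (v : 𝒴 → F) (A : E →L[ℝ] E)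
    (B : F →L[ℝ] F) (γ : ℝ) (x : ι → 𝒳 × 𝒴) : ℝ :=
  pairSum (tensorKernel u v (regInv A γ) (regInv B γ)) Finset.univ x /
    (√2 * Fintype.card ι *
      √(kernelSq (μ.prod ν) (tensorKernel u v (regInv A γ) (regInv B γ))))

namespace CentredFeature

lemma kernelSq_regInv (hu : CentredFeature μ u A C) (hv : CentredFeature ν v B C) (hγ : 0 < γ) :
    kernelSq (μ.prod ν) (tensorKernel u v (regInv A γ) (regInv B γ)) =
      popForm μ u (regSandwich A γ) * popForm ν v (regSandwich B γ) :=
  hu.kernelSq_tensorKernel hv (regInv_symm hu.isPositive hγ) (regInv_symm hv.isPositive hγ)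

/-- The composed kernel has second moment at most that of the kernel itself. As the latter tends
to infinity, this is the condition that makes the limit Gaussian and not a weighted sum of
chi-squares. -/
lemma kernelSq_kernelComp_regInv_le (hu : CentredFeature μ u A C) (hv : CentredFeature ν v B C)
    (hγ : 0 < γ) :
    kernelSq (μ.prod ν) (kernelComp (μ.prod ν) (tensorKernel u v (regInv A γ) (regInv B γ))) ≤
      kernelSq (μ.prod ν) (tensorKernel u v (regInv A γ) (regInv B γ)) := by
  rw [hu.kernelComp_tensorKernel hv (regInv_symm hu.isPositive hγ) (regInv_symm hv.isPositive hγ),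
    hu.kernelSq_regInv hv hγ]
  refine (hu.kernelSq_tensorKernel hv (regSandwich_symm hu.isPositive hγ)
    (regSandwich_symm hv.isPositive hγ)).trans_le ?_
  have h1 := hu.popForm_regSandwich_comp_le hγ
  exact mul_le_mul h1 (hv.popForm_regSandwich_comp_le hγ)
    (hv.popForm_regSandwich_comp_nonneg hγ) ((hu.popForm_regSandwich_comp_nonneg hγ).trans h1)

lemma degenerateKernel_regInv (hu : CentredFeature μ u A C) (hv : CentredFeature ν v B C)
    (hγ : 0 < γ) : DegenerateKernel (μ.prod ν) (tensorKernel u v (regInv A γ) (regInv B γ))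
      (C ^ 4 * (γ ^ 2)⁻¹) :=
  hu.degenerateKernel hv (regInv_symm hu.isPositive hγ) (regInv_symm hv.isPositive hγ)
    (norm_regInv_le hu.isPositive hγ) (norm_regInv_le hv.isPositive hγ)

/-- The two conditions of `tendsto_charFun_pairSum` follow from the rate of `γ` and from the
divergence of the second moment of the kernel. -/
lemma tendsto_charFun_popStat (hu : CentredFeature μ u A C) (hv : CentredFeature ν v B C)
    (hA : Infinite (PosEig A)) (hB : Infinite (PosEig B)) {γ : ℕ → ℝ}
    (hγ : ∀ᶠ n in atTop, 0 < γ n) (hγ0 : Tendsto γ atTop (𝓝 0))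
    (hrate : Tendsto (fun n : ℕ => (γ n ^ 3)⁻¹ * (√n)⁻¹) atTop (𝓝 0)) (t : ℝ) :
    Tendsto (fun n : ℕ => ∫ x : Fin n → 𝒳 × 𝒴, Complex.exp
      ((t * popStat μ ν u v A B (γ n) x : ℝ) * Complex.I) ∂(Measure.pi fun _ => μ.prod ν))
      atTop (𝓝 (Complex.exp ((-(t ^ 2 / 2) : ℝ)))) := by
  have hC : 0 < C := zero_lt_one.trans_le hu.one_le
  have hγ1 : ∀ᶠ n in atTop, γ n ≤ 1 := hγ0.eventually (ge_mem_nhds zero_lt_one)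
  have hK : Tendsto (fun n => kernelSq (μ.prod ν)
      (tensorKernel u v (regInv A (γ n)) (regInv B (γ n)))) atTop atTop := by
    refine ((hu.tendsto_popForm_regSandwich hA hγ hγ0).atTop_mul_atTop₀
      (hv.tendsto_popForm_regSandwich hB hγ hγ0)).congr' ?_
    filter_upwards [hγ] with n hn
    exact (hu.kernelSq_regInv hv hn).symm
  have key := tendsto_charFun_pairSum (ρ := μ.prod ν)
    (h := fun n => tensorKernel u v (regInv A (γ n)) (regInv B (γ n)))
    (B := fun n => C ^ 4 * (γ n ^ 2)⁻¹)
    (hγ.mono fun n hn => hu.degenerateKernel_regInv hv hn)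
    (hγ.mono fun n hn => by positivity) (hK.eventually_gt_atTop 0) ?_ ?_ t
  · simpa only [popStat, Fintype.card_fin] using key
  · have h0 : Tendsto (fun n : ℕ => C ^ 4 * ((γ n ^ 3)⁻¹ * (√n)⁻¹)) atTop (𝓝 0) := by
      simpa using hrate.const_mul (C ^ 4)
    refine squeeze_zero' (hγ.mono fun n hn => by positivity) ?_ h0
    filter_upwards [hγ, hγ1, hK.eventually_ge_atTop 1] with n h1 h2 h3
    have h4 : 1 ≤ √(kernelSq (μ.prod ν) (tensorKernel u v (regInv A (γ n)) (regInv B (γ n)))) :=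
      Real.one_le_sqrt.2 h3
    have h5 : (γ n ^ 2)⁻¹ ≤ (γ n ^ 3)⁻¹ :=
      inv_anti₀ (by positivity) (pow_le_pow_of_le_one h1.le h2 (by norm_num))
    rw [div_eq_mul_inv, mul_inv]
    calc _ ≤ C ^ 4 * (γ n ^ 3)⁻¹ * ((√n)⁻¹ * 1) := by
          gcongr
          exact inv_le_one_of_one_le₀ h4
      _ = _ := by ring
  · refine squeeze_zero' (g := fun n => (√(kernelSq (μ.prod ν)
      (tensorKernel u v (regInv A (γ n)) (regInv B (γ n)))))⁻¹)
      (Eventually.of_forall fun n => div_nonneg (Real.sqrt_nonneg _) kernelSq_nonneg) ?_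
      (tendsto_inv_atTop_zero.comp (Real.tendsto_sqrt_atTop.comp hK))
    filter_upwards [hγ] with n hn
    rw [← Real.sqrt_div_self]
    exact div_le_div_of_nonneg_right
      (Real.sqrt_le_sqrt (hu.kernelSq_kernelComp_regInv_le hv hn)) kernelSq_nonneg

lemma measurable_popStat (hu : CentredFeature μ u A C) (hv : CentredFeature ν v B C) (γ : ℝ) :
    Measurable (popStat (ι := ι) μ ν u v A B γ) := by
  refine Measurable.div_const (Finset.measurable_fun_sum _ fun i _ =>
    Finset.measurable_fun_sum _ fun j _ => ?_) _
  exact ((hu.measurable_inner (regInv A γ)).comp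
      ((measurable_pi_apply i).fst.prodMk (measurable_pi_apply j).fst)).mul
    ((hv.measurable_inner (regInv B γ)).comp
      ((measurable_pi_apply i).snd.prodMk (measurable_pi_apply j).snd))

lemma measureReal_abs_popStat_gt_le (hu : CentredFeature μ u A C) (hv : CentredFeature ν v B C)
    (hγ : 0 < γ) (hN : 0 < N) :
    (Measure.pi fun _ : ι => μ.prod ν).real {x | N < |popStat μ ν u v A B γ x|} ≤ (N ^ 2)⁻¹ := by
  have H := hu.degenerateKernel_regInv hv hγ
  have h := measureReal_lt_le_of_integral_sq_le (a := 1) (N := N)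
    (((H.bddMeasurable_pairSum (ι := ι) Finset.univ).mul (BddMeasurable.const
      (√2 * Fintype.card ι * √(kernelSq (μ.prod ν)
        (tensorKernel u v (regInv A γ) (regInv B γ))))⁻¹)).pow 2 |>.integrable
      (Measure.pi fun _ : ι => μ.prod ν)) one_pos hN ?_
  · simpa only [mul_one, popStat, div_eq_mul_inv] using h
  simp_rw [mul_pow]
  rw [integral_mul_const, inv_pow, ← div_eq_mul_inv, one_pow]
  refine div_le_one_of_le₀ ((H.integral_pairSum_sq_le Finset.univ).trans (le_of_eq ?_))
    (sq_nonneg _)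
  rw [mul_pow, mul_pow, Real.sq_sqrt zero_le_two, Real.sq_sqrt kernelSq_nonneg, Finset.card_univ]

/-- The sum over pairs of distinct indices is the full double sum minus its diagonal. -/
lemma popStat_eq (hu : CentredFeature μ u A C) (hv : CentredFeature ν v B C) (hγ : 0 < γ)
    [Nonempty ι] (hs : 0 ≤ popForm μ u (regSandwich A γ)) (x : ι → 𝒳 × 𝒴) :
    popStat μ ν u v A B γ x =
      (crossForm (regInv A γ) (regInv B γ) (fun i => u (x i).1) (fun i => v (x i).2) -
        (Fintype.card ι : ℝ)⁻¹ * ∑ i, ⟪regInv A γ (u (x i).1), u (x i).1⟫_ℝ *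
          ⟪regInv B γ (v (x i).2), v (x i).2⟫_ℝ) /
      (√2 * (√(popForm μ u (regSandwich A γ)) * √(popForm ν v (regSandwich B γ)))) := by
  have hn0 : (Fintype.card ι : ℝ) ≠ 0 := (Nat.cast_pos.2 Fintype.card_pos).ne'
  have hp : pairSum (tensorKernel u v (regInv A γ) (regInv B γ)) Finset.univ x =
      Fintype.card ι * (crossForm (regInv A γ) (regInv B γ) (fun i => u (x i).1)
        (fun i => v (x i).2) - (Fintype.card ι : ℝ)⁻¹ * ∑ i,
          ⟪regInv A γ (u (x i).1), u (x i).1⟫_ℝ * ⟪regInv B γ (v (x i).2), v (x i).2⟫_ℝ) := by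
    rw [mul_sub, crossForm, ← mul_assoc, ← mul_assoc, mul_inv_cancel₀ hn0, one_mul, one_mul,
      ← Finset.sum_sub_distrib, pairSum]
    refine Finset.sum_congr rfl fun i _ => ?_
    rw [rowSum, Finset.sum_erase_eq_sub (Finset.mem_univ i)]
    rfl
  rw [popStat, hp, hu.kernelSq_regInv hv hγ, Real.sqrt_mul hs, mul_comm √2 (Fintype.card ι : ℝ),
    mul_assoc, mul_div_mul_left _ _ hn0]

/-- The four empirical quantities attached to one sample are simultaneously within `M n^{-1/2}`
of their means, at their natural scale in `γ`, up to an event of probability `4 N⁻²`. -/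
lemma measureReal_not_concentrated_le [Nonempty ι] (hu : CentredFeature μ u A C) (hγ : 0 < γ)
    (hγ1 : γ ≤ 1) (hN : 0 < N) {M r : ℝ} (hr : r = (√(Fintype.card ι))⁻¹) (hM : 4 * C ^ 4 * N ≤ M) :
    (Measure.pi fun _ : ι => μ).real {x | ¬ (‖avg fun i => u (x i)‖ ≤ M * r ∧
      ‖secondMoment (fun i => u (x i)) - A‖ ≤ M * r ∧
      |meanForm (regInv A γ) (fun i => u (x i)) - popForm μ u (regInv A γ)| ≤ M * r * γ⁻¹ ∧
      |meanForm (regSandwich A γ) (fun i => u (x i)) - popForm μ u (regSandwich A γ)| ≤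
        M * r * (γ ^ 2)⁻¹)} ≤ 4 * (N ^ 2)⁻¹ := by
  have hC1 := hu.one_le
  have hC : 0 < C := zero_lt_one.trans_le hC1
  have hA := hu.isPositive
  have hC24 : C ^ 2 ≤ C ^ 4 := pow_le_pow_right₀ hC1 (by norm_num)
  have hC14 : C ≤ C ^ 4 := le_self_pow₀ hC1 (by norm_num)
  have hr0 : 0 ≤ r := by rw [hr]; positivity
  have h1 := measureReal_norm_avg_gt_le (ι := ι) hu.stronglyMeasurable hu.bound hC hu.centred hN
  have h2 := hu.measureReal_norm_secondMoment_sub_gt_le (ι := ι) hN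
  have h3 := measureReal_abs_mean_gt_le (ι := ι) (ρ := μ) (hu.measurable_diag (regInv A γ))
    (c := γ⁻¹ * C ^ 2) (fun x => (hu.abs_inner_apply_le _ x x).trans
      (by gcongr; exact norm_regInv_le hA hγ)) (by positivity) hN
  have h4 := measureReal_abs_mean_gt_le (ι := ι) (ρ := μ) (hu.measurable_diag (regSandwich A γ))
    (c := 2 * γ⁻¹ * C ^ 2) (fun x => (hu.abs_inner_apply_le _ x x).trans
      (by gcongr; exact norm_regSandwich_le hA hγ)) (by positivity) hN
  rw [← hr] at h1 h2 h3 h4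
  have hγi : γ⁻¹ ≤ (γ ^ 2)⁻¹ := by
    rw [← inv_pow]; exact le_self_pow₀ ((one_le_inv₀ hγ).2 hγ1) two_ne_zero
  have e : 4 * (N ^ 2)⁻¹ = (N ^ 2)⁻¹ + ((N ^ 2)⁻¹ + ((N ^ 2)⁻¹ + (N ^ 2)⁻¹)) := by ring
  have hC4 : 0 < C ^ 4 := by positivity
  have b1 : C * N ≤ M := le_trans (by gcongr; linarith) hM
  have b2 : 2 * C ^ 2 * N ≤ M := le_trans (by gcongr; linarith) hM
  have b3 : 4 * C ^ 2 * N ≤ M := le_trans (by gcongr) hM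
  rw [e]
  refine measureReal_not_and_le (measureReal_not_le_le h1 ?_) (measureReal_not_and_le
    (measureReal_not_le_le h2 ?_) (measureReal_not_and_le (measureReal_not_le_le h3 ?_)
      (measureReal_not_le_le h4 ?_)))
  · calc _ = C * N * r := by ring
      _ ≤ _ := by gcongr
  · calc _ = 2 * C ^ 2 * N * r := by ring
      _ ≤ _ := by gcongr
  · calc _ = 2 * C ^ 2 * N * r * γ⁻¹ := by ring
      _ ≤ _ := by gcongr
  · calc _ = 4 * C ^ 2 * N * r * γ⁻¹ := by ring
      _ ≤ _ := by
        have : 0 ≤ M := le_trans (by positivity) b1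
        gcongr

lemma comp_fst (hu : CentredFeature μ u A C) :
    CentredFeature (μ.prod ν) (fun z => u z.1) A C where
  stronglyMeasurable := hu.stronglyMeasurable.comp_measurable measurable_fst
  one_le := hu.one_le
  bound z := hu.bound z.1
  centred w := by
    rw [integral_fun_fst (μ := μ) (ν := ν) (fun x => ⟪w, u x⟫_ℝ), hu.centred, smul_zero]
  inner_cov a b := by
    rw [integral_fun_fst (μ := μ) (ν := ν) (fun x => ⟪a, u x⟫_ℝ * ⟪b, u x⟫_ℝ), hu.inner_cov]
    simp

lemma comp_snd (hv : CentredFeature ν v B C) :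
    CentredFeature (μ.prod ν) (fun z => v z.2) B C where
  stronglyMeasurable := hv.stronglyMeasurable.comp_measurable measurable_snd
  one_le := hv.one_le
  bound z := hv.bound z.2
  centred w := by
    rw [integral_fun_snd (μ := μ) (ν := ν) (fun x => ⟪w, v x⟫_ℝ), hv.centred, smul_zero]
  inner_cov a b := by
    rw [integral_fun_snd (μ := μ) (ν := ν) (fun x => ⟪a, v x⟫_ℝ * ⟪b, v x⟫_ℝ), hv.inner_cov]
    simp

/-- By independence `u(X) ⊗ v(Y)` is centred, so the normalised cross covariance is bounded in
probability. -/
lemma measureReal_norm_crossVec_gt_le [Nonempty ι] (hu : CentredFeature μ u A C)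
    (hv : CentredFeature ν v B C) (hN : 0 < N) :
    (Measure.pi fun _ : ι => μ.prod ν).real
      {x | N * C ^ 2 < ‖crossVec (fun i => u (x i).1) (fun i => v (x i).2)‖} ≤ (N ^ 2)⁻¹ := by
  have hC : 0 < C := zero_lt_one.trans_le hu.one_le
  have hn0 : (0 : ℝ) < Fintype.card ι := Nat.cast_pos.2 Fintype.card_pos
  have hs0 : 0 < √(Fintype.card ι : ℝ) := Real.sqrt_pos.2 hn0
  have hm : StronglyMeasurable fun z : 𝒳 × 𝒴 => u z.1 ⊗ₜ[ℝ] v z.2 := by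
    have h1 : Continuous fun p : E × F => p.1 ⊗ₜ[ℝ] p.2 := by fun_prop
    exact h1.comp_stronglyMeasurable ((hu.comp_fst (ν := ν)).stronglyMeasurable.prodMk
      (hv.comp_snd (μ := μ)).stronglyMeasurable)
  have hb : ∀ z : 𝒳 × 𝒴, ‖u z.1 ⊗ₜ[ℝ] v z.2‖ ≤ C ^ 2 := fun z => by
    rw [TensorProduct.norm_tmul, sq]
    exact mul_le_mul (hu.bound _) (hv.bound _) (norm_nonneg _) hC.le
  have hc : ∀ w : E ⊗[ℝ] F, ∫ z, ⟪w, u z.1 ⊗ₜ[ℝ] v z.2⟫_ℝ ∂(μ.prod ν) = 0 := by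
    intro w
    have hi : ∀ w : E ⊗[ℝ] F, Integrable (fun z => ⟪w, u z.1 ⊗ₜ[ℝ] v z.2⟫_ℝ) (μ.prod ν) :=
      fun w => (Integrable.of_bound hm.aestronglyMeasurable _ (ae_of_all _ hb)).const_inner w
    induction w using TensorProduct.induction_on with
    | zero => simp
    | tmul a b =>
      simp_rw [TensorProduct.inner_tmul]
      rw [integral_prod_mul (fun x => ⟪a, u x⟫_ℝ) (fun y => ⟪b, v y⟫_ℝ), hu.centred, zero_mul]
    | add w w' h h' =>
      simp_rw [inner_add_left]
      rw [integral_add (hi w) (hi w'), h, h', add_zero]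
  have h := measureReal_norm_avg_gt_le (ι := ι) hm hb (by positivity) hc hN
  refine (measureReal_mono fun x hx => ?_).trans h
  have hx' : N * C ^ 2 < ‖crossVec (fun i => u (x i).1) (fun i => v (x i).2)‖ := hx
  have e : ‖avg fun i => u (x i).1 ⊗ₜ[ℝ] v (x i).2‖ =
      (√(Fintype.card ι : ℝ))⁻¹ * ‖crossVec (fun i => u (x i).1) (fun i => v (x i).2)‖ := by
    rw [avg, crossVec, norm_smul, norm_smul, ← mul_assoc, norm_inv, norm_inv, Real.norm_natCast,
      Real.norm_eq_abs, abs_of_pos hs0, ← mul_inv, Real.mul_self_sqrt hn0.le]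
  change _ < ‖avg fun i => u (x i).1 ⊗ₜ[ℝ] v (x i).2‖
  rw [e]
  calc _ = (√(Fintype.card ι : ℝ))⁻¹ * (N * C ^ 2) := by ring
    _ < _ := by gcongr

/-- The statistic and its population version differ by `O(γ⁻³ n^{-1/2})` in probability. -/
lemma measureReal_abs_gramStat_sub_gt_le [Nonempty ι] (hu : CentredFeature μ u A C)
    (hv : CentredFeature ν v B C) (hγ : 0 < γ) (hγ1 : γ ≤ 1) (hN : 1 ≤ N) {M r : ℝ}
    (hr : r = (√(Fintype.card ι))⁻¹) (hM : M = 4 * C ^ 4 * N)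
    (hs : 1 ≤ popForm μ u (regSandwich A γ)) (ht : 1 ≤ popForm ν v (regSandwich B γ))
    (hsmall : pertConst M C * ((γ ^ 3)⁻¹ * r) ≤ 1 / 4) :
    (Measure.pi fun _ : ι => μ.prod ν).real
      {x | ¬ |gramStat γ (fun i => u (x i).1) (fun i => v (x i).2) - popStat μ ν u v A B γ x| ≤
        (2 + 5 * M) * (pertConst M C * ((γ ^ 3)⁻¹ * r))} ≤ 11 * (N ^ 2)⁻¹ := by
  have hN0 : 0 < N := zero_lt_one.trans_le hN
  have hC1 := hu.one_le
  have hC : 0 < C := zero_lt_one.trans_le hC1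
  have hr0 : 0 ≤ r := by rw [hr]; positivity
  have hC24 : C ^ 2 ≤ C ^ 4 := pow_le_pow_right₀ hC1 (by norm_num)
  have hC4 : 1 ≤ C ^ 4 := one_le_pow₀ hC1
  have hNM : N ≤ M := by rw [hM]; nlinarith
  have hM1 : 1 ≤ M := hN.trans hNM
  have hM0 : 0 ≤ M := zero_le_one.trans hM1
  have g1 := (hu.comp_fst (ν := ν)).measureReal_not_concentrated_le (ι := ι) hγ hγ1 hN0 hr hM.ge
  have g2 := (hv.comp_snd (μ := μ)).measureReal_not_concentrated_le (ι := ι) hγ hγ1 hN0 hr hM.ge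
  have p1 : ∀ T, popForm (μ.prod ν) (fun z => u z.1) T = popForm μ u T := fun T => by
    rw [popForm, integral_fun_fst (μ := μ) (ν := ν) (fun x => ⟪T (u x), u x⟫_ℝ)]; simp [popForm]
  have p2 : ∀ T, popForm (μ.prod ν) (fun z => v z.2) T = popForm ν v T := fun T => by
    rw [popForm, integral_fun_snd (μ := μ) (ν := ν) (fun x => ⟪T (v x), v x⟫_ℝ)]; simp [popForm]
  rw [p1, p1] at g1
  rw [p2, p2] at g2
  have g3 := measureReal_not_le_le (hu.measureReal_norm_crossVec_gt_le (ι := ι) hv hN0)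
    (b := M) (by rw [hM]; nlinarith)
  have g4 := measureReal_not_le_le (hu.measureReal_abs_popStat_gt_le (ι := ι) hv hγ hN0) hNM
  have HK := hu.degenerateKernel_regInv hv hγ
  have g5 := measureReal_abs_mean_gt_le (ι := ι) (ρ := μ.prod ν)
    (f := fun z => tensorKernel u v (regInv A γ) (regInv B γ) z z)
    (HK.measurable.comp (measurable_id.prodMk measurable_id))
    (fun z => HK.bound z z) (by positivity) hN0
  have hpq : ∫ z, tensorKernel u v (regInv A γ) (regInv B γ) z z ∂(μ.prod ν) =
      popForm μ u (regInv A γ) * popForm ν v (regInv B γ) :=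
    integral_prod_mul (μ := μ) (ν := ν) (fun x => ⟪regInv A γ (u x), u x⟫_ℝ)
      (fun y => ⟪regInv B γ (v y), v y⟫_ℝ)
  rw [hpq, ← hr] at g5
  have g5' := measureReal_not_le_le g5 (b := M * r * (γ ^ 2)⁻¹) (by
    calc _ = 2 * C ^ 4 * N * r * (γ ^ 2)⁻¹ := by ring
      _ ≤ _ := by rw [hM]; gcongr; norm_num)
  -- eleven events: four for each sample, the cross covariance, the statistic and the diagonal
  have e : 11 * (N ^ 2)⁻¹ = 4 * (N ^ 2)⁻¹ + (4 * (N ^ 2)⁻¹ + ((N ^ 2)⁻¹ +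
    ((N ^ 2)⁻¹ + (N ^ 2)⁻¹))) := by ring
  have G := measureReal_not_and_le g1
    (measureReal_not_and_le g2 (measureReal_not_and_le g3 (measureReal_not_and_le g4 g5')))
  rw [e]
  refine (measureReal_mono fun x hx => ?_).trans G
  rw [Set.mem_ofPred] at hx ⊢
  refine fun hgood => hx ?_
  obtain ⟨⟨a1, a2, a3, a4⟩, ⟨b1, b2, b3, b4⟩, c1, c2, c3⟩ := hgood
  rw [hu.popStat_eq hv hγ (zero_le_one.trans hs)] at c2 ⊢
  refine abs_gramStat_sub_le hu.isPositive hv.isPositive hγ hγ1 hr hM1 (fun i => hu.bound _)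
    (fun i => hv.bound _) a1 a2 b1 b2 c1 a3 b3 ?_ a4 b4 c3 hs ht c2 hsmall
  refine (hu.abs_popForm_le _).trans ?_
  rw [mul_comm]
  gcongr
  exact norm_regInv_le hu.isPositive hγ

end CentredFeature

end PopStat

/-! ### Limit laws along an i.i.d. sample -/

section Limit

variable {E F 𝒳 𝒴 Ω : Type*} [NormedAddCommGroup E] [InnerProductSpace ℝ E] [CompleteSpace E]
  [NormedAddCommGroup F] [InnerProductSpace ℝ F] [CompleteSpace F]
  [MeasurableSpace 𝒳] [MeasurableSpace 𝒴] [MeasurableSpace Ω] {P : Measure Ω}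
  [IsProbabilityMeasure P] {μ : Measure 𝒳} [IsProbabilityMeasure μ] {ν : Measure 𝒴}
  [IsProbabilityMeasure ν] {u : 𝒳 → E} {A : E →L[ℝ] E} {v : 𝒴 → F} {B : F →L[ℝ] F} {C : ℝ}
  {γ : ℕ → ℝ} {Z : ∀ n : ℕ, Ω → Fin n → 𝒳 × 𝒴}

namespace CentredFeature

lemma tendstoInDistribution_popStat (hu : CentredFeature μ u A C) (hv : CentredFeature ν v B C)
    (hA : Infinite (PosEig A)) (hB : Infinite (PosEig B))
    (hγ : ∀ᶠ n in atTop, 0 < γ n) (hγ0 : Tendsto γ atTop (𝓝 0))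
    (hrate : Tendsto (fun n : ℕ => (γ n ^ 3)⁻¹ * (√n)⁻¹) atTop (𝓝 0))
    (hZ : ∀ n, AEMeasurable (Z n) P)
    (hlaw : ∀ n, P.map (Z n) = Measure.pi fun _ => μ.prod ν) :
    TendstoInDistribution (fun n ω => popStat μ ν u v A B (γ n) (Z n ω)) atTop (id : ℝ → ℝ)
      (fun _ => P) (gaussianReal 0 1) := by
  have hm : ∀ n, Measurable (popStat (ι := Fin n) μ ν u v A B (γ n)) := fun n =>
    hu.measurable_popStat hv (γ n)
  have hmZ : ∀ n, AEMeasurable (fun ω => popStat μ ν u v A B (γ n) (Z n ω)) P := fun n =>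
    (hm n).comp_aemeasurable (hZ n)
  refine ⟨hmZ, aemeasurable_id, ProbabilityMeasure.tendsto_iff_tendsto_charFun.2 fun t => ?_⟩
  have h := hu.tendsto_charFun_popStat hv hA hB hγ hγ0 hrate t
  have e1 : charFun ((gaussianReal 0 1).map id) t = Complex.exp ((-(t ^ 2 / 2) : ℝ)) := by
    rw [Measure.map_id, charFun_gaussianReal]
    congr 1
    push_cast
    simp
  have e2 : ∀ n, charFun (P.map fun ω => popStat μ ν u v A B (γ n) (Z n ω)) t =
      ∫ x : Fin n → 𝒳 × 𝒴, Complex.exp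
        ((t * popStat μ ν u v A B (γ n) x : ℝ) * Complex.I) ∂(Measure.pi fun _ => μ.prod ν) := by
    intro n
    have hc : Continuous fun y : ℝ => Complex.exp (t * y * Complex.I) := by fun_prop
    have hc' : Measurable fun x : Fin n → 𝒳 × 𝒴 =>
        Complex.exp ((t * popStat μ ν u v A B (γ n) x : ℝ) * Complex.I) :=
      (BddMeasurable.cexp_I ((hm n).const_mul t)).1
    rw [charFun_apply_real, integral_map (hmZ n) hc.aestronglyMeasurable, ← hlaw n,
      integral_map (hZ n) hc'.aestronglyMeasurable]
    simp only [Complex.ofReal_mul]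
  change Tendsto (fun n => charFun (P.map fun ω => popStat μ ν u v A B (γ n) (Z n ω)) t) atTop
    (𝓝 (charFun ((gaussianReal 0 1).map id) t))
  rw [e1]
  simp_rw [e2]
  exact h

/-- The bad event has probability at most `11 N⁻²` for every fixed `N`, and off it the difference
is `O_N(γ⁻³ n^{-1/2})`. -/
lemma tendstoInMeasure_gramStat_sub_popStat (hu : CentredFeature μ u A C)
    (hv : CentredFeature ν v B C) (hA : Infinite (PosEig A)) (hB : Infinite (PosEig B))
    (hγ : ∀ᶠ n in atTop, 0 < γ n) (hγ0 : Tendsto γ atTop (𝓝 0))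
    (hrate : Tendsto (fun n : ℕ => (γ n ^ 3)⁻¹ * (√n)⁻¹) atTop (𝓝 0))
    (hZ : ∀ n, AEMeasurable (Z n) P)
    (hlaw : ∀ n, P.map (Z n) = Measure.pi fun _ => μ.prod ν) :
    TendstoInMeasure P (fun n ω => gramStat (γ n) (fun i => u (Z n ω i).1)
      (fun i => v (Z n ω i).2) - popStat μ ν u v A B (γ n) (Z n ω)) atTop 0 := by
  refine tendstoInMeasure_iff_measureReal_norm.2 fun ε hε => ?_
  refine tendsto_order.2 ⟨fun b hb => Eventually.of_forall fun n =>
    hb.trans_le measureReal_nonneg, fun δ hδ => ?_⟩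
  obtain ⟨N, hN1, hNδ⟩ : ∃ N : ℝ, 1 ≤ N ∧ 11 * (N ^ 2)⁻¹ < δ := by
    have h : Tendsto (fun N : ℝ => 11 * (N ^ 2)⁻¹) atTop (𝓝 0) := by
      simpa using (tendsto_inv_atTop_zero.comp (tendsto_pow_atTop (α := ℝ) two_ne_zero)).const_mul 11
    obtain ⟨N, h1, h2⟩ := ((eventually_ge_atTop 1).and (h.eventually (gt_mem_nhds hδ))).exists
    exact ⟨N, h1, h2⟩
  set M := 4 * C ^ 4 * N with hM
  have hsmall : Tendsto (fun n : ℕ => pertConst M C * ((γ n ^ 3)⁻¹ * (√n)⁻¹)) atTop (𝓝 0) := by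
    simpa using hrate.const_mul (pertConst M C)
  have hsmall' : Tendsto (fun n : ℕ => (2 + 5 * M) * (pertConst M C * ((γ n ^ 3)⁻¹ * (√n)⁻¹)))
      atTop (𝓝 0) := by
    simpa using hsmall.const_mul (2 + 5 * M)
  filter_upwards [hγ, hγ0.eventually (ge_mem_nhds zero_lt_one),
    (hu.tendsto_popForm_regSandwich hA hγ hγ0).eventually_ge_atTop 1,
    (hv.tendsto_popForm_regSandwich hB hγ hγ0).eventually_ge_atTop 1,
    hsmall.eventually (ge_mem_nhds (show (0 : ℝ) < 1 / 4 by norm_num)),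
    hsmall'.eventually (gt_mem_nhds hε), eventually_ge_atTop 1] with n h1 h2 h3 h4 h5 h6 h7
  have : Nonempty (Fin n) := ⟨⟨0, h7⟩⟩
  have key := hu.measureReal_abs_gramStat_sub_gt_le (ι := Fin n) hv h1 h2 hN1
    (r := (√n)⁻¹) (by rw [Fintype.card_fin]) hM h3 h4 h5
  refine lt_of_le_of_lt ?_ hNδ
  refine le_trans ?_ key
  rw [← hlaw n]
  refine ENNReal.toReal_mono (measure_ne_top _ _)
    (le_trans (measure_mono fun ω hω => ?_) (Measure.le_map_apply (hZ n) _))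
  rw [Set.mem_preimage, Set.mem_ofPred, not_le]
  refine h6.trans_le ?_
  have hω' := Set.mem_ofPred.1 hω
  simpa using hω'

end CentredFeature

end Limit

/-! ### The feature map of a bounded continuous kernel -/

section Feature

variable {𝒳 Ω H : Type*} [TopologicalSpace 𝒳] [MeasurableSpace 𝒳] [BorelSpace 𝒳]
  [NormedAddCommGroup H] [InnerProductSpace ℝ H] [CompleteSpace H] [RKHS ℝ H 𝒳 ℝ]
  [MeasurableSpace Ω] {P : Measure Ω} [IsProbabilityMeasure P] {X : Ω → 𝒳}

lemma continuous_sqrt_kernel_diff {k : 𝒳 → 𝒳 → ℝ} (hk : Continuous fun p : 𝒳 × 𝒳 => k p.1 p.2)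
    (x : 𝒳) : Continuous fun y => √(k y y - 2 * k y x + k x x) := by
  have h1 : Continuous fun y : 𝒳 => k y y :=
    Continuous.comp (g := fun p : 𝒳 × 𝒳 => k p.1 p.2) hk (continuous_id.prodMk continuous_id)
  have h2 : Continuous fun y : 𝒳 => k y x :=
    Continuous.comp (g := fun p : 𝒳 × 𝒳 => k p.1 p.2) hk (continuous_id.prodMk continuous_const)
  exact ((h1.sub (h2.const_mul 2)).add continuous_const).sqrt

lemma continuous_feature (hK : Continuous fun p : 𝒳 × 𝒳 => kern H p.1 p.2) :
    Continuous (feature H : 𝒳 → H) := by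
  refine continuous_iff_continuousAt.2 fun x => tendsto_iff_norm_sub_tendsto_zero.2 ?_
  have h : ∀ y : 𝒳, ‖feature H y - feature H x‖ =
      √(kern H y y - 2 * kern H y x + kern H x x) := fun y => by
    have e : kern H y y - 2 * kern H y x + kern H x x = ‖feature H y - feature H x‖ ^ 2 := by
      rw [norm_sub_sq_real, ← real_inner_self_eq_norm_sq, ← real_inner_self_eq_norm_sq]
      rfl
    rw [e, Real.sqrt_sq (norm_nonneg _)]
  simp_rw [h]
  have := (continuous_sqrt_kernel_diff hK x).tendsto x
  rwa [show kern H x x - 2 * kern H x x + kern H x x = 0 by ring, Real.sqrt_zero] at this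

/-- Strong measurability of `K(X, ·)` passes to the feature map on the law of `X`, since the
feature map is continuous. -/
lemma aestronglyMeasurable_feature (hK : Continuous fun p : 𝒳 × 𝒳 => kern H p.1 p.2)
    (hX : Measurable X) (hΦ : AEStronglyMeasurable (fun ω => feature H (X ω)) P) :
    AEStronglyMeasurable (feature H : 𝒳 → H) (P.map X) := by
  borelize H
  have hc := continuous_feature (H := H) hK
  obtain ⟨-, t, ht, hae⟩ := aestronglyMeasurable_iff_aemeasurable_separable.1 hΦ
  refine aestronglyMeasurable_iff_aemeasurable_separable.2
    ⟨hc.measurable.aemeasurable, closure t, ht.closure, ?_⟩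
  refine (ae_map_iff hX.aemeasurable (isClosed_closure.preimage hc).measurableSet).2 ?_
  exact hae.mono fun ω hω => subset_closure hω

lemma exists_norm_feature_le (hK : BoundedKernel (𝒳 := 𝒳) H) :
    ∃ b : ℝ, ∀ x : 𝒳, ‖feature H x‖ ≤ b := by
  obtain ⟨b, hb⟩ := hK
  refine ⟨√b, fun x => Real.le_sqrt_of_sq_le ?_⟩
  rw [← real_inner_self_eq_norm_sq]
  exact hb ⟨(x, x), rfl⟩

lemma inner_covOp (hΦ : AEStronglyMeasurable (fun ω => feature H (X ω)) P) {b : ℝ}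
    (hb : ∀ x : 𝒳, ‖feature H x‖ ≤ b) (a a' : H) :
    ⟪covOp H P X a, a'⟫_ℝ = ∫ ω, ⟪a, feature H (X ω) - meanElement H P X⟫_ℝ *
      ⟪a', feature H (X ω) - meanElement H P X⟫_ℝ ∂P := by
  have hI : Integrable (fun ω => feature H (X ω)) P :=
    Integrable.of_bound hΦ b (ae_of_all _ fun ω => hb _)
  have hin : ∀ a : H, Integrable (fun ω => ⟪a, feature H (X ω)⟫_ℝ) P := fun a =>
    hI.const_inner a
  have hinb : ∀ (a : H) ω, ‖⟪a, feature H (X ω)⟫_ℝ‖ ≤ ‖a‖ * b := fun a ω =>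
    (norm_inner_le_norm _ _).trans (mul_le_mul_of_nonneg_left (hb _) (norm_nonneg _))
  have hII : Integrable (fun ω => ⟪a, feature H (X ω)⟫_ℝ * ⟪a', feature H (X ω)⟫_ℝ) P :=
    (hin a).mul_bdd (hin a').aestronglyMeasurable (ae_of_all _ (hinb a'))
  have hrc : Continuous fun x : H => rankOne ℝ x x :=
    ((rankOne ℝ (E := H) (F := H)).continuous).clm_apply continuous_id
  have hR : Integrable (fun ω => rankOne ℝ (feature H (X ω)) (feature H (X ω))) P := by
    refine Integrable.of_bound (hrc.comp_aestronglyMeasurable hΦ) (b * b) (ae_of_all _ fun ω => ?_)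
    rw [norm_rankOne]
    exact mul_le_mul (hb _) (hb _) (norm_nonneg _) ((norm_nonneg _).trans (hb (X ω)))
  have hm : ∀ a : H, ∫ ω, ⟪a, feature H (X ω)⟫_ℝ ∂P = ⟪a, meanElement H P X⟫_ℝ := fun a => by
    rw [integral_inner hI, meanElement]
  have hRa : Integrable (fun ω => rankOne ℝ (feature H (X ω)) (feature H (X ω)) a) P :=
    hR.apply_continuousLinearMap a
  rw [covOp, sub_apply, ContinuousLinearMap.integral_apply hR, inner_sub_left,
    real_inner_comm, ← integral_inner hRa]
  have e : ∀ ω, ⟪a, feature H (X ω) - meanElement H P X⟫_ℝ *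
      ⟪a', feature H (X ω) - meanElement H P X⟫_ℝ =
      ⟪a, feature H (X ω)⟫_ℝ * ⟪a', feature H (X ω)⟫_ℝ -
        (⟪a', meanElement H P X⟫_ℝ * ⟪a, feature H (X ω)⟫_ℝ +
        ⟪a, meanElement H P X⟫_ℝ * ⟪a', feature H (X ω)⟫_ℝ) +
        ⟪a, meanElement H P X⟫_ℝ * ⟪a', meanElement H P X⟫_ℝ := fun ω => by
    rw [inner_sub_right, inner_sub_right]; ring
  have hL : Integrable (fun ω => ⟪a', meanElement H P X⟫_ℝ * ⟪a, feature H (X ω)⟫_ℝ +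
      ⟪a, meanElement H P X⟫_ℝ * ⟪a', feature H (X ω)⟫_ℝ) P :=
    ((hin a).const_mul _).add ((hin a').const_mul _)
  have hD : Integrable (fun ω => ⟪a, feature H (X ω)⟫_ℝ * ⟪a', feature H (X ω)⟫_ℝ -
      (⟪a', meanElement H P X⟫_ℝ * ⟪a, feature H (X ω)⟫_ℝ +
        ⟪a, meanElement H P X⟫_ℝ * ⟪a', feature H (X ω)⟫_ℝ)) P := hII.sub hL
  simp_rw [e]
  rw [integral_add hD (integrable_const _), integral_sub hII hL,
    integral_add ((hin a).const_mul _) ((hin a').const_mul _), integral_const_mul,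
    integral_const_mul, hm, hm]
  simp only [rankOne_apply, real_inner_smul_right, integral_const, probReal_univ, one_smul,
    real_inner_comm a, real_inner_comm a']
  ring

/-- The centred feature map agrees, almost surely for the law of `X`, with a bounded strongly
measurable map, whose covariance operator is that of `X`. -/
lemma exists_centredFeature (hK : Continuous fun p : 𝒳 × 𝒳 => kern H p.1 p.2)
    (hKb : BoundedKernel (𝒳 := 𝒳) H) (hX : Measurable X)
    (hΦ : AEStronglyMeasurable (fun ω => feature H (X ω)) P) :
    ∃ (u : 𝒳 → H) (b : ℝ), (∀ C, b ≤ C → CentredFeature (P.map X) u (covOp H P X) C) ∧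
      ∀ᵐ x ∂(P.map X), u x = feature H x - meanElement H P X := by
  obtain ⟨b, hb⟩ := exists_norm_feature_le hKb
  have hm := aestronglyMeasurable_feature hK hX hΦ
  set m := meanElement H P X with hmdef
  have hI : Integrable (fun ω => feature H (X ω)) P :=
    Integrable.of_bound hΦ b (ae_of_all _ fun ω => hb _)
  have hgm : StronglyMeasurable fun x => hm.mk _ x - m :=
    hm.stronglyMeasurable_mk.sub stronglyMeasurable_const
  let s : Set 𝒳 := {x | ‖hm.mk _ x - m‖ ≤ b + ‖m‖}
  have hs : MeasurableSet s := measurableSet_le hgm.norm.measurable measurable_const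
  have hae : ∀ᵐ x ∂(P.map X), s.indicator (fun x => hm.mk _ x - m) x = feature H x - m := by
    filter_upwards [hm.ae_eq_mk] with x hx
    have hxs : x ∈ s := by
      change ‖hm.mk _ x - m‖ ≤ b + ‖m‖
      rw [← hx]
      exact (norm_sub_le _ _).trans (by linarith [hb x])
    rw [Set.indicator_of_mem hxs, ← hx]
  have hum := hgm.indicator hs
  refine ⟨s.indicator fun x => hm.mk _ x - m, max 1 (b + ‖m‖), fun C hC => ?_, hae⟩
  have hC1 := (le_max_left _ _).trans hC
  have hint : ∀ f : H → ℝ, Continuous f →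
      ∫ x, f (s.indicator (fun x => hm.mk _ x - m) x) ∂(P.map X) =
        ∫ ω, f (feature H (X ω) - m) ∂P := by
    intro f hf
    rw [integral_map hX.aemeasurable (hf.comp_stronglyMeasurable hum).aestronglyMeasurable]
    refine integral_congr_ae ?_
    filter_upwards [ae_of_ae_map hX.aemeasurable hae] with ω hω
    rw [hω]
  refine ⟨hum, hC1, fun x => ?_, fun w => ?_, fun a a' => ?_⟩
  · by_cases hx : x ∈ s
    · rw [Set.indicator_of_mem hx]
      exact (le_trans hx (le_max_right _ _)).trans hC
    · rw [Set.indicator_of_notMem hx, norm_zero]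
      exact zero_le_one.trans hC1
  · rw [hint (fun y => ⟪w, y⟫_ℝ) (by fun_prop)]
    simp_rw [inner_sub_right]
    rw [integral_sub (hI.const_inner w) (integrable_const _), integral_inner hI]
    simp [hmdef, meanElement]
  · rw [hint (fun y => ⟪a, y⟫_ℝ * ⟪a', y⟫_ℝ) (by fun_prop), inner_covOp hΦ hb]

end Feature

/-- With no observations the statistic is a constant. -/
lemma statT_zero {𝒳 𝒴 : Type*} (HX HY : Type*)
    [NormedAddCommGroup HX] [InnerProductSpace ℝ HX] [CompleteSpace HX] [RKHS ℝ HX 𝒳 ℝ]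
    [NormedAddCommGroup HY] [InnerProductSpace ℝ HY] [CompleteSpace HY] [RKHS ℝ HY 𝒴 ℝ]
    (γ : ℝ) (x x' : ℕ → 𝒳) (y y' : ℕ → 𝒴) :
    statT HX HY γ 0 x y = statT HX HY γ 0 x' y' := by
  simp [statT, empD, empCov]

end NOCCO

theorem theorem1
    {𝒳 𝒴 Ω HX HY : Type*}
    [MetricSpace 𝒳] [MeasurableSpace 𝒳] [BorelSpace 𝒳]
    [MetricSpace 𝒴] [MeasurableSpace 𝒴] [BorelSpace 𝒴]
    [NormedAddCommGroup HX] [InnerProductSpace ℝ HX] [CompleteSpace HX] [RKHS ℝ HX 𝒳 ℝ]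
    [NormedAddCommGroup HY] [InnerProductSpace ℝ HY] [CompleteSpace HY] [RKHS ℝ HY 𝒴 ℝ]
    [MeasurableSpace Ω] (P : Measure Ω) [IsProbabilityMeasure P]
    -- the pair `(X, Y)`
    (X : Ω → 𝒳) (Y : Ω → 𝒴) (hX : Measurable X) (hY : Measurable Y)
    -- `K(X, ·)` and `L(Y, ·)` are strongly measurable (automatic for separable `𝒳`, `𝒴`)
    (hΦ : AEStronglyMeasurable (fun ω => NOCCO.feature HX (X ω)) P)
    (hΨ : AEStronglyMeasurable (fun ω => NOCCO.feature HY (Y ω)) P)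
    -- the i.i.d. sample of `(X, Y)`
    (Xs : ℕ → Ω → 𝒳) (Ys : ℕ → Ω → 𝒴)
    (h_indep : iIndepFun (fun i ω => (Xs i ω, Ys i ω)) P)
    (h_ident : ∀ i, IdentDistrib (fun ω => (Xs i ω, Ys i ω)) (fun ω => (X ω, Y ω)) P P)
    -- the regularisation sequence
    (γ : ℕ → ℝ) (hγ_pos : ∀ n, 1 ≤ n → 0 < γ n) (hγ_zero : Tendsto γ atTop (𝓝 0))
    -- bounded universal kernels
    (hK_univ : NOCCO.UniversalKernel HX) (hK_bdd : NOCCO.BoundedKernel HX)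
    (hL_univ : NOCCO.UniversalKernel HY) (hL_bdd : NOCCO.BoundedKernel HY)
    -- summable square roots of the eigenvalues of the covariance operators
    (hX_sum : Summable fun p => √(NOCCO.eig (NOCCO.covOp HX P X) p))
    (hY_sum : Summable fun q => √(NOCCO.eig (NOCCO.covOp HY P Y) q))
    -- infinitely many strictly positive eigenvalues
    (hX_inf : Infinite (NOCCO.PosEig (NOCCO.covOp HX P X)))
    (hY_inf : Infinite (NOCCO.PosEig (NOCCO.covOp HY P Y)))
    -- the rate of the regularisation sequence
    (hγ_rate : Tendsto (fun n : ℕ => (γ n ^ 6)⁻¹ * (n : ℝ)⁻¹) atTop (𝓝 0))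
    -- the null hypothesis
    (h_null : IndepFun X Y P) :
    TendstoInDistribution
      (fun (n : ℕ) (ω : Ω) =>
        NOCCO.statT HX HY (γ n) n (fun i => Xs i ω) (fun i => Ys i ω))
      atTop (id : ℝ → ℝ) (fun _ => P) (gaussianReal 0 1) := by
  obtain ⟨u, b, hu, hu'⟩ := NOCCO.exists_centredFeature hK_univ.1 hK_bdd hX hΦ
  obtain ⟨v, c, hv, hv'⟩ := NOCCO.exists_centredFeature hL_univ.1 hL_bdd hY hΨ
  replace hu := hu _ (le_max_left b c)
  replace hv := hv _ (le_max_right b c)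
  have : IsProbabilityMeasure (P.map X) := Measure.isProbabilityMeasure_map hX.aemeasurable
  have : IsProbabilityMeasure (P.map Y) := Measure.isProbabilityMeasure_map hY.aemeasurable
  have hXY : ∀ i, AEMeasurable (fun ω => (Xs i ω, Ys i ω)) P := fun i =>
    (h_ident i).aemeasurable_fst
  have hXs : ∀ i, AEMeasurable (Xs i) P := fun i => (hXY i).fst
  have hYs : ∀ i, AEMeasurable (Ys i) P := fun i => (hXY i).snd
  have mapX : ∀ i, P.map (Xs i) = P.map X := fun i =>
    ((h_ident i).comp measurable_fst).map_eq
  have mapY : ∀ i, P.map (Ys i) = P.map Y := fun i =>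
    ((h_ident i).comp measurable_snd).map_eq
  have hZ : ∀ n : ℕ, AEMeasurable (fun ω (i : Fin n) => (Xs i ω, Ys i ω)) P := fun n =>
    aemeasurable_pi_lambda _ fun i => hXY i
  have hlaw : ∀ n : ℕ, P.map (fun ω (i : Fin n) => (Xs i ω, Ys i ω)) =
      Measure.pi fun _ => (P.map X).prod (P.map Y) := fun n => by
    rw [(iIndepFun_iff_map_fun_eq_pi_map fun i : Fin n => hXY i).1
      (h_indep.precomp Fin.val_injective)]
    congr 1
    funext i
    rw [(h_ident i).map_eq, (indepFun_iff_map_prod_eq_prod_map_map hX.aemeasurable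
      hY.aemeasurable).1 h_null]
  have hγ : ∀ᶠ n in atTop, 0 < γ n := (eventually_ge_atTop 1).mono hγ_pos
  have hrate : Tendsto (fun n : ℕ => (γ n ^ 3)⁻¹ * (√n)⁻¹) atTop (𝓝 0) := by
    have h := (Real.continuous_sqrt.tendsto 0).comp hγ_rate
    rw [Real.sqrt_zero] at h
    refine h.congr' (hγ.mono fun n hn => ?_)
    rw [Function.comp_apply, Real.sqrt_mul (by positivity), Real.sqrt_inv, Real.sqrt_inv,
      show γ n ^ 6 = (γ n ^ 3) ^ 2 by ring, Real.sqrt_sq (by positivity)]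
  have hXae : ∀ᵐ ω ∂P, ∀ i, u (Xs i ω) = NOCCO.feature HX (Xs i ω) - NOCCO.meanElement HX P X :=
    ae_all_iff.2 fun i => ae_of_ae_map (hXs i) (by rw [mapX]; exact hu')
  have hYae : ∀ᵐ ω ∂P, ∀ i, v (Ys i ω) = NOCCO.feature HY (Ys i ω) - NOCCO.meanElement HY P Y :=
    ae_all_iff.2 fun i => ae_of_ae_map (hYs i) (by rw [mapY]; exact hv')
  have hmeas : ∀ n, AEMeasurable (fun ω =>
      NOCCO.statT HX HY (γ n) n (fun i => Xs i ω) (fun i => Ys i ω)) P := by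
    intro n
    rcases Nat.eq_zero_or_pos n with rfl | hn
    -- `γ 0` may have any sign, but the statistic of an empty sample is constant
    · by_cases hΩ : Nonempty Ω
      · obtain ⟨ω₀⟩ := hΩ
        simp_rw [fun ω => NOCCO.statT_zero HX HY (γ 0) (fun i => Xs i ω) (fun i => Xs i ω₀)
          (fun i => Ys i ω) (fun i => Ys i ω₀)]
        exact aemeasurable_const
      · have := not_nonempty_iff.1 hΩ
        exact (measurable_of_empty _).aemeasurable
    · simp_rw [NOCCO.statT_eq_gramStat HX HY (hγ_pos n hn) hn]
      refine NOCCO.aemeasurable_gramStat (hγ_pos n hn) (fun i => ?_) fun i => ?_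
      · have h := NOCCO.aestronglyMeasurable_feature hK_univ.1 hX hΦ
        rw [← mapX i] at h
        exact h.comp_aemeasurable (hXs i)
      · have h := NOCCO.aestronglyMeasurable_feature hL_univ.1 hY hΨ
        rw [← mapY i] at h
        exact h.comp_aemeasurable (hYs i)
  refine tendstoInDistribution_of_tendstoInMeasure_sub _ _
    (hu.tendstoInDistribution_popStat hv hX_inf hY_inf hγ hγ_zero hrate hZ hlaw) ?_ hmeas
  refine TendstoInMeasure.congr' ?_ EventuallyEq.rfl
    (hu.tendstoInMeasure_gramStat_sub_popStat hv hX_inf hY_inf hγ hγ_zero hrate hZ hlaw)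
  filter_upwards [eventually_ge_atTop 1] with n hn
  have : Nonempty (Fin n) := ⟨⟨0, hn⟩⟩
  filter_upwards [hXae, hYae] with ω h1 h2
  simp only [h1, h2, Pi.sub_apply]
  rw [NOCCO.gramStat_sub_const, NOCCO.statT_eq_gramStat HX HY (hγ_pos n hn) hn]
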